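/- Throughout, $[n]=\{1,\dots,n\}$, and $n,k_1,k_2,t$ are positive integers. A *partition* is a set of pairwise disjoint non-empty sets, called blocks. For $k\ge 1$ let ${[n]\brace k}$ be the set of all partitions of $[n]$ into exactly $k$ blocks. For a family $\mathcal F$ of partitions let $\cap\mathcal F$ be the set of blocks that belong to every member of $\mathcal F$. Families $\mathcal F_1\subseteq{[n]\brace k_1}$ and $\mathcal F_2\subseteq{[n]\brace k_2}$ are *cross $t$-intersecting* if $|F_1\cap F_2|\ge t$ (at least $t$ common blocks) for all $F_1\in\mathcal F_1$, $F_2\in\mathcal F_2$, and *non-trivial* if $|(\cap\mathcal F_1)\cap(\cap\mathcal F_2)|<t$. Two pairs of families $(\mathcal F,\mathcal G)$ and $(\mathcal F',\mathcal G')$ are *isomorphic* if a single permutation of $[n]$ maps $\mathcal F$ to $\mathcal F'$ and $\mathcal G$ to $\mathcal G'$. Put $$L(k,t)=(t+1)+(k-t+1)\log_2\big((t+1)(k-t+1)\big),\qquad [[b]]=\{\{1\},\{2\},\dots,\{b\}\},$$ and define $$\mathcal A(k,\ell,t)=\Big\{F\in{[n]\brace k}:[[t]]\subseteq F,\ F\cap([[\ell]]\setminus[[t]])\ne\emptyset\Big\},$$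 $$\mathcal B(\ell,t)=\Big\{F\in{[n]\brace \ell}:[[t]]\subseteq F\Big\}\cup\Big\{([[\ell]]\setminus\{\{i\}\})\cup\{\{i\}\cup\{\ell+1,\dots,n\}\}:1\le i\le t\Big\},$$ $$\mathcal C(k,t)=\Big\{F\in{[n]\brace k}:[[t+1]]\subseteq F\Big\},\qquad \mathcal D(\ell,t)=\Big\{F\in{[n]\brace \ell}:|F\cap[[t+1]]|\ge t\Big\}.$$ **Theorem.** Let $k_1\ge k_2\ge t+2$, $(k_1,k_2)\ne(3,3)$ and $n\ge 2L(k_1,t)$. Suppose that $\mathcal F_1\subseteq{[n]\brace k_1}$ and $\mathcal F_2\subseteq{[n]\brace k_2}$ are non-trivial cross $t$-intersecting families whose product of sizes $|\mathcal F_1||\mathcal F_2|$ is maximum among all such pairs. Then $(\mathcal F_1,\mathcal F_2)$ is isomorphic to one of $$(\mathcal A(k_1,k_2,t),\mathcal B(k_2,t)),\quad(\mathcal B(k_1,t),\mathcal A(k_2,k_1,t)),\quad(\mathcal C(k_1,t),\mathcal D(k_2,t)),\quad(\mathcal D(k_1,t),\mathcal C(k_2,t)).$$ -/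

import Mathlib

/-- Families of partitions of the ground set `[n]`, modelled as `Fin n`: a block is a
`Finset (Fin n)`, a partition is the finite set of its blocks, and a family is a finite set of
partitions. -/
abbrev PartFamily (n : ℕ) : Type := Finset (Finset (Finset (Fin n)))

open Classical in
/-- The family of all `k`-partitions of `[n]`: sets of `k` pairwise disjoint non-empty blocks whose
union is `[n]`. -/
noncomputable def kPartitions (n k : ℕ) : PartFamily n :=
  Finset.univ.filter fun F =>
    F.card = k ∧ ∃ P : Finpartition (Finset.univ : Finset (Fin n)), P.parts = F

/-- `L(k,t) = (t+1) + (k-t+1) log₂((t+1)(k-t+1))`, as a real number. -/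
noncomputable def boundL (k t : ℕ) : ℝ :=
  ((t : ℝ) + 1) + ((k : ℝ) - t + 1) * Real.logb 2 (((t : ℝ) + 1) * ((k : ℝ) - t + 1))

/-- Any member of the first family shares at least `t` blocks with any member of the second. -/
def CrossIntersecting {n : ℕ} (t : ℕ) (𝓕 𝓖 : PartFamily n) : Prop :=
  ∀ F ∈ 𝓕, ∀ G ∈ 𝓖, t ≤ (F ∩ G).card

/-- `∩𝓕`: the set of blocks that lie in every member of `𝓕`. -/
def commonBlocks {n : ℕ} (𝓕 : PartFamily n) : Finset (Finset (Fin n)) :=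
  Finset.univ.filter fun B => ∀ F ∈ 𝓕, B ∈ F

/-- The pair is non-trivial: `|(∩𝓕) ∩ (∩𝓖)| < t`. -/
def NonTrivialPair {n : ℕ} (t : ℕ) (𝓕 𝓖 : PartFamily n) : Prop :=
  (commonBlocks 𝓕 ∩ commonBlocks 𝓖).card < t

/-- `𝓕` and `𝓖` are non-trivial cross `t`-intersecting families of `k₁`-partitions and
`k₂`-partitions of `[n]`, respectively. -/
def IsNonTrivialCross {n : ℕ} (k₁ k₂ t : ℕ) (𝓕 𝓖 : PartFamily n) : Prop :=
  𝓕 ⊆ kPartitions n k₁ ∧ 𝓖 ⊆ kPartitions n k₂ ∧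
    CrossIntersecting t 𝓕 𝓖 ∧ NonTrivialPair t 𝓕 𝓖

/-- `[[b]] = {{1}, …, {b}}`: the first `b` singletons (the first `b` points of `Fin n`). -/
def singletonBlocks (n b : ℕ) : Finset (Finset (Fin n)) :=
  (Finset.univ.filter fun i : Fin n => (i : ℕ) < b).image fun i => {i}

/-- `𝓐(k, X, M)`: the `k`-partitions of `[n]` that contain `X` and some block of `M \ X`. -/
noncomputable def familyA {n : ℕ} (k : ℕ) (X M : Finset (Finset (Fin n))) : PartFamily n :=
  (kPartitions n k).filter fun F => X ⊆ F ∧ (F ∩ (M \ X)).Nonempty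

/-- `𝓑(ℓ, X, M)`: the `ℓ`-partitions of `[n]` that contain `X`, together with the partitions
`(M \ {B}) ∪ {B ∪ ([n] \ ⋃ M)}` for `B ∈ X`. -/
noncomputable def familyB {n : ℕ} (l : ℕ) (X M : Finset (Finset (Fin n))) : PartFamily n :=
  ((kPartitions n l).filter fun F => X ⊆ F) ∪
    X.image fun B => (M \ {B}) ∪ {B ∪ (M.sup id)ᶜ}

/-- `𝓒(k, T)`: the `k`-partitions of `[n]` that contain `T`. -/
noncomputable def familyC {n : ℕ} (k : ℕ) (T : Finset (Finset (Fin n))) : PartFamily n :=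
  (kPartitions n k).filter fun F => T ⊆ F

/-- `𝓓(ℓ, T)`: the `ℓ`-partitions of `[n]` that share at least `t` blocks with `T`. -/
noncomputable def familyD {n : ℕ} (l t : ℕ) (T : Finset (Finset (Fin n))) : PartFamily n :=
  (kPartitions n l).filter fun F => t ≤ (T ∩ F).card

/-- `𝓐(k, ℓ, t) = 𝓐(k, [[t]], [[ℓ]])` over the ground set `[n]`. -/
noncomputable def stdA (n k l t : ℕ) : PartFamily n :=
  familyA k (singletonBlocks n t) (singletonBlocks n l)

/-- `𝓑(ℓ, t) = 𝓑(ℓ, [[t]], [[ℓ]])` over the ground set `[n]`. -/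
noncomputable def stdB (n l t : ℕ) : PartFamily n :=
  familyB l (singletonBlocks n t) (singletonBlocks n l)

/-- `𝓒(k, t) = 𝓒(k, [[t+1]])` over the ground set `[n]`. -/
noncomputable def stdC (n k t : ℕ) : PartFamily n :=
  familyC k (singletonBlocks n (t + 1))

/-- `𝓓(ℓ, t) = 𝓓(ℓ, [[t+1]])` over the ground set `[n]`. -/
noncomputable def stdD (n l t : ℕ) : PartFamily n :=
  familyD l t (singletonBlocks n (t + 1))

/-- The image of a family under a permutation of the ground set. -/
def permFamily {n : ℕ} (σ : Equiv.Perm (Fin n)) (𝓕 : PartFamily n) : PartFamily n :=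
  𝓕.image fun F => F.image fun B => B.image σ

/-- `(𝓕, 𝓖) ≅ (𝓕', 𝓖')`: one permutation of `[n]` takes `𝓕` to `𝓕'` and `𝓖` to `𝓖'`. -/
def PairIso {n : ℕ} (𝓕 𝓖 𝓕' 𝓖' : PartFamily n) : Prop :=
  ∃ σ : Equiv.Perm (Fin n), permFamily σ 𝓕 = 𝓕' ∧ permFamily σ 𝓖 = 𝓖'

/-!
Write `p = k₁ - t` and `Q = (t + 1) (p + 1)`, and let `S(n - s, k - s)` (`starSize n k s`) count the
`k`-partitions of `[n]` that contain `s` given singletons. No `s` blocks, `s < k`, lie in more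
`k`-partitions than `s` singletons do, and a block with two points costs at least a factor `2`. The
hypothesis `n ≥ 2 L(k₁, t)` enters mainly through the ratio
`S(n - s, k - s) ≥ (Q² / 2) S(n - s - 1, k - s - 1)` for `t ≤ s ≤ k - 2`
(`IsLarge.sq_mul_starSize_le`) and through the far larger last ratio, between `s = k - 2` and
`s = k - 1` (`IsLarge.pow_le_starSize_sub_two`). Every prescribed block is thus expensive, and the
proof counts how many blocks are forced.

Let `𝓕` (`k`-partitions) and `𝓖` (`l`-partitions) be the two families, in either order. Call a set
`T` of blocks a cover of `𝓕` if it shares `t` blocks with every member of `𝓕`. If `H` has at least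
`t` blocks and is not a cover of `𝓖`, some `G ∈ 𝓖` shares fewer than `t` blocks with `H`, and every
member of `𝓕` that contains `H` contains one of at most `l - t` further blocks of `G`
(`exists_transversal`). Iterating this until the size of a smallest cover of `𝓖` is reached bounds
the stars of `𝓕` (`card_starOf_le_pow_mul`); summing over the `t`-subsets of a smallest cover of `𝓕`
bounds `𝓕` itself (`card_le_choose_mul`). An optimal pair has to beat `(𝓓, 𝓒)`, whose product is
about `(t + 1) S(n - t, k - t) S(n - t - 1, l - t - 1)`, and `(𝓑, 𝓐)`, whose product is about
`k - t` times the same two Stirling numbers.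

If neither family has a cover with `t` blocks, the bounds are too small
(`IsOptimal.exists_isCover`). So let the `t` blocks of `X` lie in all members of `𝓖`, and suppose
`l ≥ t + 3`. A smallest cover `T` of `𝓕` must then have exactly `t + 1` blocks. If `T` lies in all
members of `𝓖`, the pair is contained in a pair of type `(𝓓, 𝓒)`. Otherwise `X` is the set of all
common blocks of `𝓖`, it is contained in `T`, and the transversal lemma gives a set `Y` of at most
`k - t` blocks such that each member of `𝓖` contains a block of `Y`. Beating the two standard pairs
forces `Y` to consist of `k - t` blocks each of which extends `X` to a cover of `𝓕`, and all blocks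
of `X ∪ Y` to be singletons; then the pair is contained in a pair of type `(𝓑, 𝓐)`
(`IsOptimal.pairIso_of_isCover`). Since the standard pairs are themselves non-trivial and
cross-intersecting, optimality turns containment into equality, up to the permutation that moves the
singletons to the front (`IsOptimal.pairIso_stdD`, `IsOptimal.pairIso_stdB`).

For `l = t + 2` the ratio estimate is not available at `s = t + 1`, where only one partition
contains `t + 1` given blocks. If `k > t + 2`, such a `𝓖` is too small
(`IsOptimal.not_isCover_of_lt`). If `k = t + 2`, then `(𝓓, 𝓒)` has product about
`(t + 1) S(n - t, 2)`, while a family `𝓖` without `t + 1` common blocks has at most two members and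
gives about `2 S(n - t, 2)`. This is too small for `t ≥ 2`, but for `t = 1` the two products agree
to leading order; hence the exclusion of `(k₁, k₂) = (3, 3)`. The remaining case is a single
partition `𝓖 = {G}`, where all blocks of `G` but a largest one turn out to be singletons
(`IsOptimal.pairIso_of_isCover_of_eq`).
-/

/-! ### Partitions of a finite set and Stirling numbers -/

/-- `F` is a partition of the finite set `V`: its blocks are non-empty, two blocks that share a
point are equal, and the blocks cover exactly `V`. -/
def IsPartitionOf {α : Type*} (V : Finset α) (F : Finset (Finset α)) : Prop :=
  (∀ B ∈ F, B.Nonempty) ∧ (∀ B ∈ F, ∀ C ∈ F, ∀ x, x ∈ B → x ∈ C → B = C) ∧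
    ∀ x, x ∈ V ↔ ∃ B ∈ F, x ∈ B

open Classical in
/-- The partitions of `V` into exactly `k` blocks. -/
noncomputable def partitionsInto {α : Type*} (V : Finset α) (k : ℕ) :
    Finset (Finset (Finset α)) :=
  V.powerset.powerset.filter fun F => F.card = k ∧ IsPartitionOf V F

theorem mem_partitionsInto {α : Type*} {V : Finset α} {k : ℕ} {F : Finset (Finset α)} :
    F ∈ partitionsInto V k ↔ F.card = k ∧ IsPartitionOf V F := by
  simp only [partitionsInto, Finset.mem_filter, Finset.mem_powerset, and_iff_right_iff_imp]
  rintro ⟨-, h⟩ B hB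
  rw [Finset.mem_powerset]
  exact fun x hx => (h.2.2 x).2 ⟨B, hB, hx⟩

theorem mem_kPartitions {n k : ℕ} {F : Finset (Finset (Fin n))} :
    F ∈ kPartitions n k ↔ F.card = k ∧ IsPartitionOf Finset.univ F := by
  simp only [kPartitions, Finset.mem_filter, Finset.mem_univ, true_and]
  refine and_congr_right fun _ => ⟨?_, ?_⟩
  · rintro ⟨P, rfl⟩
    refine ⟨fun B hB => P.nonempty_of_mem_parts hB, fun B hB C hC x hxB hxC => ?_, fun x => ?_⟩
    · by_contra hne
      exact Finset.disjoint_left.1 (P.disjoint hB hC hne) hxB hxC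
    · simpa using P.exists_mem (Finset.mem_univ x)
  · rintro ⟨h1, h2, h3⟩
    refine ⟨⟨F, ?_, ?_, ?_⟩, rfl⟩
    · rw [Finset.supIndep_iff_pairwiseDisjoint]
      intro B hB C hC hne
      rw [Function.onFun, Finset.disjoint_left]
      exact fun x hx hx' => hne (h2 B hB C hC x hx hx')
    · ext x
      simpa [Finset.mem_sup] using (h3 x)
    · intro h
      simpa using h1 _ h

theorem partitionsInto_zero {α : Type*} [DecidableEq α] {V : Finset α} (hV : V.Nonempty) :
    partitionsInto V 0 = ∅ := by
  ext F
  simp only [mem_partitionsInto, Finset.card_eq_zero, Finset.notMem_empty, iff_false, not_and]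
  rintro rfl h
  obtain ⟨x, hx⟩ := hV
  simpa using (h.2.2 x).1 hx

/-- The partitions of `V ∪ {a}` in which `a` is a block of its own are the partitions of `V` with
the block `{a}` added. -/
theorem card_partitions_with_singleton {α : Type*} [DecidableEq α] {V : Finset α} {a : α}
    (ha : a ∉ V) (k : ℕ) :
    ((partitionsInto (insert a V) (k + 1)).filter fun F => {a} ∈ F).card =
      (partitionsInto V k).card := by
  refine Finset.card_bij' (fun F _ => F.erase {a}) (fun F _ => insert {a} F) ?_ ?_ ?_ ?_
  · intro F hF
    rw [Finset.mem_filter, mem_partitionsInto] at hF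
    obtain ⟨⟨hc, h1, h2, h3⟩, hmem⟩ := hF
    rw [mem_partitionsInto, Finset.card_erase_of_mem hmem, hc]
    refine ⟨rfl, fun B hB => h1 B (Finset.mem_of_mem_erase hB), fun B hB C hC =>
      h2 B (Finset.mem_of_mem_erase hB) C (Finset.mem_of_mem_erase hC), fun x => ?_⟩
    constructor
    · intro hx
      obtain ⟨B, hB, hxB⟩ := (h3 x).1 (Finset.mem_insert_of_mem hx)
      refine ⟨B, Finset.mem_erase.2 ⟨?_, hB⟩, hxB⟩
      rintro rfl
      rw [Finset.mem_singleton] at hxB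
      exact ha (hxB ▸ hx)
    · rintro ⟨B, hB, hxB⟩
      rw [Finset.mem_erase] at hB
      have := (h3 x).2 ⟨B, hB.2, hxB⟩
      rw [Finset.mem_insert] at this
      rcases this with rfl | h
      · exact absurd (h2 B hB.2 _ hmem x hxB (Finset.mem_singleton_self x)) hB.1
      · exact h
  · intro F hF
    rw [mem_partitionsInto] at hF
    obtain ⟨hc, h1, h2, h3⟩ := hF
    have hno : ∀ B ∈ F, a ∉ B := fun B hB haB => ha ((h3 a).2 ⟨B, hB, haB⟩)
    have hmem : ({a} : Finset α) ∉ F := fun h => hno _ h (Finset.mem_singleton_self a)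
    rw [Finset.mem_filter, mem_partitionsInto, Finset.card_insert_of_notMem hmem, hc]
    refine ⟨⟨rfl, ?_, ?_, ?_⟩, Finset.mem_insert_self _ _⟩
    · intro B hB
      rcases Finset.mem_insert.1 hB with rfl | hB
      · exact Finset.singleton_nonempty a
      · exact h1 B hB
    · intro B hB C hC x hxB hxC
      rcases Finset.mem_insert.1 hB with rfl | hB <;> rcases Finset.mem_insert.1 hC with rfl | hC
      · rfl
      · rw [Finset.mem_singleton] at hxB
        exact absurd (hxB ▸ hxC) (hno C hC)
      · rw [Finset.mem_singleton] at hxC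
        exact absurd (hxC ▸ hxB) (hno B hB)
      · exact h2 B hB C hC x hxB hxC
    · intro x
      rw [Finset.mem_insert, h3]
      simp
  · intro F hF
    exact Finset.insert_erase (Finset.mem_filter.1 hF).2
  · intro F hF
    rw [mem_partitionsInto] at hF
    refine Finset.erase_insert fun h => ha ((hF.2.2.2 a).2 ⟨_, h, Finset.mem_singleton_self a⟩)

/-- A partition of `V ∪ {a}` in which `a` has company arises from a partition of `V` by adding `a`
to one of its blocks. -/
theorem card_partitions_without_singleton {α : Type*} [DecidableEq α] {V : Finset α} {a : α}
    (ha : a ∉ V) (k : ℕ) :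
    ((partitionsInto (insert a V) k).filter fun F => {a} ∉ F).card =
      k * (partitionsInto V k).card := by
  have hsig : ((partitionsInto V k).sigma fun F => F).card = k * (partitionsInto V k).card := by
    rw [Finset.card_sigma, Finset.sum_const_nat (m := k), mul_comm]
    intro F hF
    exact (mem_partitionsInto.1 hF).1
  rw [← hsig]
  symm
  refine Finset.card_bij (fun P _ => insert (insert a P.2) (P.1.erase P.2)) ?_ ?_ ?_
  · rintro ⟨F, B⟩ hFB
    rw [Finset.mem_sigma, mem_partitionsInto] at hFB
    obtain ⟨⟨hc, h1, h2, h3⟩, hB⟩ := hFB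
    dsimp only at hc h1 h2 h3 hB ⊢
    have hno : ∀ B ∈ F, a ∉ B := fun B hB haB => ha ((h3 a).2 ⟨B, hB, haB⟩)
    have hnew : insert a B ∉ F.erase B := fun h =>
      hno _ (Finset.mem_of_mem_erase h) (Finset.mem_insert_self a B)
    rw [Finset.mem_filter, mem_partitionsInto, Finset.card_insert_of_notMem hnew,
      Finset.card_erase_of_mem hB, hc]
    have hpos : 0 < k := hc ▸ Finset.card_pos.2 ⟨B, hB⟩
    refine ⟨⟨by omega, ?_, ?_, ?_⟩, ?_⟩
    · intro C hC
      rcases Finset.mem_insert.1 hC with rfl | hC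
      · exact Finset.insert_nonempty a B
      · exact h1 C (Finset.mem_of_mem_erase hC)
    · intro C hC D hD x hxC hxD
      rcases Finset.mem_insert.1 hC with rfl | hC <;> rcases Finset.mem_insert.1 hD with rfl | hD
      · rfl
      · have hD' := Finset.mem_erase.1 hD
        rcases Finset.mem_insert.1 hxC with rfl | hxC
        · exact absurd hxD (hno D hD'.2)
        · exact absurd (h2 D hD'.2 B hB x hxD hxC) hD'.1
      · have hC' := Finset.mem_erase.1 hC
        rcases Finset.mem_insert.1 hxD with rfl | hxD
        · exact absurd hxC (hno C hC'.2)
        · exact absurd (h2 C hC'.2 B hB x hxC hxD) hC'.1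
      · exact h2 C (Finset.mem_of_mem_erase hC) D (Finset.mem_of_mem_erase hD) x hxC hxD
    · intro x
      rw [Finset.mem_insert, h3]
      constructor
      · rintro (rfl | ⟨C, hC, hxC⟩)
        · exact ⟨_, Finset.mem_insert_self _ _, Finset.mem_insert_self _ _⟩
        · by_cases hCB : C = B
          · subst hCB
            exact ⟨_, Finset.mem_insert_self _ _, Finset.mem_insert_of_mem hxC⟩
          · exact ⟨C, Finset.mem_insert_of_mem (Finset.mem_erase.2 ⟨hCB, hC⟩), hxC⟩
      · rintro ⟨C, hC, hxC⟩
        rcases Finset.mem_insert.1 hC with rfl | hC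
        · rcases Finset.mem_insert.1 hxC with rfl | hxC
          · exact Or.inl rfl
          · exact Or.inr ⟨B, hB, hxC⟩
        · exact Or.inr ⟨C, Finset.mem_of_mem_erase hC, hxC⟩
    · intro h
      rcases Finset.mem_insert.1 h with h | h
      · obtain ⟨y, hy⟩ := h1 B hB
        have : y ∈ ({a} : Finset α) := h ▸ Finset.mem_insert_of_mem hy
        rw [Finset.mem_singleton] at this
        exact hno B hB (this ▸ hy)
      · exact hno _ (Finset.mem_of_mem_erase h) (Finset.mem_singleton_self a)
  · rintro ⟨F, B⟩ hFB ⟨F', B'⟩ hFB' heq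
    rw [Finset.mem_sigma, mem_partitionsInto] at hFB hFB'
    obtain ⟨⟨-, -, -, h3⟩, hB⟩ := hFB
    obtain ⟨⟨-, -, -, h3'⟩, hB'⟩ := hFB'
    dsimp only at h3 h3' hB hB' heq
    have hno : ∀ B ∈ F, a ∉ B := fun B hB haB => ha ((h3 a).2 ⟨B, hB, haB⟩)
    have hno' : ∀ B ∈ F', a ∉ B := fun B hB haB => ha ((h3' a).2 ⟨B, hB, haB⟩)
    have hBB : B = B' := by
      have : insert a B ∈ insert (insert a B') (F'.erase B') :=
        heq ▸ Finset.mem_insert_self _ _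
      rcases Finset.mem_insert.1 this with h | h
      · rw [← Finset.erase_insert (hno B hB), h, Finset.erase_insert (hno' B' hB')]
      · exact absurd (Finset.mem_insert_self a B) (hno' _ (Finset.mem_of_mem_erase h))
    subst hBB
    have : F.erase B = F'.erase B := by
      rw [← Finset.erase_insert (s := F.erase B) (a := insert a B), heq, Finset.erase_insert]
      · exact fun h => hno' _ (Finset.mem_of_mem_erase h) (Finset.mem_insert_self a B)
      · exact fun h => hno _ (Finset.mem_of_mem_erase h) (Finset.mem_insert_self a B)
    have : F = F' := by rw [← Finset.insert_erase hB, this, Finset.insert_erase hB']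
    subst this
    rfl
  · intro F hF
    rw [Finset.mem_filter, mem_partitionsInto] at hF
    obtain ⟨⟨hc, h1, h2, h3⟩, hmem⟩ := hF
    obtain ⟨C, hC, haC⟩ := (h3 a).1 (Finset.mem_insert_self a V)
    have hne : (C.erase a).Nonempty := by
      rw [Finset.nonempty_iff_ne_empty]
      intro h
      refine hmem ?_
      rwa [← Finset.insert_erase haC, h] at hC
    have hother : ∀ D ∈ F.erase C, a ∉ D := fun D hD haD =>
      (Finset.mem_erase.1 hD).1 (h2 D (Finset.mem_of_mem_erase hD) C hC a haD haC)
    have hCe : C.erase a ∉ F.erase C := by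
      intro h
      obtain ⟨y, hy⟩ := hne
      exact (Finset.mem_erase.1 h).1 (h2 _ (Finset.mem_of_mem_erase h) C hC y hy
        (Finset.mem_of_mem_erase hy))
    refine ⟨⟨insert (C.erase a) (F.erase C), C.erase a⟩, ?_, ?_⟩
    · rw [Finset.mem_sigma, mem_partitionsInto]
      dsimp only
      rw [Finset.card_insert_of_notMem hCe, Finset.card_erase_of_mem hC, hc]
      have hpos : 0 < k := hc ▸ Finset.card_pos.2 ⟨C, hC⟩
      refine ⟨⟨by omega, ?_, ?_, ?_⟩, Finset.mem_insert_self _ _⟩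
      · intro D hD
        rcases Finset.mem_insert.1 hD with rfl | hD
        · exact hne
        · exact h1 D (Finset.mem_of_mem_erase hD)
      · intro D hD E hE x hxD hxE
        rcases Finset.mem_insert.1 hD with rfl | hD <;> rcases Finset.mem_insert.1 hE with rfl | hE
        · rfl
        · exact absurd (h2 E (Finset.mem_of_mem_erase hE) C hC x hxE (Finset.mem_of_mem_erase hxD))
            (Finset.mem_erase.1 hE).1
        · exact absurd (h2 D (Finset.mem_of_mem_erase hD) C hC x hxD (Finset.mem_of_mem_erase hxE))
            (Finset.mem_erase.1 hD).1
        · exact h2 D (Finset.mem_of_mem_erase hD) E (Finset.mem_of_mem_erase hE) x hxD hxE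
      · intro x
        constructor
        · intro hx
          have hxa : x ≠ a := fun h => ha (h ▸ hx)
          obtain ⟨D, hD, hxD⟩ := (h3 x).1 (Finset.mem_insert_of_mem hx)
          by_cases hDC : D = C
          · subst hDC
            exact ⟨_, Finset.mem_insert_self _ _, Finset.mem_erase.2 ⟨hxa, hxD⟩⟩
          · exact ⟨D, Finset.mem_insert_of_mem (Finset.mem_erase.2 ⟨hDC, hD⟩), hxD⟩
        · rintro ⟨D, hD, hxD⟩
          have : x ∈ insert a V ∧ x ≠ a := by
            rcases Finset.mem_insert.1 hD with rfl | hD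
            · exact ⟨(h3 x).2 ⟨C, hC, Finset.mem_of_mem_erase hxD⟩, (Finset.mem_erase.1 hxD).1⟩
            · exact ⟨(h3 x).2 ⟨D, Finset.mem_of_mem_erase hD, hxD⟩,
                fun h => hother D hD (h ▸ hxD)⟩
          exact (Finset.mem_insert.1 this.1).resolve_left this.2
    · dsimp only
      rw [Finset.insert_erase haC, Finset.erase_insert hCe, Finset.insert_erase hC]

theorem card_partitionsInto {α : Type*} [DecidableEq α] (V : Finset α) (k : ℕ) :
    (partitionsInto V k).card = Nat.stirlingSecond V.card k := by
  induction V using Finset.induction_on generalizing k with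
  | empty =>
    cases k with
    | zero =>
      rw [Finset.card_empty, Nat.stirlingSecond_zero, Finset.card_eq_one]
      refine ⟨∅, ?_⟩
      ext F
      rw [mem_partitionsInto, Finset.card_eq_zero, Finset.mem_singleton, and_iff_left_iff_imp]
      rintro rfl
      simp [IsPartitionOf]
    | succ k =>
      rw [Finset.card_empty, Nat.stirlingSecond_zero_succ, Finset.card_eq_zero]
      ext F
      simp only [mem_partitionsInto, Finset.notMem_empty, iff_false, not_and]
      rintro hc ⟨h1, -, h3⟩
      obtain ⟨B, hB⟩ := Finset.card_pos.1 (by omega : 0 < F.card)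
      obtain ⟨x, hx⟩ := h1 B hB
      simpa using (h3 x).2 ⟨B, hB, hx⟩
  | insert a V ha ih =>
    rw [Finset.card_insert_of_notMem ha]
    cases k with
    | zero => rw [partitionsInto_zero (Finset.insert_nonempty a V)]; rfl
    | succ k =>
      rw [Nat.stirlingSecond_succ_succ, ← ih, ← ih, ← card_partitions_without_singleton ha,
        ← card_partitions_with_singleton ha, add_comm (Finset.card _),
        Finset.card_filter_add_card_filter_not]

/-! ### Counting the partitions that contain given blocks -/

/-- `{F ∈ 𝓕 : H ⊆ F}`. -/
def starOf {n : ℕ} (𝓕 : PartFamily n) (H : Finset (Finset (Fin n))) : PartFamily n :=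
  𝓕.filter fun F => H ⊆ F

theorem mem_starOf {n : ℕ} {𝓕 : PartFamily n} {H F : Finset (Finset (Fin n))} :
    F ∈ starOf 𝓕 H ↔ F ∈ 𝓕 ∧ H ⊆ F := Finset.mem_filter

theorem starOf_mono {n : ℕ} {𝓕 𝓖 : PartFamily n} (h : 𝓕 ⊆ 𝓖) (H : Finset (Finset (Fin n))) :
    starOf 𝓕 H ⊆ starOf 𝓖 H := Finset.filter_subset_filter _ h

/-- The blocks outside a fixed set `H` of blocks partition the points that `H` leaves over. -/
theorem card_starOf_kPartitions {n k : ℕ} {H : Finset (Finset (Fin n))} {U : Finset (Fin n)}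
    (hH : IsPartitionOf U H) (hk : H.card ≤ k) :
    (starOf (kPartitions n k) H).card = Nat.stirlingSecond (n - U.card) (k - H.card) := by
  have hU : (Uᶜ).card = n - U.card := by rw [Finset.card_compl, Fintype.card_fin]
  rw [← hU, ← card_partitionsInto]
  obtain ⟨g1, g2, g3⟩ := hH
  refine Finset.card_bij' (fun F _ => F \ H) (fun F _ => F ∪ H) ?_ ?_ ?_ ?_
  · intro F hF
    rw [mem_starOf, mem_kPartitions] at hF
    obtain ⟨⟨hc, h1, h2, h3⟩, hHF⟩ := hF
    rw [mem_partitionsInto, Finset.card_sdiff_of_subset hHF, hc]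
    refine ⟨rfl, fun B hB => h1 B (Finset.mem_sdiff.1 hB).1, fun B hB C hC =>
      h2 B (Finset.mem_sdiff.1 hB).1 C (Finset.mem_sdiff.1 hC).1, fun x => ?_⟩
    rw [Finset.mem_compl, g3]
    constructor
    · intro hx
      obtain ⟨B, hB, hxB⟩ := (h3 x).1 (Finset.mem_univ x)
      exact ⟨B, Finset.mem_sdiff.2 ⟨hB, fun h => hx ⟨B, h, hxB⟩⟩, hxB⟩
    · rintro ⟨B, hB, hxB⟩ ⟨C, hC, hxC⟩
      rw [Finset.mem_sdiff] at hB
      exact hB.2 (h2 B hB.1 C (hHF hC) x hxB hxC ▸ hC)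
  · intro F hF
    rw [mem_partitionsInto] at hF
    obtain ⟨hc, h1, h2, h3⟩ := hF
    have hsep : ∀ B ∈ F, ∀ C ∈ H, ∀ x, x ∈ B → x ∉ C := fun B hB C hC x hxB hxC =>
      (Finset.mem_compl.1 ((h3 x).2 ⟨B, hB, hxB⟩)) ((g3 x).2 ⟨C, hC, hxC⟩)
    have hdisj : Disjoint F H := by
      rw [Finset.disjoint_left]
      intro B hB hB'
      obtain ⟨x, hx⟩ := h1 B hB
      exact hsep B hB B hB' x hx hx
    rw [mem_starOf, mem_kPartitions, Finset.card_union_of_disjoint hdisj, hc]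
    refine ⟨⟨by omega, ?_, ?_, ?_⟩, Finset.subset_union_right⟩
    · intro B hB
      rcases Finset.mem_union.1 hB with hB | hB
      · exact h1 B hB
      · exact g1 B hB
    · intro B hB C hC x hxB hxC
      rcases Finset.mem_union.1 hB with hB | hB <;> rcases Finset.mem_union.1 hC with hC | hC
      · exact h2 B hB C hC x hxB hxC
      · exact absurd hxC (hsep B hB C hC x hxB)
      · exact absurd hxB (hsep C hC B hB x hxC)
      · exact g2 B hB C hC x hxB hxC
    · intro x
      simp only [Finset.mem_univ, true_iff]
      by_cases hx : x ∈ U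
      · obtain ⟨C, hC, hxC⟩ := (g3 x).1 hx
        exact ⟨C, Finset.mem_union_right _ hC, hxC⟩
      · obtain ⟨B, hB, hxB⟩ := (h3 x).1 (Finset.mem_compl.2 hx)
        exact ⟨B, Finset.mem_union_left _ hB, hxB⟩
  · intro F hF
    exact Finset.sdiff_union_of_subset (mem_starOf.1 hF).2
  · intro F hF
    rw [mem_partitionsInto] at hF
    obtain ⟨hc, h1, h2, h3⟩ := hF
    rw [Finset.union_sdiff_right, Finset.sdiff_eq_self_iff_disjoint, Finset.disjoint_left]
    intro B hB hB'
    obtain ⟨x, hx⟩ := h1 B hB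
    exact (Finset.mem_compl.1 ((h3 x).2 ⟨B, hB, hx⟩)) ((g3 x).2 ⟨B, hB', hx⟩)

/-! ### Inequalities between Stirling numbers of the second kind -/

theorem mul_stirlingSecond_le (m j : ℕ) :
    j * Nat.stirlingSecond m j ≤ Nat.stirlingSecond (m + 1) j := by
  cases j with
  | zero => simp
  | succ j => rw [Nat.stirlingSecond_succ_succ]; omega

theorem stirlingSecond_mono {m m' j : ℕ} (hj : 1 ≤ j) (h : m ≤ m') :
    Nat.stirlingSecond m j ≤ Nat.stirlingSecond m' j := by
  induction m', h using Nat.le_induction with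
  | base => exact le_rfl
  | succ m' _ ih =>
    exact ih.trans (le_trans (Nat.le_mul_of_pos_left _ hj) (mul_stirlingSecond_le m' j))

theorem stirlingSecond_pos {m j : ℕ} (hj : 1 ≤ j) (h : j ≤ m) : 0 < Nat.stirlingSecond m j :=
  lt_of_lt_of_le (by rw [Nat.stirlingSecond_self]; exact one_pos) (stirlingSecond_mono hj h)

theorem stirlingSecond_two (m : ℕ) : Nat.stirlingSecond (m + 1) 2 + 1 = 2 ^ m := by
  induction m with
  | zero => rfl
  | succ m ih =>
    rw [Nat.stirlingSecond_succ_succ (m + 1) 1, Nat.stirlingSecond_one_right, pow_succ, ← ih]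
    ring

theorem stirlingSecond_one {m : ℕ} (hm : 1 ≤ m) : Nat.stirlingSecond m 1 = 1 := by
  obtain ⟨m, rfl⟩ := Nat.exists_eq_add_of_le' hm
  exact Nat.stirlingSecond_one_right m

/-- `S(m, j + 1) / S(m - 1, j) ≥ ((j + 1) / j) ^ d` for `m = j + 1 + d`: the complete homogeneous
polynomial of degree `d` in `2, …, j + 1` dominates the one in `1, …, j` factor by factor. -/
theorem pow_mul_stirlingSecond_le (d j : ℕ) :
    (j + 1) ^ d * Nat.stirlingSecond (j + d) j ≤
      j ^ d * Nat.stirlingSecond (j + 1 + d) (j + 1) := by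
  induction d generalizing j with
  | zero => simp [Nat.stirlingSecond_self]
  | succ d ihd =>
    induction j with
    | zero => simp
    | succ j ihj =>
      have h1 := ihd (j + 1)
      have e1 : Nat.stirlingSecond (j + 1 + 1 + (d + 1)) (j + 1 + 1) =
          (j + 2) * Nat.stirlingSecond (j + 1 + 1 + d) (j + 1 + 1) +
            Nat.stirlingSecond (j + 1 + (d + 1)) (j + 1) := by
        rw [show j + 1 + 1 + (d + 1) = (j + 1 + 1 + d) + 1 by ring,
          Nat.stirlingSecond_succ_succ, show j + 1 + 1 + d = j + 1 + (d + 1) by ring]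
      have e2 : Nat.stirlingSecond (j + 1 + (d + 1)) (j + 1) =
          (j + 1) * Nat.stirlingSecond (j + 1 + d) (j + 1) +
            Nat.stirlingSecond (j + (d + 1)) j := by
        rw [show j + 1 + (d + 1) = (j + 1 + d) + 1 by ring,
          Nat.stirlingSecond_succ_succ, show j + 1 + d = j + (d + 1) by ring]
      rw [e1]
      set A := Nat.stirlingSecond (j + 1 + 1 + d) (j + 1 + 1)
      set B := Nat.stirlingSecond (j + 1 + (d + 1)) (j + 1)
      set C := Nat.stirlingSecond (j + 1 + d) (j + 1)
      set E := Nat.stirlingSecond (j + (d + 1)) j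
      -- the ratio `(j + 2) / (j + 1)` is at most `(j + 1) / j`
      have h2 : (j + 2) ^ (d + 1) * E ≤ (j + 1) ^ (d + 1) * B := by
        rcases Nat.eq_zero_or_pos j with rfl | hj
        · have : E = 0 := by
            show Nat.stirlingSecond (0 + (d + 1)) 0 = 0
            rw [zero_add]; rfl
          simp [this]
        · refine Nat.le_of_mul_le_mul_left ?_ (pow_pos hj (d + 1))
          calc j ^ (d + 1) * ((j + 2) ^ (d + 1) * E)
              = (j * (j + 2)) ^ (d + 1) * E := by rw [mul_pow]; ring
            _ ≤ ((j + 1) * (j + 1)) ^ (d + 1) * E :=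
                Nat.mul_le_mul_right _ (Nat.pow_le_pow_left (by nlinarith) _)
            _ = (j + 1) ^ (d + 1) * ((j + 1) ^ (d + 1) * E) := by rw [mul_pow]; ring
            _ ≤ (j + 1) ^ (d + 1) * (j ^ (d + 1) * B) := Nat.mul_le_mul_left _ ihj
            _ = j ^ (d + 1) * ((j + 1) ^ (d + 1) * B) := by ring
      calc (j + 1 + 1) ^ (d + 1) * B
          = (j + 1) * (j + 2) * ((j + 1 + 1) ^ d * C) + (j + 2) ^ (d + 1) * E := by rw [e2]; ring
        _ ≤ (j + 1) * (j + 2) * ((j + 1) ^ d * A) + (j + 1) ^ (d + 1) * B :=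
            add_le_add (Nat.mul_le_mul_left _ h1) h2
        _ = (j + 1) ^ (d + 1) * ((j + 2) * A + B) := by ring

/-- `S(m, j + 1) / S(m - 1, j) ≤ (j + 1) ((j + 1) / j) ^ d` for `m = j + 1 + d`. The summand on the
left that the estimate does not need makes the induction work. -/
theorem stirlingSecond_le_pow_mul (d j : ℕ) :
    j ^ d * Nat.stirlingSecond (j + 1 + d) (j + 1) + j ^ (d + 1) * Nat.stirlingSecond (j + d) j ≤
      (j + 1) ^ (d + 1) * Nat.stirlingSecond (j + d) j := by
  induction d with
  | zero => simp [Nat.stirlingSecond_self]; omega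
  | succ d ih =>
    have e1 : Nat.stirlingSecond (j + 1 + (d + 1)) (j + 1) =
        (j + 1) * Nat.stirlingSecond (j + 1 + d) (j + 1) +
          Nat.stirlingSecond (j + (d + 1)) j := by
      rw [show j + 1 + (d + 1) = (j + 1 + d) + 1 by ring,
        Nat.stirlingSecond_succ_succ, show j + 1 + d = j + (d + 1) by ring]
    have h1 : j * Nat.stirlingSecond (j + d) j ≤ Nat.stirlingSecond (j + (d + 1)) j :=
      mul_stirlingSecond_le (j + d) j
    rw [e1]
    set A := Nat.stirlingSecond (j + 1 + d) (j + 1)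
    set B := Nat.stirlingSecond (j + (d + 1)) j
    set C := Nat.stirlingSecond (j + d) j
    obtain ⟨e, he⟩ : ∃ e, (j + 1) ^ (d + 1) = j ^ (d + 1) + e :=
      Nat.exists_eq_add_of_le (Nat.pow_le_pow_left (Nat.le_succ j) _)
    have ih' : j ^ d * A ≤ e * C := by
      rw [he, add_mul] at ih
      omega
    calc j ^ (d + 1) * ((j + 1) * A + B) + j ^ (d + 1 + 1) * B
        = (j + 1) * j * (j ^ d * A) + (j + 1) * j ^ (d + 1) * B := by ring
      _ ≤ (j + 1) * j * (e * C) + (j + 1) * j ^ (d + 1) * B := by gcongr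
      _ = (j + 1) * e * (j * C) + (j + 1) * j ^ (d + 1) * B := by ring
      _ ≤ (j + 1) * e * B + (j + 1) * j ^ (d + 1) * B := by gcongr
      _ = (j + 1) ^ (d + 1 + 1) * B := by rw [pow_succ (j + 1) (d + 1), he]; ring

/-! ### Consequences of `n ≥ 2 L(k, t)` -/

/-- The number of `k`-partitions of `[n]` that contain `s` given singletons; for `s < k` it is the
largest number of `k`-partitions that contain `s` given blocks. -/
def starSize (n k s : ℕ) : ℕ := Nat.stirlingSecond (n - s) (k - s)

/-- The hypothesis `n ≥ 2 L(t + p, t)` in exponential form, with the standing assumptions on `t`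
and on `p = k - t`. -/
def IsLarge (n t p : ℕ) : Prop :=
  1 ≤ t ∧ 2 ≤ p ∧ 2 ^ (2 * (t + 1)) * ((t + 1) * (p + 1)) ^ (2 * (p + 1)) ≤ 2 ^ n

theorem isLarge_of_boundL {n t p : ℕ} (ht : 1 ≤ t) (hp : 2 ≤ p)
    (hn : 2 * boundL (t + p) t ≤ (n : ℝ)) : IsLarge n t p := by
  refine ⟨ht, hp, ?_⟩
  have hQ : (0 : ℝ) < ((t : ℝ) + 1) * (p + 1) := by positivity
  have hb : 2 * boundL (t + p) t =
      ((2 * (t + 1) : ℕ) : ℝ) + ((2 * (p + 1) : ℕ) : ℝ) *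
        Real.logb 2 (((t : ℝ) + 1) * (p + 1)) := by
    unfold boundL
    push_cast
    rw [show (t : ℝ) + p - t + 1 = p + 1 by ring]
    ring
  rw [hb] at hn
  have h2 := Real.rpow_le_rpow_of_exponent_le (x := 2) (by norm_num) hn
  rw [Real.rpow_add (by norm_num), mul_comm ((2 * (p + 1) : ℕ) : ℝ), Real.rpow_mul (by norm_num),
    Real.rpow_logb (by norm_num) (by norm_num) hQ, Real.rpow_natCast, Real.rpow_natCast,
    Real.rpow_natCast] at h2
  exact_mod_cast h2

theorem two_mul_pow_self_le (i : ℕ) (hi : 1 ≤ i) : 2 * i ^ i ≤ (i + 1) ^ i := by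
  have key : ∀ m, i ^ (m + 1) + (m + 1) * i ^ m ≤ (i + 1) ^ (m + 1) := by
    intro m
    induction m with
    | zero => simp
    | succ m ih =>
      calc i ^ (m + 1 + 1) + (m + 1 + 1) * i ^ (m + 1)
          ≤ (i + 1) * (i ^ (m + 1) + (m + 1) * i ^ m) := by
            have : 0 ≤ (m + 1) * i ^ m := Nat.zero_le _
            ring_nf
            nlinarith
        _ ≤ (i + 1) * (i + 1) ^ (m + 1) := Nat.mul_le_mul_left _ ih
        _ = (i + 1) ^ (m + 1 + 1) := by ring
  obtain ⟨m, rfl⟩ := Nat.exists_eq_add_of_le' hi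
  refine le_trans (le_of_eq ?_) (key m)
  ring

namespace IsLarge

variable {n t p : ℕ}

theorem one_le (h : IsLarge n t p) : 1 ≤ t := h.1

theorem two_le (h : IsLarge n t p) : 2 ≤ p := h.2.1

theorem six_le (h : IsLarge n t p) : 6 ≤ (t + 1) * (p + 1) := by
  have h1 := h.one_le
  have h2 := h.two_le
  nlinarith

theorem add_lt (h : IsLarge n t p) : 2 * t + 2 + 2 * p < n := by
  have h6 := h.six_le
  have h3 := h.2.2
  by_contra! hcon
  have : 2 ^ n < 2 ^ (2 * (t + 1)) * ((t + 1) * (p + 1)) ^ (2 * (p + 1)) := by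
    calc 2 ^ n ≤ 2 ^ (2 * (t + 1) + 2 * p) := Nat.pow_le_pow_right (by norm_num) (by omega)
      _ < 2 ^ (2 * (t + 1) + 2 * (p + 1)) := Nat.pow_lt_pow_right (by norm_num) (by omega)
      _ = 2 ^ (2 * (t + 1)) * 2 ^ (2 * (p + 1)) := pow_add _ _ _
      _ ≤ _ := Nat.mul_le_mul_left _ (Nat.pow_le_pow_left (by omega) _)
  omega

/-- Prescribing one more block divides the number of partitions by at least `Q² / 2`, where
`Q = (t + 1)(p + 1)`. -/
theorem sq_mul_starSize_le (h : IsLarge n t p) {k s : ℕ} (hk : k ≤ t + p) (hs : t ≤ s)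
    (hsk : s + 2 ≤ k) :
    ((t + 1) * (p + 1)) ^ 2 * starSize n k (s + 1) ≤ 2 * starSize n k s := by
  have hlt := h.add_lt
  have h6 := h.six_le
  have h3 := h.2.2
  set Q := (t + 1) * (p + 1)
  obtain ⟨i, rfl⟩ : ∃ i, k = s + 1 + i := Nat.exists_eq_add_of_le (by omega)
  obtain ⟨d, rfl⟩ : ∃ d, n = s + 1 + i + d := Nat.exists_eq_add_of_le (by omega)
  have hi : 1 ≤ i := by omega
  have e1 : starSize (s + 1 + i + d) (s + 1 + i) (s + 1) = Nat.stirlingSecond (i + d) i := by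
    unfold starSize; congr 1 <;> omega
  have e2 : starSize (s + 1 + i + d) (s + 1 + i) s = Nat.stirlingSecond (i + 1 + d) (i + 1) := by
    unfold starSize; congr 1 <;> omega
  rw [e1, e2]
  have hmain := pow_mul_stirlingSecond_le d i
  have hpow : Q ^ (2 * i) ≤ 2 ^ (i + d) := by
    refine Nat.le_of_mul_le_mul_right ?_ (pow_pos two_pos (s + 1) : 0 < 2 ^ (s + 1))
    obtain ⟨e, he⟩ : ∃ e, p = i + e := Nat.exists_eq_add_of_le (by omega)
    calc Q ^ (2 * i) * 2 ^ (s + 1) ≤ Q ^ (2 * i) * 2 ^ (2 * (t + 1) + 2 * (e + 1)) :=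
          Nat.mul_le_mul_left _ (Nat.pow_le_pow_right (by norm_num) (by omega))
      _ = Q ^ (2 * i) * (2 ^ (2 * (t + 1)) * 2 ^ (2 * (e + 1))) := by rw [pow_add 2]
      _ ≤ Q ^ (2 * i) * (2 ^ (2 * (t + 1)) * Q ^ (2 * (e + 1))) :=
          Nat.mul_le_mul_left _ (Nat.mul_le_mul_left _ (Nat.pow_le_pow_left (by omega) _))
      _ = 2 ^ (2 * (t + 1)) * Q ^ (2 * (p + 1)) := by
          rw [he, show 2 * (i + e + 1) = 2 * i + 2 * (e + 1) by ring, pow_add Q]; ring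
      _ ≤ _ := h3
      _ = 2 ^ (i + d) * 2 ^ (s + 1) := by rw [← pow_add]; congr 1; omega
  have hratio : Q ^ 2 * i ^ d ≤ 2 * (i + 1) ^ d := by
    refine le_of_pow_le_pow_left₀ (n := i) (by omega) (Nat.zero_le _) ?_
    calc (Q ^ 2 * i ^ d) ^ i = Q ^ (2 * i) * (i ^ i) ^ d := by
          rw [mul_pow, ← pow_mul, ← pow_mul, ← pow_mul, mul_comm d i]
      _ ≤ 2 ^ (i + d) * (i ^ i) ^ d := Nat.mul_le_mul_right _ hpow
      _ = 2 ^ i * (2 * i ^ i) ^ d := by rw [pow_add, mul_pow]; ring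
      _ ≤ 2 ^ i * ((i + 1) ^ i) ^ d :=
          Nat.mul_le_mul_left _ (Nat.pow_le_pow_left (two_mul_pow_self_le i hi) _)
      _ = (2 * (i + 1) ^ d) ^ i := by rw [mul_pow, ← pow_mul, ← pow_mul, mul_comm d i]
  refine Nat.le_of_mul_le_mul_left ?_ (pow_pos hi d)
  calc i ^ d * (Q ^ 2 * Nat.stirlingSecond (i + d) i)
      = (Q ^ 2 * i ^ d) * Nat.stirlingSecond (i + d) i := by ring
    _ ≤ (2 * (i + 1) ^ d) * Nat.stirlingSecond (i + d) i := Nat.mul_le_mul_right _ hratio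
    _ = 2 * ((i + 1) ^ d * Nat.stirlingSecond (i + d) i) := by ring
    _ ≤ 2 * (i ^ d * Nat.stirlingSecond (i + 1 + d) (i + 1)) := Nat.mul_le_mul_left _ hmain
    _ = _ := by ring

theorem starSize_pos (h : IsLarge n t p) {k s : ℕ} (hk : k ≤ t + p) (hsk : s + 1 ≤ k) :
    0 < starSize n k s := by
  have := h.add_lt
  exact stirlingSecond_pos (by omega) (by omega)

theorem starSize_antitone (h : IsLarge n t p) {k s s' : ℕ} (hk : k ≤ t + p) (hs : t ≤ s)
    (hss : s ≤ s') (hsk : s' + 1 ≤ k) : starSize n k s' ≤ starSize n k s := by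
  induction s', hss using Nat.le_induction with
  | base => exact le_rfl
  | succ s' hs' ih =>
    refine le_trans ?_ (ih (by omega))
    have h1 := h.sq_mul_starSize_le hk (hs.trans hs') (by omega : s' + 2 ≤ k)
    have h6 := h.six_le
    have h36 := Nat.mul_le_mul_right (starSize n k (s' + 1)) (Nat.pow_le_pow_left h6 2)
    omega

theorem starSize_pred (h : IsLarge n t p) {k : ℕ} (hk : k ≤ t + p) (hk1 : 1 ≤ k) :
    starSize n k (k - 1) = 1 := by
  have := h.add_lt
  unfold starSize
  rw [show k - (k - 1) = 1 by omega]
  exact stirlingSecond_one (by omega)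

theorem starSize_sub_two (h : IsLarge n t p) {k : ℕ} (hk : k ≤ t + p) (hk2 : 2 ≤ k) :
    starSize n k (k - 2) + 1 = 2 ^ (n - k + 1) := by
  have := h.add_lt
  unfold starSize
  rw [show k - (k - 2) = 2 by omega, show n - (k - 2) = n - k + 1 + 1 by omega]
  exact stirlingSecond_two _

theorem pow_le_two_pow_sub (h : IsLarge n t p) {k : ℕ} (hk : k ≤ t + p) :
    ((t + 1) * (p + 1)) ^ (p + 2) ≤ 2 ^ (n - k) := by
  have hlt := h.add_lt
  have h6 := h.six_le
  have h3 := h.2.2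
  set Q := (t + 1) * (p + 1)
  refine Nat.le_of_mul_le_mul_right ?_ (pow_pos two_pos k : 0 < 2 ^ k)
  calc Q ^ (p + 2) * 2 ^ k ≤ Q ^ (p + 2) * 2 ^ (2 * (t + 1) + p) :=
        Nat.mul_le_mul_left _ (Nat.pow_le_pow_right (by norm_num) (by omega))
    _ = Q ^ (p + 2) * (2 ^ (2 * (t + 1)) * 2 ^ p) := by rw [pow_add 2]
    _ ≤ Q ^ (p + 2) * (2 ^ (2 * (t + 1)) * Q ^ p) :=
        Nat.mul_le_mul_left _ (Nat.mul_le_mul_left _ (Nat.pow_le_pow_left (by omega) _))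
    _ = 2 ^ (2 * (t + 1)) * Q ^ (2 * (p + 1)) := by
        rw [show 2 * (p + 1) = p + 2 + p by ring, pow_add Q (p + 2)]; ring
    _ ≤ 2 ^ n := h3
    _ = 2 ^ (n - k) * 2 ^ k := by rw [← pow_add]; congr 1; omega

/-- The last ratio, between `k - 2` and `k - 1` prescribed blocks, is far larger than the others. -/
theorem pow_le_starSize_sub_two (h : IsLarge n t p) {k : ℕ} (hk : k ≤ t + p) (hk2 : 2 ≤ k) :
    ((t + 1) * (p + 1)) ^ (p + 2) ≤ starSize n k (k - 2) := by
  have h1 := h.pow_le_two_pow_sub hk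
  have h2 := h.starSize_sub_two hk hk2
  have h3 : 1 ≤ 2 ^ (n - k) := Nat.one_le_two_pow
  rw [pow_succ] at h2
  omega

/-- Prescribing `i` more blocks divides the number of partitions by at least `(Q² / 2) ^ i`. -/
theorem starSize_add_le (h : IsLarge n t p) {k s i : ℕ} (hk : k ≤ t + p) (hs : t ≤ s)
    (hsk : s + i + 1 ≤ k) :
    (starSize n k (s + i) : ℝ) ≤ (2 / (((t : ℝ) + 1) * (p + 1)) ^ 2) ^ i * starSize n k s := by
  have hQ : (0 : ℝ) < (((t : ℝ) + 1) * (p + 1)) ^ 2 := by positivity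
  induction i with
  | zero => simp
  | succ i ih =>
    have h1 := h.sq_mul_starSize_le hk (by omega : t ≤ s + i) (by omega)
    have h2 : (((t : ℝ) + 1) * (p + 1)) ^ 2 * (starSize n k (s + i + 1) : ℝ) ≤
        2 * starSize n k (s + i) := by exact_mod_cast h1
    calc (starSize n k (s + i + 1) : ℝ)
        ≤ 2 / (((t : ℝ) + 1) * (p + 1)) ^ 2 * starSize n k (s + i) := by
          rw [div_mul_eq_mul_div, le_div_iff₀ hQ]; linarith
      _ ≤ 2 / (((t : ℝ) + 1) * (p + 1)) ^ 2 *
          ((2 / (((t : ℝ) + 1) * (p + 1)) ^ 2) ^ i * starSize n k s) :=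
          mul_le_mul_of_nonneg_left (ih (by omega)) (by positivity)
      _ = _ := by ring

/-- For `k > t + 2` the ratio between `t` and `t + 1` prescribed blocks is much smaller for
`k`-partitions than for `(t + 2)`-partitions. -/
theorem mul_starSize_lt (h : IsLarge n t p) {k : ℕ} (hk : k ≤ t + p) (hk3 : t + 3 ≤ k) :
    ((t + 1) ^ 2 * (k - t)) * starSize n k t < starSize n k (t + 1) * starSize n (t + 2) t := by
  have hlt := h.add_lt
  have h6 := h.six_le
  have hp3 : 3 ≤ p := by omega
  have h3 := h.2.2
  have hpos := h.starSize_pos hk (s := t + 1) (by omega)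
  set Q := (t + 1) * (p + 1) with hQ
  obtain ⟨i, rfl⟩ : ∃ i, k = t + 1 + i := Nat.exists_eq_add_of_le (by omega)
  obtain ⟨d, rfl⟩ : ∃ d, n = t + 1 + i + d := Nat.exists_eq_add_of_le (by omega)
  have hi : 2 ≤ i := by omega
  have e1 : starSize (t + 1 + i + d) (t + 1 + i) (t + 1) = Nat.stirlingSecond (i + d) i := by
    unfold starSize; congr 1 <;> omega
  have e2 : starSize (t + 1 + i + d) (t + 1 + i) t = Nat.stirlingSecond (i + 1 + d) (i + 1) := by
    unfold starSize; congr 1 <;> omega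
  have e3 : starSize (t + 1 + i + d) (t + 2) t + 1 = 2 ^ (i + d) := by
    have := h.starSize_sub_two (k := t + 2) (by omega) (by omega)
    rwa [Nat.add_sub_cancel, show t + 1 + i + d - (t + 2) + 1 = i + d by omega] at this
  rw [e1] at hpos
  rw [e1, e2, show t + 1 + i - t = i + 1 by omega]
  have hU := stirlingSecond_le_pow_mul d i
  set A := Nat.stirlingSecond (i + 1 + d) (i + 1)
  set B := Nat.stirlingSecond (i + d) i
  have hU' : i ^ d * A ≤ (i + 1) ^ (d + 1) * B := le_trans (Nat.le_add_right _ _) hU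
  -- `(4 / 3) ^ 5 ≥ 4` turns `2 ^ d ≥ Q ^ 5` into `(4 / 3) ^ d ≥ Q ^ 2`
  have hd5 : Q ^ 5 ≤ 2 ^ d := by
    refine le_trans (Nat.pow_le_pow_right (by omega) (by omega : 5 ≤ p + 2)) ?_
    have := h.pow_le_two_pow_sub hk
    rwa [Nat.add_sub_cancel_left] at this
  have hd : Q ^ 2 * 3 ^ d ≤ 4 ^ d := by
    refine le_of_pow_le_pow_left₀ (n := 5) (by omega) (Nat.zero_le _) ?_
    calc (Q ^ 2 * 3 ^ d) ^ 5 = (Q ^ 5) ^ 2 * (3 ^ 5) ^ d := by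
          rw [mul_pow, ← pow_mul, ← pow_mul, ← pow_mul, ← pow_mul, mul_comm d 5]
      _ ≤ (2 ^ d) ^ 2 * (3 ^ 5) ^ d := Nat.mul_le_mul_right _ (Nat.pow_le_pow_left hd5 2)
      _ = (4 * 3 ^ 5) ^ d := by rw [mul_pow, ← pow_mul, mul_comm d 2, pow_mul]; norm_num
      _ ≤ (4 ^ 5) ^ d := Nat.pow_le_pow_left (by norm_num) d
      _ = (4 ^ d) ^ 5 := by rw [← pow_mul, ← pow_mul, mul_comm]
  have h23 : 2 ^ d * (i + 1) ^ d ≤ 3 ^ d * i ^ d := by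
    rw [← mul_pow, ← mul_pow]
    exact Nat.pow_le_pow_left (by omega) d
  have hQi : (t + 1) ^ 2 * (i + 1) * (i + 1) ≤ Q ^ 2 := by
    rw [hQ, mul_pow, mul_assoc, ← sq]
    exact Nat.mul_le_mul_left _ (Nat.pow_le_pow_left (by omega) 2)
  have hW : (t + 1) ^ 2 * (i + 1) * (i + 1) ^ (d + 1) ≤ i ^ d * 2 ^ d := by
    refine Nat.le_of_mul_le_mul_left ?_ (pow_pos two_pos d)
    calc 2 ^ d * ((t + 1) ^ 2 * (i + 1) * (i + 1) ^ (d + 1))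
        = ((t + 1) ^ 2 * (i + 1) * (i + 1)) * (2 ^ d * (i + 1) ^ d) := by ring
      _ ≤ Q ^ 2 * (3 ^ d * i ^ d) := Nat.mul_le_mul hQi h23
      _ = (Q ^ 2 * 3 ^ d) * i ^ d := by ring
      _ ≤ 4 ^ d * i ^ d := Nat.mul_le_mul_right _ hd
      _ = 2 ^ d * (i ^ d * 2 ^ d) := by rw [show (4 : ℕ) = 2 * 2 by norm_num, mul_pow]; ring
  have hlast : 2 ^ d < starSize (t + 1 + i + d) (t + 2) t := by
    have h1 : 2 ^ (1 + 1 + d) ≤ 2 ^ (i + d) := Nat.pow_le_pow_right (by norm_num) (by omega)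
    have h2 : 1 ≤ 2 ^ d := Nat.one_le_two_pow
    rw [pow_add] at h1
    omega
  refine Nat.lt_of_mul_lt_mul_left (a := i ^ d) ?_
  calc i ^ d * ((t + 1) ^ 2 * (i + 1) * A) = (t + 1) ^ 2 * (i + 1) * (i ^ d * A) := by ring
    _ ≤ (t + 1) ^ 2 * (i + 1) * ((i + 1) ^ (d + 1) * B) := Nat.mul_le_mul_left _ hU'
    _ = ((t + 1) ^ 2 * (i + 1) * (i + 1) ^ (d + 1)) * B := by ring
    _ ≤ (i ^ d * 2 ^ d) * B := Nat.mul_le_mul_right _ hW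
    _ = i ^ d * (B * 2 ^ d) := by ring
    _ < i ^ d * (B * starSize (t + 1 + i + d) (t + 2) t) := by
        refine Nat.mul_lt_mul_of_pos_left (Nat.mul_lt_mul_of_pos_left hlast hpos) ?_
        exact pow_pos (by omega) d

end IsLarge

/-! ### Stars and covers -/

theorem isPartitionOf_subset {α : Type*} [DecidableEq α] {V : Finset α} {H F : Finset (Finset α)}
    (hF : IsPartitionOf V F) (hHF : H ⊆ F) : IsPartitionOf (H.biUnion id) H :=
  ⟨fun B hB => hF.1 B (hHF hB), fun B hB C hC => hF.2.1 B (hHF hB) C (hHF hC), fun x => by simp⟩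

theorem IsPartitionOf.card_eq_sum {α : Type*} [DecidableEq α] {V : Finset α}
    {H : Finset (Finset α)} (hH : IsPartitionOf V H) : V.card = ∑ B ∈ H, B.card := by
  have hV : V = H.biUnion id := by
    ext x
    simp [hH.2.2 x]
  rw [hV, Finset.card_biUnion]
  · rfl
  · intro B hB C hC hne
    exact Finset.disjoint_left.2 fun x hx hx' => hne (hH.2.1 B hB C hC x hx hx')

theorem IsPartitionOf.card_le {α : Type*} [DecidableEq α] {V : Finset α} {H : Finset (Finset α)}
    (hH : IsPartitionOf V H) : H.card ≤ V.card := by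
  rw [hH.card_eq_sum, Finset.card_eq_sum_ones]
  exact Finset.sum_le_sum fun B hB => Finset.card_pos.2 (hH.1 B hB)

theorem IsPartitionOf.card_lt {α : Type*} [DecidableEq α] {V : Finset α} {H : Finset (Finset α)}
    (hH : IsPartitionOf V H) {C : Finset α} (hC : C ∈ H) (hC1 : C.card ≠ 1) :
    H.card < V.card := by
  rw [hH.card_eq_sum, Finset.card_eq_sum_ones]
  refine Finset.sum_lt_sum (fun B hB => Finset.card_pos.2 (hH.1 B hB)) ⟨C, hC, ?_⟩
  have := Finset.card_pos.2 (hH.1 C hC)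
  omega

theorem card_starOf_le {n k : ℕ} {𝓕 : PartFamily n} (h𝓕 : 𝓕 ⊆ kPartitions n k)
    {H : Finset (Finset (Fin n))} (hk : H.card < k) :
    (starOf 𝓕 H).card ≤ starSize n k H.card := by
  rcases (starOf 𝓕 H).eq_empty_or_nonempty with he | ⟨F, hF⟩
  · simp [he]
  · rw [mem_starOf] at hF
    have hH := isPartitionOf_subset (mem_kPartitions.1 (h𝓕 hF.1)).2 hF.2
    refine (Finset.card_le_card (starOf_mono h𝓕 H)).trans ?_
    rw [card_starOf_kPartitions hH hk.le]
    exact stirlingSecond_mono (by omega) (Nat.sub_le_sub_left hH.card_le n)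

/-- A block with more than one point at least halves the bound of `card_starOf_le`. -/
theorem two_mul_card_starOf_le {n k : ℕ} {𝓕 : PartFamily n} (h𝓕 : 𝓕 ⊆ kPartitions n k)
    {H : Finset (Finset (Fin n))} (hk : H.card + 2 ≤ k) (hn : H.card < n)
    (hns : ∃ B ∈ H, B.card ≠ 1) :
    2 * (starOf 𝓕 H).card ≤ starSize n k H.card := by
  rcases (starOf 𝓕 H).eq_empty_or_nonempty with he | ⟨F, hF⟩
  · simp [he]
  · rw [mem_starOf] at hF
    have hH := isPartitionOf_subset (mem_kPartitions.1 (h𝓕 hF.1)).2 hF.2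
    obtain ⟨B, hB, hB1⟩ := hns
    have hlt := hH.card_lt hB hB1
    have h1 := Finset.card_le_card (starOf_mono h𝓕 H)
    rw [card_starOf_kPartitions hH (by omega)] at h1
    have h2 : Nat.stirlingSecond (n - (H.biUnion id).card) (k - H.card) ≤
        Nat.stirlingSecond (n - H.card - 1) (k - H.card) :=
      stirlingSecond_mono (by omega) (by omega)
    have h3 := mul_stirlingSecond_le (n - H.card - 1) (k - H.card)
    rw [show n - H.card - 1 + 1 = n - H.card by omega] at h3
    unfold starSize
    calc 2 * (starOf 𝓕 H).card
        ≤ (k - H.card) * Nat.stirlingSecond (n - H.card - 1) (k - H.card) :=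
          Nat.mul_le_mul (by omega) (h1.trans h2)
      _ ≤ _ := h3

theorem CrossIntersecting.symm {n t : ℕ} {𝓕 𝓖 : PartFamily n} (h : CrossIntersecting t 𝓕 𝓖) :
    CrossIntersecting t 𝓖 𝓕 := fun G hG F hF => Finset.inter_comm F G ▸ h F hF G hG

/-- Let `G` be an `l`-partition that shares fewer than `t` blocks with `H`, where `|H| ≥ t`. Among
the blocks of `G` outside `H` there are `l - t` such that every partition containing `H` and sharing
`t` blocks with `G` contains one of these. A block of `H` missing from `G` meets some block of `G`,
which then cannot be used; this is why `l - t + 1` blocks are not needed. -/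
theorem exists_transversal {n l t : ℕ} {G H : Finset (Finset (Fin n))}
    (hG : G ∈ kPartitions n l) (hH : t ≤ H.card) (hGH : (H ∩ G).card < t) :
    ∃ Y ⊆ G \ H, Y.card ≤ l - t ∧ ∀ k, ∀ F ∈ kPartitions n k, H ⊆ F → t ≤ (F ∩ G).card →
      ∃ B ∈ Y, B ∈ F := by
  classical
  by_cases hex : ∃ k, ∃ F ∈ kPartitions n k, H ⊆ F ∧ t ≤ (F ∩ G).card
  swap
  · refine ⟨∅, Finset.empty_subset _, by simp, fun k F hF hHF hFG => ?_⟩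
    exact absurd ⟨k, F, hF, hHF, hFG⟩ hex
  obtain ⟨k₀, F₀, hF₀, hHF₀, hFG₀⟩ := hex
  rw [mem_kPartitions] at hG hF₀
  obtain ⟨hGc, hG1, hG2, hG3⟩ := hG
  set U := (G \ H).filter fun B => ∀ C ∈ H, Disjoint B C with hU
  -- a block of `G` that is not disjoint from all blocks of `H`
  obtain ⟨D, hDG, hDH, hDU⟩ : ∃ D ∈ G, D ∉ H ∧ D ∉ U := by
    obtain ⟨C, hCH, hCG⟩ : ∃ C ∈ H, C ∉ G := by
      by_contra! hcon
      rw [Finset.inter_eq_left.2 hcon] at hGH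
      omega
    obtain ⟨x, hx⟩ := hF₀.2.1 C (hHF₀ hCH)
    obtain ⟨D, hD, hxD⟩ := (hG3 x).1 (Finset.mem_univ x)
    refine ⟨D, hD, fun hDH => ?_, fun hDU => ?_⟩
    · have := hF₀.2.2.1 D (hHF₀ hDH) C (hHF₀ hCH) x hxD hx
      exact hCG (this ▸ hD)
    · exact Finset.disjoint_left.1 ((Finset.mem_filter.1 hDU).2 C hCH) hxD hx
  have hUsub : U ⊆ G \ H := Finset.filter_subset _ _
  have hUcard : U.card + 1 + (H ∩ G).card ≤ l := by
    have h1 : (insert D U).card ≤ (G \ H).card := by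
      refine Finset.card_le_card (Finset.insert_subset ?_ hUsub)
      exact Finset.mem_sdiff.2 ⟨hDG, hDH⟩
    rw [Finset.card_insert_of_notMem hDU] at h1
    have h2 := Finset.card_sdiff_add_card_inter G H
    rw [Finset.inter_comm] at h2
    omega
  have hmany : ∀ k, ∀ F ∈ kPartitions n k, H ⊆ F → t ≤ (F ∩ G).card →
      t ≤ (H ∩ G).card + (F ∩ U).card := by
    intro k F hF hHF hFG
    rw [mem_kPartitions] at hF
    refine hFG.trans ((Finset.card_le_card ?_).trans (Finset.card_union_le _ _))
    intro B hB
    rw [Finset.mem_inter] at hB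
    by_cases hBH : B ∈ H
    · exact Finset.mem_union_left _ (Finset.mem_inter.2 ⟨hBH, hB.2⟩)
    · refine Finset.mem_union_right _ (Finset.mem_inter.2 ⟨hB.1, Finset.mem_filter.2
        ⟨Finset.mem_sdiff.2 ⟨hB.2, hBH⟩, fun C hC => ?_⟩⟩)
      rw [Finset.disjoint_left]
      exact fun x hx hx' => hBH (hF.2.2.1 B hB.1 C (hHF hC) x hx hx' ▸ hC)
  have hUt : t ≤ (H ∩ G).card + U.card :=
    (hmany k₀ F₀ (mem_kPartitions.2 hF₀) hHF₀ hFG₀).trans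
      (Nat.add_le_add_left (Finset.card_le_card Finset.inter_subset_right) _)
  obtain ⟨Y, hYU, hYc⟩ : ∃ Y ⊆ U, Y.card = U.card + (H ∩ G).card + 1 - t :=
    Finset.exists_subset_card_eq (by omega)
  refine ⟨Y, hYU.trans hUsub, by omega, fun k F hF hHF hFG => ?_⟩
  have h1 := hmany k F hF hHF hFG
  by_contra! hcon
  have h2 : (F ∩ U).card ≤ (U \ Y).card := by
    refine Finset.card_le_card fun B hB => ?_
    rw [Finset.mem_inter] at hB
    exact Finset.mem_sdiff.2 ⟨hB.2, fun h => hcon B h hB.1⟩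
  rw [Finset.card_sdiff_of_subset hYU] at h2
  omega

/-- `T` shares at least `t` blocks with every member of `𝓕`. -/
def IsCover {n : ℕ} (t : ℕ) (𝓕 : PartFamily n) (T : Finset (Finset (Fin n))) : Prop :=
  ∀ F ∈ 𝓕, t ≤ (T ∩ F).card

theorem IsCover.le_card {n t : ℕ} {𝓕 : PartFamily n} {T : Finset (Finset (Fin n))}
    (h : IsCover t 𝓕 T) (hne : 𝓕.Nonempty) : t ≤ T.card := by
  obtain ⟨F, hF⟩ := hne
  exact (h F hF).trans (Finset.card_le_card Finset.inter_subset_left)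

theorem isCover_iff_subset {n t : ℕ} {𝓕 : PartFamily n} {T : Finset (Finset (Fin n))}
    (hT : T.card = t) : IsCover t 𝓕 T ↔ ∀ F ∈ 𝓕, T ⊆ F := by
  refine forall₂_congr fun F _ => ⟨fun h => ?_, fun h => ?_⟩
  · rw [← Finset.inter_eq_left]
    exact Finset.eq_of_subset_of_card_le Finset.inter_subset_left (by omega)
  · rw [Finset.inter_eq_left.2 h, hT]

theorem card_starOf_le_sum {n : ℕ} {𝓕 : PartFamily n} {H Y : Finset (Finset (Fin n))}
    (hY : ∀ F ∈ 𝓕, H ⊆ F → ∃ B ∈ Y, B ∈ F) :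
    (starOf 𝓕 H).card ≤ ∑ B ∈ Y, (starOf 𝓕 (insert B H)).card := by
  refine (Finset.card_le_card fun F hF => ?_).trans Finset.card_biUnion_le
  rw [mem_starOf] at hF
  obtain ⟨B, hB, hBF⟩ := hY F hF.1 hF.2
  exact Finset.mem_biUnion.2 ⟨B, hB, mem_starOf.2 ⟨hF.1, Finset.insert_subset hBF hF.2⟩⟩

theorem card_starOf_le_mul {n k l t m : ℕ} {𝓕 𝓖 : PartFamily n} (h𝓕 : 𝓕 ⊆ kPartitions n k)
    (h𝓖 : 𝓖 ⊆ kPartitions n l) (hc : CrossIntersecting t 𝓕 𝓖) {H : Finset (Finset (Fin n))}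
    (hH : t ≤ H.card) (hcov : ¬ IsCover t 𝓖 H)
    (hm : ∀ B ∉ H, (starOf 𝓕 (insert B H)).card ≤ m) :
    (starOf 𝓕 H).card ≤ (l - t) * m := by
  unfold IsCover at hcov
  push Not at hcov
  obtain ⟨G, hG, hGH⟩ := hcov
  obtain ⟨Y, hY, hYc, hYF⟩ := exists_transversal (h𝓖 hG) hH hGH
  refine (card_starOf_le_sum fun F hF hHF => hYF k F (h𝓕 hF) hHF (hc F hF G hG)).trans ?_
  refine (Finset.sum_le_card_nsmul Y _ m fun B hB => hm B ?_).trans ?_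
  · exact (Finset.mem_sdiff.1 (hY hB)).2
  · rw [smul_eq_mul]
    exact Nat.mul_le_mul_right m hYc

theorem card_starOf_le_mul_starSize {n k l t : ℕ} {𝓕 𝓖 : PartFamily n}
    (h𝓕 : 𝓕 ⊆ kPartitions n k)
    (h𝓖 : 𝓖 ⊆ kPartitions n l) (hc : CrossIntersecting t 𝓕 𝓖) {H : Finset (Finset (Fin n))}
    (hH : t ≤ H.card) (hk : H.card + 1 < k) (hcov : ¬ IsCover t 𝓖 H) :
    (starOf 𝓕 H).card ≤ (l - t) * starSize n k (H.card + 1) := by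
  refine card_starOf_le_mul h𝓕 h𝓖 hc hH hcov fun B hB => ?_
  have hcard := Finset.card_insert_of_notMem hB
  rw [← hcard]
  exact card_starOf_le h𝓕 (by omega)

/-- If no set of fewer than `s` blocks covers `𝓖`, then each block beyond the ones of `H` can be
chosen from `l - t` candidates, until `s` blocks are fixed. -/
theorem card_starOf_le_pow_mul {n k l t s : ℕ} {𝓕 𝓖 : PartFamily n} (h𝓕 : 𝓕 ⊆ kPartitions n k)
    (h𝓖 : 𝓖 ⊆ kPartitions n l) (hc : CrossIntersecting t 𝓕 𝓖)
    (hcov : ∀ T, T.card < s → ¬ IsCover t 𝓖 T) (hsk : s < k) {H : Finset (Finset (Fin n))}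
    (hH : t ≤ H.card) (hHs : H.card ≤ s) :
    (starOf 𝓕 H).card ≤ (l - t) ^ (s - H.card) * starSize n k s := by
  obtain ⟨e, he⟩ : ∃ e, s = H.card + e := Nat.exists_eq_add_of_le hHs
  induction e generalizing H with
  | zero =>
    rw [Nat.add_zero] at he
    rw [he, Nat.sub_self, pow_zero, one_mul]
    exact card_starOf_le h𝓕 (by omega)
  | succ e ih =>
    refine (card_starOf_le_mul (m := (l - t) ^ e * starSize n k s) h𝓕 h𝓖 hc hH
      (hcov H (by omega)) fun B hB => ?_).trans ?_
    · have hcard := Finset.card_insert_of_notMem hB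
      have := ih (H := insert B H) (by omega) (by omega) (by omega)
      rwa [show s - (insert B H).card = e by omega] at this
    · rw [show s - H.card = e + 1 by omega, pow_succ]
      exact le_of_eq (by ring)

theorem card_le_sum_starOf {n t : ℕ} {𝓕 : PartFamily n} {T : Finset (Finset (Fin n))}
    (hT : IsCover t 𝓕 T) : 𝓕.card ≤ ∑ H ∈ T.powersetCard t, (starOf 𝓕 H).card := by
  refine (Finset.card_le_card fun F hF => ?_).trans Finset.card_biUnion_le
  obtain ⟨H, hH, hHc⟩ := Finset.exists_subset_card_eq (hT F hF)
  rw [Finset.subset_inter_iff] at hH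
  exact Finset.mem_biUnion.2 ⟨H, Finset.mem_powersetCard.2 ⟨hH.1, hHc⟩, mem_starOf.2 ⟨hF, hH.2⟩⟩

theorem card_le_choose_mul {n t m : ℕ} {𝓕 : PartFamily n} {T : Finset (Finset (Fin n))}
    (hT : IsCover t 𝓕 T) (hm : ∀ H ⊆ T, H.card = t → (starOf 𝓕 H).card ≤ m) :
    𝓕.card ≤ T.card.choose t * m := by
  refine (card_le_sum_starOf hT).trans ?_
  rw [← Finset.card_powersetCard, ← smul_eq_mul]
  refine Finset.sum_le_card_nsmul _ _ m fun H hH => ?_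
  rw [Finset.mem_powersetCard] at hH
  exact hm H hH.1 hH.2

theorem choose_add_le_pow (t x : ℕ) : (t + x).choose t ≤ (t + 1) ^ x := by
  induction x with
  | zero => simp
  | succ x ih =>
    refine Nat.le_of_mul_le_mul_right ?_ (Nat.succ_pos x)
    have h := Nat.choose_mul_succ_eq (t + x) t
    rw [show t + x + 1 - t = x + 1 by omega] at h
    calc (t + (x + 1)).choose t * (x + 1) = (t + x).choose t * (t + x + 1) := h.symm
      _ ≤ (t + 1) ^ x * ((t + 1) * (x + 1)) := Nat.mul_le_mul ih (by nlinarith)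
      _ = (t + 1) ^ (x + 1) * (x + 1) := by ring

/-- A smallest `t`-cover of `𝓕` has at most `l` blocks, since the members of `𝓖` are covers. -/
theorem exists_minimal_cover {n l t : ℕ} {𝓕 𝓖 : PartFamily n} (h𝓖 : 𝓖 ⊆ kPartitions n l)
    (hc : CrossIntersecting t 𝓕 𝓖) (hne : 𝓖.Nonempty) :
    ∃ T, IsCover t 𝓕 T ∧ T.card ≤ l ∧ ∀ T', T'.card < T.card → ¬ IsCover t 𝓕 T' := by
  classical
  obtain ⟨G, hG⟩ := hne
  have hGcov : IsCover t 𝓕 G := fun F hF => hc.symm G hG F hF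
  obtain ⟨T, hT, hmin⟩ := Finset.exists_min_image
    (Finset.univ.filter fun T : Finset (Finset (Fin n)) => IsCover t 𝓕 T) Finset.card
    ⟨G, Finset.mem_filter.2 ⟨Finset.mem_univ _, hGcov⟩⟩
  refine ⟨T, (Finset.mem_filter.1 hT).2, ?_, fun T' hT' hcov => ?_⟩
  · rw [← (mem_kPartitions.1 (h𝓖 hG)).1]
    exact hmin G (Finset.mem_filter.2 ⟨Finset.mem_univ _, hGcov⟩)
  · have := hmin T' (Finset.mem_filter.2 ⟨Finset.mem_univ _, hcov⟩)
    omega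

/-! ### The extremal pairs: sizes -/

/-- A set of one-point blocks is a partition of the set of points involved. -/
theorem isPartitionOf_singletons {α : Type*} [DecidableEq α] {T : Finset (Finset α)}
    (hT : ∀ B ∈ T, B.card = 1) : IsPartitionOf (T.biUnion id) T := by
  refine ⟨fun B hB => Finset.card_pos.1 (by rw [hT B hB]; exact one_pos),
    fun B hB C hC x hxB hxC => ?_, fun x => by simp⟩
  obtain ⟨b, rfl⟩ := Finset.card_eq_one.1 (hT B hB)
  obtain ⟨c, rfl⟩ := Finset.card_eq_one.1 (hT C hC)
  rw [Finset.mem_singleton] at hxB hxC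
  rw [← hxB, ← hxC]

theorem card_biUnion_singletons {α : Type*} [DecidableEq α] {T : Finset (Finset α)}
    (hT : ∀ B ∈ T, B.card = 1) : (T.biUnion id).card = T.card := by
  rw [(isPartitionOf_singletons hT).card_eq_sum, Finset.card_eq_sum_ones]
  exact Finset.sum_congr rfl hT

theorem card_starOf_singletons {n k : ℕ} {T : Finset (Finset (Fin n))}
    (hT : ∀ B ∈ T, B.card = 1) (hk : T.card ≤ k) :
    (starOf (kPartitions n k) T).card = starSize n k T.card := by
  rw [card_starOf_kPartitions (isPartitionOf_singletons hT) hk, card_biUnion_singletons hT,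
    starSize]

theorem card_of_mem_singletonBlocks {n b : ℕ} : ∀ B ∈ singletonBlocks n b, B.card = 1 := by
  intro B hB
  obtain ⟨i, -, rfl⟩ := Finset.mem_image.1 hB
  exact Finset.card_singleton i

theorem card_singletonBlocks {n b : ℕ} (hb : b ≤ n) : (singletonBlocks n b).card = b := by
  rw [singletonBlocks, Finset.card_image_of_injective _ Finset.singleton_injective,
    Fin.card_filter_val_lt, min_eq_right hb]

theorem singletonBlocks_mono {n a b : ℕ} (hab : a ≤ b) :
    singletonBlocks n a ⊆ singletonBlocks n b :=
  Finset.image_subset_image (Finset.monotone_filter_right _ fun _ _ h => lt_of_lt_of_le h hab)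

/-- The members of `𝓓` that omit exactly one block of `T` already number about `t + 1` stars. -/
theorem mul_starSize_le_card_familyD {n k t : ℕ} {T : Finset (Finset (Fin n))}
    (hT : ∀ B ∈ T, B.card = 1) (hTc : T.card = t + 1) (hk : t + 1 ≤ k) :
    (t + 1) * starSize n k t ≤ (familyD k t T).card + (t + 1) * starSize n k (t + 1) := by
  set W : Finset (Fin n) → PartFamily n := fun B =>
    starOf (kPartitions n k) (T.erase B) \ starOf (kPartitions n k) T with hW
  have hWc : ∀ B ∈ T, starSize n k t ≤ (W B).card + starSize n k (t + 1) := by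
    intro B hB
    have h1 := card_starOf_singletons (n := n) (k := k) (T := T.erase B)
      (fun C hC => hT C (Finset.mem_of_mem_erase hC))
      (by rw [Finset.card_erase_of_mem hB]; omega)
    have h2 := card_starOf_singletons (n := n) (k := k) hT (by omega)
    rw [Finset.card_erase_of_mem hB, hTc, Nat.add_sub_cancel] at h1
    rw [hTc] at h2
    rw [← h1, ← h2]
    exact Nat.sub_le_iff_le_add.1 (Finset.le_card_sdiff _ _)
  have hdisj : (T : Set (Finset (Fin n))).PairwiseDisjoint W := by
    intro B hB C hC hne
    refine Finset.disjoint_left.2 fun F hFB hFC => ?_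
    simp only [hW, Finset.mem_sdiff, mem_starOf] at hFB hFC
    refine hFB.2 ⟨hFB.1.1, fun D hD => ?_⟩
    by_cases hDB : D = B
    · exact hFC.1.2 (Finset.mem_erase.2 ⟨hDB ▸ hne, hD⟩)
    · exact hFB.1.2 (Finset.mem_erase.2 ⟨hDB, hD⟩)
  have hsub : T.biUnion W ⊆ familyD k t T := by
    intro F hF
    obtain ⟨B, hB, hFB⟩ := Finset.mem_biUnion.1 hF
    simp only [hW, Finset.mem_sdiff, mem_starOf] at hFB
    refine Finset.mem_filter.2 ⟨hFB.1.1, ?_⟩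
    have : (T.erase B).card ≤ (T ∩ F).card :=
      Finset.card_le_card (Finset.subset_inter (Finset.erase_subset _ _) hFB.1.2)
    rwa [Finset.card_erase_of_mem hB, hTc, Nat.add_sub_cancel] at this
  have hcard := Finset.card_le_card hsub
  rw [Finset.card_biUnion hdisj] at hcard
  have hsum := Finset.sum_le_sum hWc
  rw [Finset.sum_add_distrib, Finset.sum_const, Finset.sum_const, hTc, smul_eq_mul,
    smul_eq_mul] at hsum
  omega

/-- The members of `𝓐` with exactly one block in `M \ X` already number about `m = |M \ X|`
stars. -/
theorem mul_starSize_le_card_familyA {n l t m : ℕ} {X M : Finset (Finset (Fin n))}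
    (hM : ∀ B ∈ M, B.card = 1) (hXM : X ⊆ M) (hX : X.card = t) (hm : (M \ X).card = m)
    (hl : t + 2 ≤ l) :
    m * starSize n l (t + 1) ≤ (familyA l X M).card + m * ((m - 1) * starSize n l (t + 2)) := by
  set W : Finset (Fin n) → PartFamily n := fun B =>
    starOf (kPartitions n l) (insert B X) \
      ((M \ X).erase B).biUnion fun C => starOf (kPartitions n l) (insert C (insert B X)) with hW
  have hWc : ∀ B ∈ M \ X,
      starSize n l (t + 1) ≤ (W B).card + (m - 1) * starSize n l (t + 2) := by
    intro B hB
    have hB' := Finset.mem_sdiff.1 hB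
    have hBX : ∀ C ∈ insert B X, C.card = 1 := fun C hC =>
      hM C (Finset.insert_subset hB'.1 hXM hC)
    have hc1 : (insert B X).card = t + 1 := by rw [Finset.card_insert_of_notMem hB'.2, hX]
    have h1 := card_starOf_singletons (n := n) (k := l) hBX (by omega)
    rw [hc1] at h1
    have h2 : (((M \ X).erase B).biUnion fun C =>
        starOf (kPartitions n l) (insert C (insert B X))).card ≤
          (m - 1) * starSize n l (t + 2) := by
      refine (Finset.card_biUnion_le_card_mul _ _ (starSize n l (t + 2)) fun C hC => ?_).trans ?_
      · have hC' := Finset.mem_erase.1 hC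
        have hC'' := Finset.mem_sdiff.1 hC'.2
        have hCn : C ∉ insert B X := by
          rw [Finset.mem_insert]
          rintro (h | h)
          · exact hC'.1 h
          · exact hC''.2 h
        have hc2 : (insert C (insert B X)).card = t + 2 := by
          rw [Finset.card_insert_of_notMem hCn, hc1]
        rw [card_starOf_singletons (n := n) (k := l) _ (by omega), hc2]
        intro D hD
        rcases Finset.mem_insert.1 hD with rfl | hD
        · exact hM _ hC''.1
        · exact hBX D hD
      · rw [Finset.card_erase_of_mem hB, hm]
    rw [← h1]
    have h3 := Finset.le_card_sdiff (((M \ X).erase B).biUnion fun C =>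
      starOf (kPartitions n l) (insert C (insert B X))) (starOf (kPartitions n l) (insert B X))
    simp only [hW]
    omega
  have hdisj : ((M \ X : Finset (Finset (Fin n))) : Set (Finset (Fin n))).PairwiseDisjoint W := by
    intro B hB C hC hne
    refine Finset.disjoint_left.2 fun F hFB hFC => ?_
    simp only [hW, Finset.mem_sdiff, mem_starOf, Finset.mem_biUnion] at hFB hFC
    refine hFB.2 ⟨C, Finset.mem_erase.2 ⟨hne.symm, hC⟩, hFB.1.1, ?_⟩
    exact Finset.insert_subset (hFC.1.2 (Finset.mem_insert_self _ _)) hFB.1.2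
  have hsub : (M \ X).biUnion W ⊆ familyA l X M := by
    intro F hF
    obtain ⟨B, hB, hFB⟩ := Finset.mem_biUnion.1 hF
    simp only [hW, Finset.mem_sdiff, mem_starOf] at hFB
    refine Finset.mem_filter.2 ⟨hFB.1.1, (Finset.subset_insert _ _).trans hFB.1.2, B, ?_⟩
    exact Finset.mem_inter.2 ⟨hFB.1.2 (Finset.mem_insert_self _ _), hB⟩
  have hcard := Finset.card_le_card hsub
  rw [Finset.card_biUnion hdisj] at hcard
  have hsum := Finset.sum_le_sum hWc
  rw [Finset.sum_add_distrib, Finset.sum_const, Finset.sum_const, hm, smul_eq_mul,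
    smul_eq_mul] at hsum
  omega

/-- Moving all points outside `⋃ M` into the block `B` of `M` gives a partition. -/
theorem sdiff_union_mem_kPartitions {n k : ℕ} {M : Finset (Finset (Fin n))}
    (hM : IsPartitionOf (M.sup id) M) (hMc : M.card = k) {B : Finset (Fin n)} (hB : B ∈ M) :
    (M \ {B}) ∪ {B ∪ (M.sup id)ᶜ} ∈ kPartitions n k := by
  obtain ⟨h1, h2, h3⟩ := hM
  obtain ⟨b, hb⟩ := h1 B hB
  have hsep : ∀ C ∈ M \ {B}, ∀ x ∈ C, x ∉ B ∪ (M.sup id)ᶜ := by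
    intro C hC x hxC hx
    rw [Finset.mem_sdiff, Finset.mem_singleton] at hC
    rcases Finset.mem_union.1 hx with hx | hx
    · exact hC.2 (h2 C hC.1 B hB x hxC hx)
    · exact Finset.mem_compl.1 hx ((h3 x).2 ⟨C, hC.1, hxC⟩)
  have hnot : B ∪ (M.sup id)ᶜ ∉ M \ {B} := fun h =>
    hsep _ h b (Finset.mem_union_left _ hb) (Finset.mem_union_left _ hb)
  rw [mem_kPartitions, Finset.union_comm, ← Finset.insert_eq,
    Finset.card_insert_of_notMem hnot,
    Finset.card_sdiff_of_subset (Finset.singleton_subset_iff.2 hB),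
    hMc, Finset.card_singleton]
  have hpos : 0 < M.card := Finset.card_pos.2 ⟨B, hB⟩
  refine ⟨by omega, ?_, ?_, ?_⟩
  · intro C hC
    rcases Finset.mem_insert.1 hC with rfl | hC
    · exact ⟨b, Finset.mem_union_left _ hb⟩
    · exact h1 C (Finset.mem_sdiff.1 hC).1
  · intro C hC D hD x hxC hxD
    rcases Finset.mem_insert.1 hC with rfl | hC <;> rcases Finset.mem_insert.1 hD with rfl | hD
    · rfl
    · exact absurd hxC (hsep D hD x hxD)
    · exact absurd hxD (hsep C hC x hxC)
    · exact h2 C (Finset.mem_sdiff.1 hC).1 D (Finset.mem_sdiff.1 hD).1 x hxC hxD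
  · intro x
    simp only [Finset.mem_univ, true_iff]
    by_cases hx : x ∈ M.sup id
    · obtain ⟨C, hC, hxC⟩ := (h3 x).1 hx
      by_cases hCB : C = B
      · exact ⟨_, Finset.mem_insert_self _ _, Finset.mem_union_left _ (hCB ▸ hxC)⟩
      · exact ⟨C, Finset.mem_insert_of_mem (Finset.mem_sdiff.2 ⟨hC, by simpa using hCB⟩), hxC⟩
    · exact ⟨_, Finset.mem_insert_self _ _, Finset.mem_union_right _ (Finset.mem_compl.2 hx)⟩

theorem familyB_subset {n k : ℕ} {X M : Finset (Finset (Fin n))}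
    (hM : ∀ B ∈ M, B.card = 1) (hMc : M.card = k) (hXM : X ⊆ M) :
    familyB k X M ⊆ kPartitions n k := by
  refine Finset.union_subset (Finset.filter_subset _ _) fun F hF => ?_
  obtain ⟨B, hB, rfl⟩ := Finset.mem_image.1 hF
  refine sdiff_union_mem_kPartitions ?_ hMc (hXM hB)
  rw [Finset.sup_eq_biUnion]
  exact isPartitionOf_singletons hM

theorem starSize_lt_card_familyB {n k t : ℕ} {X M : Finset (Finset (Fin n))}
    (hM : ∀ B ∈ M, B.card = 1) (hMc : M.card = k) (hXM : X ⊆ M) (hX : X.card = t)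
    (ht : 1 ≤ t) (hn : k < n) : starSize n k t < (familyB k X M).card := by
  have htk : t ≤ k := by rw [← hX, ← hMc]; exact Finset.card_le_card hXM
  have h1 := card_starOf_singletons (n := n) (k := k) (T := X) (fun B hB => hM B (hXM hB))
    (by omega)
  rw [hX] at h1
  rw [← h1]
  refine Finset.card_lt_card ⟨Finset.subset_union_left, fun hsub => ?_⟩
  obtain ⟨B, hB⟩ := Finset.card_pos.1 (by omega : 0 < X.card)
  have hmem : (M \ {B}) ∪ {B ∪ (M.sup id)ᶜ} ∈ starOf (kPartitions n k) X :=
    hsub (Finset.mem_union_right _ (Finset.mem_image_of_mem _ hB))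
  have hB2 := (mem_starOf.1 hmem).2 hB
  rcases Finset.mem_union.1 hB2 with h | h
  · simp at h
  · rw [Finset.mem_singleton] at h
    obtain ⟨x, hx⟩ : ((M.sup id)ᶜ).Nonempty := by
      rw [← Finset.card_pos, Finset.card_compl, Fintype.card_fin, Finset.sup_eq_biUnion,
        card_biUnion_singletons hM]
      omega
    have hxB : x ∈ B := by rw [h]; exact Finset.mem_union_right _ hx
    exact Finset.mem_compl.1 hx (by rw [Finset.mem_sup]; exact ⟨B, hXM hB, hxB⟩)

/-! ### The extremal pairs: non-trivial and cross-intersecting -/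

theorem IsNonTrivialCross.symm {n k l t : ℕ} {𝓕 𝓖 : PartFamily n}
    (h : IsNonTrivialCross k l t 𝓕 𝓖) : IsNonTrivialCross l k t 𝓖 𝓕 :=
  ⟨h.2.1, h.1, h.2.2.1.symm, by
    have := h.2.2.2
    unfold NonTrivialPair at this ⊢
    rwa [Finset.inter_comm]⟩

/-- A family larger than every star of a `t`-set has fewer than `t` common blocks. -/
theorem nonTrivialPair_of_card {n k t : ℕ} {𝓕 : PartFamily n} (h𝓕 : 𝓕 ⊆ kPartitions n k)
    (hk : t < k) (hcard : starSize n k t < 𝓕.card) (𝓖 : PartFamily n) :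
    NonTrivialPair t 𝓕 𝓖 := by
  unfold NonTrivialPair
  by_contra! hcon
  obtain ⟨X, hX, hXc⟩ := Finset.exists_subset_card_eq hcon
  have h1 : starOf 𝓕 X = 𝓕 := by
    refine Finset.filter_true_of_mem fun F hF B hB => ?_
    exact (Finset.mem_filter.1 (Finset.mem_inter.1 (hX hB)).1).2 F hF
  have h2 := card_starOf_le h𝓕 (H := X) (by omega)
  rw [h1, hXc] at h2
  omega

namespace IsLarge

variable {n t p : ℕ}

theorem mul_starSize_le_card_stdD (h : IsLarge n t p) {k : ℕ} (hk : k ≤ t + p) (hk2 : t + 2 ≤ k) :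
    (t + 1) * starSize n k t ≤ (stdD n k t).card + (t + 1) * starSize n k (t + 1) := by
  have hlt := h.add_lt
  exact mul_starSize_le_card_familyD card_of_mem_singletonBlocks
    (card_singletonBlocks (by omega)) (by omega)

theorem card_stdC (h : IsLarge n t p) {k : ℕ} (hk : k ≤ t + p) (hk2 : t + 2 ≤ k) :
    (stdC n k t).card = starSize n k (t + 1) := by
  have hlt := h.add_lt
  have hc := card_singletonBlocks (n := n) (b := t + 1) (by omega)
  have := card_starOf_singletons (n := n) (k := k) (T := singletonBlocks n (t + 1))
    card_of_mem_singletonBlocks (by omega)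
  rwa [hc] at this

theorem starSize_lt_card_stdB (h : IsLarge n t p) {k : ℕ} (hk : k ≤ t + p) (hk2 : t + 2 ≤ k) :
    starSize n k t < (stdB n k t).card := by
  have hlt := h.add_lt
  exact starSize_lt_card_familyB card_of_mem_singletonBlocks (card_singletonBlocks (by omega))
    (singletonBlocks_mono (by omega)) (card_singletonBlocks (by omega)) h.one_le (by omega)

theorem mul_starSize_le_card_stdA (h : IsLarge n t p) {k l : ℕ} (hk : k ≤ t + p)
    (hk2 : t + 2 ≤ k) (hl2 : t + 2 ≤ l) :
    (k - t) * starSize n l (t + 1) ≤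
      (stdA n l k t).card + (k - t) * ((k - t - 1) * starSize n l (t + 2)) := by
  have hlt := h.add_lt
  have hsub : singletonBlocks n t ⊆ singletonBlocks n k := singletonBlocks_mono (by omega)
  refine mul_starSize_le_card_familyA card_of_mem_singletonBlocks hsub
    (card_singletonBlocks (by omega)) ?_ hl2
  rw [Finset.card_sdiff_of_subset hsub, card_singletonBlocks (by omega),
    card_singletonBlocks (by omega)]

theorem stdD_stdC (h : IsLarge n t p) {k l : ℕ} (hk : k ≤ t + p) (hk2 : t + 2 ≤ k) :
    IsNonTrivialCross k l t (stdD n k t) (stdC n l t) := by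
  refine ⟨Finset.filter_subset _ _, Finset.filter_subset _ _, ?_,
    nonTrivialPair_of_card (Finset.filter_subset _ _) (by omega) ?_ _⟩
  · intro F hF G hG
    refine (Finset.mem_filter.1 hF).2.trans (Finset.card_le_card fun B hB => ?_)
    rw [Finset.mem_inter] at hB ⊢
    exact ⟨hB.2, (Finset.mem_filter.1 hG).2 hB.1⟩
  · have h1 := h.mul_starSize_le_card_stdD hk hk2
    have h2 := h.sq_mul_starSize_le hk le_rfl hk2
    have h3 := h.starSize_pos hk (s := t + 1) (by omega)
    have h6 := h.six_le
    have ht := h.one_le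
    have h36 : 36 * starSize n k (t + 1) ≤ 2 * starSize n k t :=
      (Nat.mul_le_mul_right _ (Nat.pow_le_pow_left h6 2)).trans h2
    change starSize n k t < (stdD n k t).card
    nlinarith [Nat.mul_le_mul_left t h36, Nat.mul_le_mul_right (starSize n k (t + 1)) ht]

theorem stdB_stdA (h : IsLarge n t p) {k l : ℕ} (hk : k ≤ t + p) (hk2 : t + 2 ≤ k) :
    IsNonTrivialCross k l t (stdB n k t) (stdA n l k t) := by
  have hlt := h.add_lt
  have ht := h.one_le
  have hsub : singletonBlocks n t ⊆ singletonBlocks n k := singletonBlocks_mono (by omega)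
  have hB : stdB n k t ⊆ kPartitions n k :=
    familyB_subset card_of_mem_singletonBlocks (card_singletonBlocks (by omega)) hsub
  have htc : (singletonBlocks n t).card = t := card_singletonBlocks (by omega)
  refine ⟨hB, Finset.filter_subset _ _, ?_,
    nonTrivialPair_of_card hB (by omega) (h.starSize_lt_card_stdB hk hk2) _⟩
  intro F hF G hG
  obtain ⟨-, hXG, D, hD⟩ := Finset.mem_filter.1 hG
  rw [Finset.mem_inter, Finset.mem_sdiff] at hD
  rcases Finset.mem_union.1 hF with hF | hF
  · refine htc.symm.le.trans (Finset.card_le_card ?_)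
    exact Finset.subset_inter (Finset.mem_filter.1 hF).2 hXG
  · obtain ⟨B, hB, rfl⟩ := Finset.mem_image.1 hF
    have hcard : (insert D ((singletonBlocks n t).erase B)).card = t := by
      rw [Finset.card_insert_of_notMem fun hmem => hD.2.2 (Finset.mem_of_mem_erase hmem),
        Finset.card_erase_of_mem hB, htc]
      omega
    refine hcard.symm.le.trans (Finset.card_le_card ?_)
    intro C hC
    rw [Finset.mem_inter, Finset.mem_union, Finset.mem_sdiff, Finset.mem_singleton]
    rcases Finset.mem_insert.1 hC with rfl | hC
    · exact ⟨Or.inl ⟨hD.2.1, fun he => hD.2.2 (he ▸ hB)⟩, hD.1⟩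
    · rw [Finset.mem_erase] at hC
      exact ⟨Or.inl ⟨hsub hC.2, hC.1⟩, hXG hC.2⟩

end IsLarge

/-! ### Permutations of the ground set -/

theorem card_permFamily {n : ℕ} (σ : Equiv.Perm (Fin n)) (𝓕 : PartFamily n) :
    (permFamily σ 𝓕).card = 𝓕.card :=
  Finset.card_image_of_injective _
    (Finset.image_injective (Finset.image_injective σ.injective))

theorem image_mem_kPartitions {n k : ℕ} (σ : Equiv.Perm (Fin n)) {F : Finset (Finset (Fin n))}
    (hF : F ∈ kPartitions n k) : F.image (fun B => B.image σ) ∈ kPartitions n k := by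
  rw [mem_kPartitions] at hF ⊢
  obtain ⟨hc, h1, h2, h3⟩ := hF
  refine ⟨by rw [Finset.card_image_of_injective _ (Finset.image_injective σ.injective), hc],
    ?_, ?_, ?_⟩
  · intro B hB
    obtain ⟨C, hC, rfl⟩ := Finset.mem_image.1 hB
    exact (h1 C hC).image σ
  · intro B hB C hC x hxB hxC
    obtain ⟨B, hB', rfl⟩ := Finset.mem_image.1 hB
    obtain ⟨C, hC', rfl⟩ := Finset.mem_image.1 hC
    obtain ⟨y, hy, rfl⟩ := Finset.mem_image.1 hxB
    obtain ⟨z, hz, hzy⟩ := Finset.mem_image.1 hxC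
    rw [σ.injective hzy] at hz
    rw [h2 B hB' C hC' y hy hz]
  · intro x
    simp only [Finset.mem_univ, true_iff]
    obtain ⟨B, hB, hx⟩ := (h3 (σ.symm x)).1 (Finset.mem_univ _)
    exact ⟨_, Finset.mem_image_of_mem _ hB, Finset.mem_image.2 ⟨_, hx, σ.apply_symm_apply x⟩⟩

theorem image_singletons {α : Type*} [DecidableEq α] {T : Finset (Finset α)}
    (hT : ∀ B ∈ T, B.card = 1) : (T.biUnion id).image (fun i => ({i} : Finset α)) = T := by
  ext B
  simp only [Finset.mem_image, Finset.mem_biUnion, id_eq]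
  constructor
  · rintro ⟨x, ⟨C, hC, hx⟩, rfl⟩
    obtain ⟨c, rfl⟩ := Finset.card_eq_one.1 (hT C hC)
    rw [Finset.mem_singleton] at hx
    rwa [hx]
  · intro hB
    obtain ⟨b, rfl⟩ := Finset.card_eq_one.1 (hT B hB)
    exact ⟨b, ⟨_, hB, Finset.mem_singleton_self b⟩, rfl⟩

theorem exists_perm_image_eq {n a b : ℕ} {P₀ P : Finset (Fin n)} (hP : P₀ ⊆ P)
    (ha : P₀.card = a) (hb : P.card = b) :
    ∃ σ : Equiv.Perm (Fin n), P₀.image σ = Finset.univ.filter (fun i : Fin n => (i : ℕ) < a) ∧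
      P.image σ = Finset.univ.filter (fun i : Fin n => (i : ℕ) < b) := by
  have hab : a ≤ b := by rw [← ha, ← hb]; exact Finset.card_le_card hP
  have hbn : b ≤ n := by
    have := Finset.card_le_univ P
    rwa [hb, Fintype.card_fin] at this
  -- both sides are coloured by three colours with equal class sizes
  set f : Fin n → ℕ := fun x => if x ∈ P₀ then 0 else if x ∈ P then 1 else 2 with hf
  set g : Fin n → ℕ := fun i => if (i : ℕ) < a then 0 else if (i : ℕ) < b then 1 else 2 with hg
  have hlt : ∀ c, c ≤ n → (Finset.univ.filter fun i : Fin n => (i : ℕ) < c).card = c := by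
    intro c hc
    rw [Fin.card_filter_val_lt, min_eq_right hc]
  have hcard : ∀ c, Fintype.card {x // f x = c} = Fintype.card {i // g i = c} := by
    intro c
    rw [Fintype.card_subtype, Fintype.card_subtype]
    rcases c with _ | _ | _ | c
    · have e1 : Finset.univ.filter (fun x => f x = 0) = P₀ := by
        ext x
        simp only [hf, Finset.mem_filter, Finset.mem_univ, true_and]
        split_ifs with h1 h2 <;> simp [h1]
      have e2 : Finset.univ.filter (fun x => g x = 0) =
          Finset.univ.filter fun i : Fin n => (i : ℕ) < a := by
        ext x
        simp only [hg, Finset.mem_filter, Finset.mem_univ, true_and]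
        split_ifs with h1 h2 <;> simp [h1]
      rw [e1, e2, ha, hlt a (by omega)]
    · have e1 : Finset.univ.filter (fun x => f x = 0 + 1) = P \ P₀ := by
        ext x
        simp only [hf, Finset.mem_filter, Finset.mem_univ, true_and, Finset.mem_sdiff]
        split_ifs <;> simp_all
      have e2 : Finset.univ.filter (fun x => g x = 0 + 1) =
          (Finset.univ.filter fun i : Fin n => (i : ℕ) < b) \
            (Finset.univ.filter fun i : Fin n => (i : ℕ) < a) := by
        ext x
        simp only [hg, Finset.mem_filter, Finset.mem_univ, true_and, Finset.mem_sdiff]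
        split_ifs <;> simp <;> omega
      rw [e1, e2, Finset.card_sdiff_of_subset hP, Finset.card_sdiff_of_subset, hlt a (by omega),
        hlt b hbn, ha, hb]
      exact Finset.monotone_filter_right _ fun _ _ h => lt_of_lt_of_le h hab
    · have e1 : Finset.univ.filter (fun x => f x = 0 + 1 + 1) = Pᶜ := by
        ext x
        simp only [hf, Finset.mem_filter, Finset.mem_univ, true_and, Finset.mem_compl]
        split_ifs with h1 h2
        · simp [hP h1]
        · simp [h2]
        · simp [h2]
      have e2 : Finset.univ.filter (fun x => g x = 0 + 1 + 1) =
          (Finset.univ.filter fun i : Fin n => (i : ℕ) < b)ᶜ := by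
        ext x
        simp only [hg, Finset.mem_filter, Finset.mem_univ, true_and, Finset.mem_compl]
        split_ifs <;> simp <;> omega
      rw [e1, e2, Finset.card_compl, Finset.card_compl, hlt b hbn, hb]
    · have e1 : Finset.univ.filter (fun x => f x = c + 1 + 1 + 1) = ∅ := by
        ext x
        simp only [hf, Finset.mem_filter, Finset.mem_univ, true_and, Finset.notMem_empty, iff_false]
        split_ifs <;> simp
      have e2 : Finset.univ.filter (fun x => g x = c + 1 + 1 + 1) = ∅ := by
        ext x
        simp only [hg, Finset.mem_filter, Finset.mem_univ, true_and, Finset.notMem_empty, iff_false]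
        split_ifs <;> simp
      rw [e1, e2]
  let σ : Equiv.Perm (Fin n) := Equiv.ofFiberEquiv fun c => Fintype.equivOfCardEq (hcard c)
  have hσ : ∀ x, g (σ x) = f x := fun x => Equiv.ofFiberEquiv_map _ x
  refine ⟨σ, ?_, ?_⟩
  · refine Finset.eq_of_subset_of_card_le ?_ ?_
    · intro y hy
      obtain ⟨x, hx, rfl⟩ := Finset.mem_image.1 hy
      have h1 := hσ x
      simp only [hf, hg, hx, if_true] at h1
      rw [Finset.mem_filter]
      refine ⟨Finset.mem_univ _, ?_⟩
      by_contra hcon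
      rw [if_neg hcon] at h1
      split_ifs at h1
    · rw [hlt a (by omega), Finset.card_image_of_injective _ σ.injective, ha]
  · refine Finset.eq_of_subset_of_card_le ?_ ?_
    · intro y hy
      obtain ⟨x, hx, rfl⟩ := Finset.mem_image.1 hy
      have h1 := hσ x
      rw [Finset.mem_filter]
      refine ⟨Finset.mem_univ _, ?_⟩
      by_contra hcon
      simp only [hf, hg, hx, if_true] at h1
      rw [if_neg (by omega), if_neg hcon] at h1
      split_ifs at h1
      omega
    · rw [hlt b hbn, Finset.card_image_of_injective _ σ.injective, hb]

/-- Nested sets of singletons can be moved to the standard position. -/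
theorem exists_perm_singletonBlocks {n a b : ℕ} {X M : Finset (Finset (Fin n))}
    (hM : ∀ B ∈ M, B.card = 1) (hXM : X ⊆ M) (ha : X.card = a) (hb : M.card = b) :
    ∃ σ : Equiv.Perm (Fin n), X.image (fun B => B.image σ) = singletonBlocks n a ∧
      M.image (fun B => B.image σ) = singletonBlocks n b := by
  have hX : ∀ B ∈ X, B.card = 1 := fun B hB => hM B (hXM hB)
  obtain ⟨σ, h1, h2⟩ := exists_perm_image_eq (Finset.biUnion_subset_biUnion_of_subset_left id hXM)
    ((card_biUnion_singletons hX).trans ha) ((card_biUnion_singletons hM).trans hb)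
  refine ⟨σ, ?_, ?_⟩
  · conv_lhs => rw [← image_singletons hX]
    rw [singletonBlocks, ← h1, Finset.image_image, Finset.image_image]
    refine Finset.image_congr fun i _ => ?_
    simp
  · conv_lhs => rw [← image_singletons hM]
    rw [singletonBlocks, ← h2, Finset.image_image, Finset.image_image]
    refine Finset.image_congr fun i _ => ?_
    simp

theorem pairIso_of_subset {n : ℕ} {𝓕 𝓖 𝓕' 𝓖' : PartFamily n} (σ : Equiv.Perm (Fin n))
    (h1 : permFamily σ 𝓕 ⊆ 𝓕') (h2 : permFamily σ 𝓖 ⊆ 𝓖')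
    (hmax : 𝓕'.card * 𝓖'.card ≤ 𝓕.card * 𝓖.card) (hpos : 0 < 𝓕'.card * 𝓖'.card) :
    PairIso 𝓕 𝓖 𝓕' 𝓖' := by
  have c1 := Finset.card_le_card h1
  have c2 := Finset.card_le_card h2
  rw [card_permFamily] at c1 c2
  have p1 : 0 < 𝓕'.card := Nat.pos_of_mul_pos_right hpos
  have p2 : 0 < 𝓖'.card := Nat.pos_of_mul_pos_left hpos
  refine ⟨σ, Finset.eq_of_subset_of_card_le h1 ?_, Finset.eq_of_subset_of_card_le h2 ?_⟩
  · rw [card_permFamily]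
    by_contra! hcon
    have := Nat.mul_lt_mul_of_lt_of_le hcon c2 p2
    omega
  · rw [card_permFamily]
    by_contra! hcon
    have := Nat.mul_lt_mul_of_le_of_lt c1 hcon p1
    omega

theorem permFamily_subset_familyC {n k : ℕ} (σ : Equiv.Perm (Fin n)) {𝓕 : PartFamily n}
    {T : Finset (Finset (Fin n))} (h : 𝓕 ⊆ familyC k T) :
    permFamily σ 𝓕 ⊆ familyC k (T.image fun B => B.image σ) := by
  intro F' hF'
  obtain ⟨F, hF, rfl⟩ := Finset.mem_image.1 hF'
  have := Finset.mem_filter.1 (h hF)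
  exact Finset.mem_filter.2 ⟨image_mem_kPartitions σ this.1, Finset.image_subset_image this.2⟩

theorem permFamily_subset_familyD {n k t : ℕ} (σ : Equiv.Perm (Fin n)) {𝓕 : PartFamily n}
    {T : Finset (Finset (Fin n))} (h : 𝓕 ⊆ familyD k t T) :
    permFamily σ 𝓕 ⊆ familyD k t (T.image fun B => B.image σ) := by
  intro F' hF'
  obtain ⟨F, hF, rfl⟩ := Finset.mem_image.1 hF'
  have := Finset.mem_filter.1 (h hF)
  refine Finset.mem_filter.2 ⟨image_mem_kPartitions σ this.1, ?_⟩
  rw [← Finset.image_inter _ _ (Finset.image_injective σ.injective),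
    Finset.card_image_of_injective _ (Finset.image_injective σ.injective)]
  exact this.2

theorem permFamily_subset_familyA {n k : ℕ} (σ : Equiv.Perm (Fin n)) {𝓕 : PartFamily n}
    {X M : Finset (Finset (Fin n))} (h : 𝓕 ⊆ familyA k X M) :
    permFamily σ 𝓕 ⊆
      familyA k (X.image fun B => B.image σ) (M.image fun B => B.image σ) := by
  intro F' hF'
  obtain ⟨F, hF, rfl⟩ := Finset.mem_image.1 hF'
  have := Finset.mem_filter.1 (h hF)
  refine Finset.mem_filter.2 ⟨image_mem_kPartitions σ this.1,
    Finset.image_subset_image this.2.1, ?_⟩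
  rw [← Finset.image_sdiff _ _ (Finset.image_injective σ.injective),
    ← Finset.image_inter _ _ (Finset.image_injective σ.injective)]
  exact this.2.2.image _

theorem permFamily_subset_familyB {n k : ℕ} (σ : Equiv.Perm (Fin n)) {𝓕 : PartFamily n}
    {X M : Finset (Finset (Fin n))} (h : 𝓕 ⊆ familyB k X M) :
    permFamily σ 𝓕 ⊆
      familyB k (X.image fun B => B.image σ) (M.image fun B => B.image σ) := by
  intro F' hF'
  obtain ⟨F, hF, rfl⟩ := Finset.mem_image.1 hF'
  rcases Finset.mem_union.1 (h hF) with hF | hF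
  · have := Finset.mem_filter.1 hF
    exact Finset.mem_union_left _ (Finset.mem_filter.2
      ⟨image_mem_kPartitions σ this.1, Finset.image_subset_image this.2⟩)
  · obtain ⟨B, hB, rfl⟩ := Finset.mem_image.1 hF
    refine Finset.mem_union_right _
      (Finset.mem_image.2 ⟨B.image σ, Finset.mem_image_of_mem _ hB, ?_⟩)
    have hsup : (M.image fun B => B.image σ).sup id = (M.sup id).image σ := by
      ext x
      simp only [Finset.mem_sup, Finset.mem_image, id_eq]
      constructor
      · rintro ⟨_, ⟨C, hC, rfl⟩, hx⟩
        obtain ⟨y, hy, rfl⟩ := Finset.mem_image.1 hx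
        exact ⟨y, ⟨C, hC, hy⟩, rfl⟩
      · rintro ⟨y, ⟨C, hC, hy⟩, rfl⟩
        exact ⟨_, ⟨C, hC, rfl⟩, Finset.mem_image_of_mem _ hy⟩
    have hcompl : ((M.sup id)ᶜ).image σ = ((M.sup id).image σ)ᶜ := by
      rw [Finset.compl_eq_univ_sdiff, Finset.image_sdiff _ _ σ.injective,
        Finset.image_univ_of_surjective σ.surjective, ← Finset.compl_eq_univ_sdiff]
    rw [hsup, Finset.image_union, Finset.image_sdiff _ _ (Finset.image_injective σ.injective),
      Finset.image_singleton, Finset.image_singleton, Finset.image_union,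
      hcompl]

/-! ### Estimates for minimal covers and lower bounds for the optimum -/

theorem choose_mul_pow_mul_le {n t p l s x : ℕ} :
    (((t + x).choose t * p ^ x * starSize n l s : ℕ) : ℝ) ≤
      (((t : ℝ) + 1) * p) ^ x * starSize n l s := by
  have : (((t + x).choose t : ℕ) : ℝ) ≤ ((t : ℝ) + 1) ^ x := by
    exact_mod_cast choose_add_le_pow t x
  push_cast
  rw [mul_pow]
  gcongr

namespace IsLarge

variable {n t p : ℕ}

theorem ratio_le (h : IsLarge n t p) {k s : ℕ} (hk : k ≤ t + p) (hs : t ≤ s) (hsk : s + 2 ≤ k) :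
    (starSize n k (s + 1) : ℝ) ≤ 2 / (((t : ℝ) + 1) * (p + 1)) ^ 2 * starSize n k s := by
  simpa using h.starSize_add_le (i := 1) hk hs (by omega)

theorem one_le_cast (h : IsLarge n t p) : (1 : ℝ) ≤ t := by exact_mod_cast h.one_le

theorem two_le_cast (h : IsLarge n t p) : (2 : ℝ) ≤ p := by exact_mod_cast h.two_le

theorem ratio_le_one_div (h : IsLarge n t p) :
    2 / (((t : ℝ) + 1) * (p + 1)) ^ 2 ≤ 1 / 18 := by
  have h1 := h.one_le_cast
  have h2 := h.two_le_cast
  have h6 : (6 : ℝ) ≤ ((t : ℝ) + 1) * (p + 1) := by nlinarith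
  rw [div_le_div_iff₀ (by positivity) (by norm_num)]
  nlinarith

theorem mul_sq_mul_ratio_le (h : IsLarge n t p) :
    ((t : ℝ) + 1) * p ^ 2 * (2 / (((t : ℝ) + 1) * (p + 1)) ^ 2) ≤ 1 := by
  have h1 := h.one_le_cast
  have h2 := h.two_le_cast
  rw [mul_div_assoc', div_le_one (by positivity), mul_pow]
  have : (p : ℝ) ^ 2 ≤ (p + 1) ^ 2 := by nlinarith
  calc ((t : ℝ) + 1) * p ^ 2 * 2 ≤ ((t : ℝ) + 1) * (p + 1) ^ 2 * (t + 1) := by gcongr; linarith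
    _ = _ := by ring

theorem sq_mul_ratio_le (h : IsLarge n t p) :
    (p : ℝ) ^ 2 * (2 / (((t : ℝ) + 1) * (p + 1)) ^ 2) ≤ 1 / 2 := by
  have h1 := h.one_le_cast
  have h3 := h.mul_sq_mul_ratio_le
  have h4 : 0 ≤ (p : ℝ) ^ 2 * (2 / (((t : ℝ) + 1) * (p + 1)) ^ 2) := by positivity
  nlinarith

theorem mul_mul_ratio_le (h : IsLarge n t p) :
    (t : ℝ) * p * (2 / (((t : ℝ) + 1) * (p + 1)) ^ 2) ≤ 1 / 9 := by
  have h1 := h.one_le_cast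
  have h2 := h.two_le_cast
  rw [mul_div_assoc', div_le_div_iff₀ (by positivity) (by norm_num), mul_pow]
  have a1 : 4 * (t : ℝ) ≤ (t + 1) ^ 2 := by nlinarith [sq_nonneg ((t : ℝ) - 1)]
  have a2 : 9 * (p : ℝ) ≤ 2 * (p + 1) ^ 2 := by nlinarith
  nlinarith [mul_le_mul a1 a2 (by positivity) (by positivity)]

/-- If a smallest cover of one family is as large as the blocks of the other allow, all its stars
are tiny, because only one partition contains `l - 1` given blocks. -/
theorem sq_mul_choose_le (h : IsLarge n t p) {l : ℕ} (hl : l ≤ t + p) (hl2 : t + 2 ≤ l) :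
    ((t + 1) * (p + 1)) ^ 2 * (l.choose t * p ^ (l - 1 - t) * starSize n l (l - 1)) ≤
      starSize n l (l - 2) := by
  rw [h.starSize_pred hl (by omega), mul_one]
  refine le_trans ?_ (h.pow_le_starSize_sub_two hl (by omega))
  have h6 := h.six_le
  obtain ⟨x, rfl⟩ : ∃ x, l = t + x := Nat.exists_eq_add_of_le (by omega)
  have h1 : p ^ (t + x - 1 - t) ≤ (p + 1) ^ x :=
    (Nat.pow_le_pow_left (Nat.le_succ p) _).trans
      (Nat.pow_le_pow_right (Nat.succ_pos p) (by omega))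
  calc ((t + 1) * (p + 1)) ^ 2 * ((t + x).choose t * p ^ (t + x - 1 - t))
      ≤ ((t + 1) * (p + 1)) ^ 2 * ((t + 1) ^ x * (p + 1) ^ x) :=
        Nat.mul_le_mul_left _ (Nat.mul_le_mul (choose_add_le_pow t x) h1)
    _ = ((t + 1) * (p + 1)) ^ (2 + x) := by rw [← mul_pow, pow_add]
    _ ≤ ((t + 1) * (p + 1)) ^ (p + 2) := Nat.pow_le_pow_right (by omega) (by omega)

theorem mul_ratio_le_one (h : IsLarge n t p) :
    ((t : ℝ) + 1) * p * (2 / (((t : ℝ) + 1) * (p + 1)) ^ 2) ≤ 1 := by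
  have h2 := h.two_le_cast
  refine le_trans ?_ h.mul_sq_mul_ratio_le
  gcongr
  nlinarith

theorem choose_mul_le_top (h : IsLarge n t p) {l s : ℕ} {c : ℝ} (hl : l ≤ t + p)
    (hl2 : t + 2 ≤ l) (hs : t ≤ s) (hsl : s + 2 ≤ l) (hc : 1 ≤ (((t : ℝ) + 1) * (p + 1)) ^ 2 * c) :
    ((l.choose t * p ^ (l - 1 - t) * starSize n l (l - 1) : ℕ) : ℝ) ≤ c * starSize n l s := by
  have h1 := (h.sq_mul_choose_le hl hl2).trans
    (h.starSize_antitone hl hs (by omega : s ≤ l - 2) (by omega))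
  have h1' : (((t : ℝ) + 1) * (p + 1)) ^ 2 *
      ((l.choose t * p ^ (l - 1 - t) * starSize n l (l - 1) : ℕ) : ℝ) ≤ starSize n l s := by
    exact_mod_cast h1
  have hQ : (0 : ℝ) < (((t : ℝ) + 1) * (p + 1)) ^ 2 := by positivity
  refine le_of_mul_le_mul_left (h1'.trans ?_) hQ
  rw [← mul_assoc]
  exact le_mul_of_one_le_left (Nat.cast_nonneg _) hc

/-- The contribution of a smallest cover with `τ > t` blocks, measured by a star of `t` blocks. -/
theorem choose_mul_le_ratio_mul (h : IsLarge n t p) {l τ : ℕ} (hl : l ≤ t + p) (hl2 : t + 2 ≤ l)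
    (hτ : t + 1 ≤ τ) (hτl : τ ≤ l) :
    ((τ.choose t * p ^ (min τ (l - 1) - t) * starSize n l (min τ (l - 1)) : ℕ) : ℝ) ≤
      ((t : ℝ) + 1) * p * (2 / (((t : ℝ) + 1) * (p + 1)) ^ 2) * starSize n l t := by
  have h1 := h.one_le_cast
  have h2 := h.two_le_cast
  rcases hτl.eq_or_lt with rfl | hlt
  · rw [min_eq_right (by omega)]
    refine h.choose_mul_le_top hl hl2 le_rfl hl2 ?_
    have hQ : (0 : ℝ) < (((t : ℝ) + 1) * (p + 1)) ^ 2 := by positivity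
    rw [mul_left_comm, mul_div_cancel₀ _ hQ.ne']
    nlinarith
  · rw [min_eq_left (by omega)]
    obtain ⟨x, rfl⟩ : ∃ x, τ = t + (x + 1) := Nat.exists_eq_add_of_le hτ |>.imp fun x hx => by omega
    rw [Nat.add_sub_cancel_left]
    refine choose_mul_pow_mul_le.trans ?_
    have h3 := h.starSize_add_le (i := x + 1) hl le_rfl (by omega)
    set r := 2 / (((t : ℝ) + 1) * (p + 1)) ^ 2 with hr
    have hr0 : 0 ≤ r := by positivity
    have hqr := h.mul_ratio_le_one
    calc (((t : ℝ) + 1) * p) ^ (x + 1) * starSize n l (t + (x + 1))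
        ≤ (((t : ℝ) + 1) * p) ^ (x + 1) * (r ^ (x + 1) * starSize n l t) := by gcongr
      _ = (((t : ℝ) + 1) * p * r) ^ x * (((t : ℝ) + 1) * p * r * starSize n l t) := by
          rw [mul_pow (((t : ℝ) + 1) * p) r x]; ring
      _ ≤ 1 * (((t : ℝ) + 1) * p * r * starSize n l t) := by
          refine mul_le_mul_of_nonneg_right (pow_le_one₀ (by positivity) hqr) (by positivity)
      _ = _ := one_mul _

/-- The contribution of a smallest cover with `τ > t` blocks, measured by a star of `t + 1`
blocks. -/
theorem choose_mul_le_mul (h : IsLarge n t p) {l τ : ℕ} (hl : l ≤ t + p) (hl3 : t + 3 ≤ l)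
    (hτ : t + 1 ≤ τ) (hτl : τ ≤ l) :
    ((τ.choose t * p ^ (min τ (l - 1) - t) * starSize n l (min τ (l - 1)) : ℕ) : ℝ) ≤
      ((t : ℝ) + 1) * p * starSize n l (t + 1) := by
  have h1 := h.one_le_cast
  have h2 := h.two_le_cast
  rcases hτl.eq_or_lt with rfl | hlt
  · rw [min_eq_right (by omega)]
    refine h.choose_mul_le_top hl (by omega) (by omega) (by omega) ?_
    have h6 : (6 : ℝ) ≤ ((t : ℝ) + 1) * (p + 1) := by nlinarith
    exact one_le_mul_of_one_le_of_one_le (by nlinarith) (by nlinarith)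
  · rw [min_eq_left (by omega)]
    obtain ⟨x, rfl⟩ : ∃ x, τ = t + (x + 1) := Nat.exists_eq_add_of_le hτ |>.imp fun x hx => by omega
    rw [Nat.add_sub_cancel_left]
    refine choose_mul_pow_mul_le.trans ?_
    have h3 := h.starSize_add_le (i := x) (s := t + 1) hl (by omega) (by omega)
    rw [show t + 1 + x = t + (x + 1) by ring] at h3
    set r := 2 / (((t : ℝ) + 1) * (p + 1)) ^ 2 with hr
    have hr0 : 0 ≤ r := by positivity
    have hqr := h.mul_ratio_le_one
    calc (((t : ℝ) + 1) * p) ^ (x + 1) * starSize n l (t + (x + 1))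
        ≤ (((t : ℝ) + 1) * p) ^ (x + 1) * (r ^ x * starSize n l (t + 1)) := by gcongr
      _ = (((t : ℝ) + 1) * p * r) ^ x * (((t : ℝ) + 1) * p * starSize n l (t + 1)) := by
          rw [mul_pow (((t : ℝ) + 1) * p) r x]; ring
      _ ≤ 1 * (((t : ℝ) + 1) * p * starSize n l (t + 1)) := by
          refine mul_le_mul_of_nonneg_right (pow_le_one₀ (by positivity) hqr) (by positivity)
      _ = _ := one_mul _

/-- The contribution of a smallest cover with at least `t + 2` blocks. -/
theorem choose_mul_le_three_halves_mul (h : IsLarge n t p) {l τ : ℕ} (hl : l ≤ t + p)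
    (hl3 : t + 3 ≤ l) (hτ : t + 2 ≤ τ) (hτl : τ ≤ l) :
    ((τ.choose t * p ^ (min τ (l - 1) - t) * starSize n l (min τ (l - 1)) : ℕ) : ℝ) ≤
      3 / 2 * starSize n l (t + 1) := by
  have h1 := h.one_le_cast
  have h2 := h.two_le_cast
  have h6 : (6 : ℝ) ≤ ((t : ℝ) + 1) * (p + 1) := by nlinarith
  rcases hτl.eq_or_lt with rfl | hlt
  · rw [min_eq_right (by omega)]
    refine h.choose_mul_le_top hl (by omega) (by omega) (by omega) ?_
    nlinarith
  · rw [min_eq_left (by omega)]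
    obtain ⟨x, rfl⟩ : ∃ x, τ = t + (x + 2) := Nat.exists_eq_add_of_le hτ |>.imp fun x hx => by omega
    rw [Nat.add_sub_cancel_left]
    have h3 := h.starSize_add_le (i := x + 1) (s := t + 1) hl (by omega) (by omega)
    rw [show t + 1 + (x + 1) = t + (x + 2) by ring] at h3
    have hqr := h.mul_ratio_le_one
    set r := 2 / (((t : ℝ) + 1) * (p + 1)) ^ 2 with hr
    have hr0 : 0 ≤ r := by positivity
    rcases Nat.eq_zero_or_pos x with rfl | hx
    · have hch : (((t + (0 + 2)).choose t : ℕ) : ℝ) = (t + 2) * (t + 1) / 2 := by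
        rw [zero_add, Nat.choose_symm_add, Nat.cast_choose_two]
        push_cast
        ring
      have hsmall : (((t : ℝ) + 2) * (t + 1) / 2) * (p ^ 2 * r) ≤ 3 / 2 := by
        rw [hr, mul_div_assoc', mul_div_assoc', div_le_div_iff₀ (by positivity) (by norm_num),
          mul_pow]
        have a1 : ((t : ℝ) + 2) * (t + 1) * 2 ≤ 3 * (t + 1) ^ 2 := by nlinarith
        have a2 : (p : ℝ) ^ 2 ≤ (p + 1) ^ 2 := by nlinarith
        nlinarith [mul_le_mul a1 a2 (by positivity) (by positivity)]
      push_cast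
      rw [hch]
      calc ((t : ℝ) + 2) * (t + 1) / 2 * p ^ 2 * starSize n l (t + 2)
          ≤ ((t : ℝ) + 2) * (t + 1) / 2 * p ^ 2 * (r ^ (0 + 1) * starSize n l (t + 1)) := by
            gcongr
        _ = (((t : ℝ) + 2) * (t + 1) / 2) * (p ^ 2 * r) * starSize n l (t + 1) := by ring
        _ ≤ _ := by gcongr
    · obtain ⟨y, rfl⟩ := Nat.exists_eq_add_of_le' hx
      refine choose_mul_pow_mul_le.trans ?_
      have hsmall : (((t : ℝ) + 1) * p) * (((t : ℝ) + 1) * p * r) ^ 2 ≤ 3 / 2 := by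
        have hQ : (0 : ℝ) < ((t : ℝ) + 1) * (p + 1) := by positivity
        have a1 : ((t : ℝ) + 1) * p ≤ ((t : ℝ) + 1) * (p + 1) := by nlinarith
        calc (((t : ℝ) + 1) * p) * (((t : ℝ) + 1) * p * r) ^ 2
            ≤ (((t : ℝ) + 1) * (p + 1)) * (((t : ℝ) + 1) * (p + 1) * r) ^ 2 := by gcongr
          _ = 4 / (((t : ℝ) + 1) * (p + 1)) := by rw [hr]; field_simp; norm_num
          _ ≤ 3 / 2 := by rw [div_le_div_iff₀ hQ (by norm_num)]; linarith
      calc (((t : ℝ) + 1) * p) ^ (y + 1 + 2) * starSize n l (t + (y + 1 + 2))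
          ≤ (((t : ℝ) + 1) * p) ^ (y + 1 + 2) * (r ^ (y + 1 + 1) * starSize n l (t + 1)) := by
            gcongr
        _ = (((t : ℝ) + 1) * p * r) ^ y *
            ((((t : ℝ) + 1) * p) * (((t : ℝ) + 1) * p * r) ^ 2 * starSize n l (t + 1)) := by
          rw [mul_pow (((t : ℝ) + 1) * p) r y]; ring
        _ ≤ 1 * (3 / 2 * starSize n l (t + 1)) :=
            mul_le_mul (pow_le_one₀ (by positivity) hqr)
              (mul_le_mul_of_nonneg_right hsmall (Nat.cast_nonneg _)) (by positivity) one_pos.le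
        _ = _ := one_mul _

end IsLarge

/-- A non-trivial cross `t`-intersecting pair of largest product of sizes. -/
def IsOptimal {n : ℕ} (k l t : ℕ) (𝓕 𝓖 : PartFamily n) : Prop :=
  IsNonTrivialCross k l t 𝓕 𝓖 ∧ ∀ 𝓕' 𝓖' : PartFamily n, IsNonTrivialCross k l t 𝓕' 𝓖' →
    𝓕'.card * 𝓖'.card ≤ 𝓕.card * 𝓖.card

namespace IsOptimal

variable {n k l t p : ℕ} {𝓕 𝓖 : PartFamily n}

theorem symm (h : IsOptimal k l t 𝓕 𝓖) : IsOptimal l k t 𝓖 𝓕 :=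
  ⟨h.1.symm, fun 𝓕' 𝓖' h' => by
    rw [mul_comm, mul_comm 𝓖.card]
    exact h.2 𝓖' 𝓕' h'.symm⟩

/-- Comparison with `(𝓓, 𝓒)`. -/
theorem stdD_le (h : IsOptimal k l t 𝓕 𝓖) (hL : IsLarge n t p) (hk : k ≤ t + p)
    (hk2 : t + 2 ≤ k) (hl : l ≤ t + p) (hl2 : t + 2 ≤ l) :
    ((t : ℝ) + 1) * (1 - 2 / (((t : ℝ) + 1) * (p + 1)) ^ 2) *
      (starSize n k t * starSize n l (t + 1)) ≤ (𝓕.card : ℝ) * 𝓖.card := by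
  have h1 := h.2 _ _ (hL.stdD_stdC (l := l) hk hk2)
  rw [hL.card_stdC hl hl2] at h1
  have h1' : ((stdD n k t).card : ℝ) * starSize n l (t + 1) ≤ (𝓕.card : ℝ) * 𝓖.card := by
    exact_mod_cast h1
  refine le_trans ?_ h1'
  have h2 : ((t : ℝ) + 1) * starSize n k t ≤
      (stdD n k t).card + ((t : ℝ) + 1) * starSize n k (t + 1) := by
    exact_mod_cast hL.mul_starSize_le_card_stdD hk hk2
  have h3 := mul_le_mul_of_nonneg_left (hL.ratio_le hk le_rfl hk2)
    (by positivity : (0 : ℝ) ≤ (t : ℝ) + 1)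
  rw [← mul_assoc]
  refine mul_le_mul_of_nonneg_right ?_ (Nat.cast_nonneg _)
  linarith

/-- Any bound below `17 / 9` contradicts optimality. -/
theorem lt_of_card_le (h : IsOptimal k l t 𝓕 𝓖) (hL : IsLarge n t p) (hk : k ≤ t + p)
    (hk2 : t + 2 ≤ k) (hl : l ≤ t + p) (hl2 : t + 2 ≤ l) {c : ℝ}
    (hc : (𝓕.card : ℝ) * 𝓖.card ≤ c * (starSize n k t * starSize n l (t + 1))) : 17 / 9 ≤ c := by
  have h1 := h.stdD_le hL hk hk2 hl hl2
  have h2 := hL.ratio_le_one_div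
  have h3 := hL.one_le_cast
  have p1 : (0 : ℝ) < starSize n k t := by exact_mod_cast hL.starSize_pos hk (s := t) (by omega)
  have p2 : (0 : ℝ) < starSize n l (t + 1) := by
    exact_mod_cast hL.starSize_pos hl (s := t + 1) (by omega)
  have h4 := le_of_mul_le_mul_right (h1.trans hc) (mul_pos p1 p2)
  nlinarith

theorem card_pos (h : IsOptimal k l t 𝓕 𝓖) (hL : IsLarge n t p) (hk : k ≤ t + p)
    (hk2 : t + 2 ≤ k) (hl : l ≤ t + p) (hl2 : t + 2 ≤ l) : 𝓕.Nonempty ∧ 𝓖.Nonempty := by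
  rw [← Finset.card_pos, ← Finset.card_pos]
  by_contra hcon
  have h0 : (𝓕.card : ℝ) * 𝓖.card = 0 := by
    rw [not_and_or, not_lt, not_lt, Nat.le_zero, Nat.le_zero] at hcon
    rcases hcon with h0 | h0 <;> simp [h0]
  have := h.lt_of_card_le hL hk hk2 hl hl2 (c := 0) (by rw [h0, zero_mul])
  norm_num at this

/-- Comparison with `(𝓑, 𝓐)`. -/
theorem stdB_le (h : IsOptimal k l t 𝓕 𝓖) (hL : IsLarge n t p) (hk : k ≤ t + p)
    (hk2 : t + 2 ≤ k) (hl : l ≤ t + p) (hl3 : t + 3 ≤ l) :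
    ((k : ℝ) - t) * (1 - ((k : ℝ) - t - 1) * (2 / (((t : ℝ) + 1) * (p + 1)) ^ 2)) *
      (starSize n k t * starSize n l (t + 1)) ≤ (𝓕.card : ℝ) * 𝓖.card := by
  have h1 := h.2 _ _ (hL.stdB_stdA (l := l) hk hk2)
  have h1' : ((stdB n k t).card : ℝ) * (stdA n l k t).card ≤ (𝓕.card : ℝ) * 𝓖.card := by
    exact_mod_cast h1
  refine le_trans ?_ h1'
  have hB : (starSize n k t : ℝ) ≤ (stdB n k t).card := by
    exact_mod_cast (hL.starSize_lt_card_stdB hk hk2).le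
  obtain ⟨w, rfl⟩ : ∃ w, k = t + (w + 1) := Nat.exists_eq_add_of_le (by omega : t + 1 ≤ k) |>.imp
    fun x hx => by omega
  have hA := hL.mul_starSize_le_card_stdA hk hk2 (by omega : t + 2 ≤ l)
  rw [Nat.add_sub_cancel_left, Nat.add_sub_cancel] at hA
  have hA' : ((w : ℝ) + 1) * starSize n l (t + 1) ≤
      (stdA n l (t + (w + 1)) t).card + ((w : ℝ) + 1) * (w * starSize n l (t + 2)) := by
    exact_mod_cast hA
  have h3 := mul_le_mul_of_nonneg_left (hL.ratio_le hl (by omega : t ≤ t + 1) (by omega))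
    (by positivity : (0 : ℝ) ≤ ((w : ℝ) + 1) * w)
  push_cast
  set r := 2 / (((t : ℝ) + 1) * (p + 1)) ^ 2
  calc ((t : ℝ) + (w + 1) - t) * (1 - ((t : ℝ) + (w + 1) - t - 1) * r) *
        (starSize n (t + (w + 1)) t * starSize n l (t + 1))
      = starSize n (t + (w + 1)) t * (((w : ℝ) + 1) * starSize n l (t + 1) -
          ((w : ℝ) + 1) * w * (r * starSize n l (t + 1))) := by ring
    _ ≤ starSize n (t + (w + 1)) t * (stdA n l (t + (w + 1)) t).card := by
        refine mul_le_mul_of_nonneg_left ?_ (Nat.cast_nonneg _)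
        linarith
    _ ≤ _ := mul_le_mul_of_nonneg_right hB (Nat.cast_nonneg _)

/-- An optimal pair contained in a pair of type `(𝓓, 𝓒)` on singletons is that pair. -/
theorem pairIso_stdD (h : IsOptimal k l t 𝓕 𝓖) (hL : IsLarge n t p) (hk : k ≤ t + p)
    (hk2 : t + 2 ≤ k) (hl : l ≤ t + p) (hl2 : t + 2 ≤ l) {T : Finset (Finset (Fin n))}
    (hT : ∀ B ∈ T, B.card = 1) (hTc : T.card = t + 1) (h𝓕 : IsCover t 𝓕 T)
    (h𝓖 : ∀ G ∈ 𝓖, T ⊆ G) : PairIso 𝓕 𝓖 (stdD n k t) (stdC n l t) := by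
  obtain ⟨σ, hσ, -⟩ := exists_perm_singletonBlocks hT (Finset.Subset.refl T) hTc hTc
  refine pairIso_of_subset σ ?_ ?_ (h.2 _ _ (hL.stdD_stdC hk hk2)) ?_
  · rw [stdD, ← hσ]
    exact permFamily_subset_familyD σ fun F hF => Finset.mem_filter.2 ⟨h.1.1 hF, h𝓕 F hF⟩
  · rw [stdC, ← hσ]
    exact permFamily_subset_familyC σ fun G hG => Finset.mem_filter.2 ⟨h.1.2.1 hG, h𝓖 G hG⟩
  · refine Nat.mul_pos ?_ ?_
    · have h1 := hL.mul_starSize_le_card_stdD hk hk2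
      have h2 := hL.sq_mul_starSize_le hk le_rfl hk2
      have h3 := hL.starSize_pos hk (s := t + 1) (by omega)
      have h6 := hL.six_le
      have h36 : 36 * starSize n k (t + 1) ≤ 2 * starSize n k t :=
        (Nat.mul_le_mul_right _ (Nat.pow_le_pow_left h6 2)).trans h2
      nlinarith
    · rw [hL.card_stdC hl hl2]
      exact hL.starSize_pos hl (by omega)

/-- An optimal pair contained in a pair of type `(𝓑, 𝓐)` on singletons is that pair. -/
theorem pairIso_stdB (h : IsOptimal k l t 𝓕 𝓖) (hL : IsLarge n t p) (hk : k ≤ t + p)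
    (hk2 : t + 2 ≤ k) (hl : l ≤ t + p) (hl3 : t + 3 ≤ l) {X M : Finset (Finset (Fin n))}
    (hM : ∀ B ∈ M, B.card = 1) (hXM : X ⊆ M) (hX : X.card = t) (hMc : M.card = k)
    (h𝓕 : 𝓕 ⊆ familyB k X M) (h𝓖 : 𝓖 ⊆ familyA l X M) :
    PairIso 𝓕 𝓖 (stdB n k t) (stdA n l k t) := by
  obtain ⟨σ, hσX, hσM⟩ := exists_perm_singletonBlocks hM hXM hX hMc
  have hsub1 : permFamily σ 𝓕 ⊆ stdB n k t := by
    rw [stdB, ← hσX, ← hσM]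
    exact permFamily_subset_familyB σ h𝓕
  have hsub2 : permFamily σ 𝓖 ⊆ stdA n l k t := by
    rw [stdA, ← hσX, ← hσM]
    exact permFamily_subset_familyA σ h𝓖
  refine pairIso_of_subset σ hsub1 hsub2 (h.2 _ _ (hL.stdB_stdA hk hk2)) ?_
  obtain ⟨hF, hG⟩ := h.card_pos hL hk hk2 hl (by omega)
  have c1 := Finset.card_le_card hsub1
  have c2 := Finset.card_le_card hsub2
  rw [card_permFamily] at c1 c2
  exact Nat.mul_pos (lt_of_lt_of_le (Finset.card_pos.2 hF) c1)
    (lt_of_lt_of_le (Finset.card_pos.2 hG) c2)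

end IsOptimal

/-! ### One family has `t` common blocks -/

theorem starOf_eq_self {n : ℕ} {𝓕 : PartFamily n} {H : Finset (Finset (Fin n))}
    (h : ∀ F ∈ 𝓕, H ⊆ F) : starOf 𝓕 H = 𝓕 := Finset.filter_true_of_mem h

theorem NonTrivialPair.not_isCover {n t : ℕ} {𝓕 𝓖 : PartFamily n} (h : NonTrivialPair t 𝓕 𝓖)
    {T : Finset (Finset (Fin n))} (hT : T.card = t) (h𝓕 : IsCover t 𝓕 T) : ¬ IsCover t 𝓖 T := by
  intro h𝓖
  rw [isCover_iff_subset hT] at h𝓕 h𝓖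
  have hsub : T ⊆ commonBlocks 𝓕 ∩ commonBlocks 𝓖 := fun B hB =>
    Finset.mem_inter.2 ⟨Finset.mem_filter.2 ⟨Finset.mem_univ _, fun F hF => h𝓕 F hF hB⟩,
      Finset.mem_filter.2 ⟨Finset.mem_univ _, fun G hG => h𝓖 G hG hB⟩⟩
  have := Finset.card_le_card hsub
  unfold NonTrivialPair at h
  omega

theorem card_le_card_starOf_add {n m : ℕ} {𝓕 : PartFamily n} {X : Finset (Finset (Fin n))}
    (S : Finset (Fin n) → Finset (Finset (Fin n))) (hm : ∀ x ∈ X, (starOf 𝓕 (S x)).card ≤ m)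
    (hS : ∀ F ∈ 𝓕, ¬ X ⊆ F → ∃ x ∈ X, S x ⊆ F) :
    𝓕.card ≤ (starOf 𝓕 X).card + X.card * m := by
  have hsub : 𝓕 ⊆ starOf 𝓕 X ∪ X.biUnion fun x => starOf 𝓕 (S x) := by
    intro F hF
    by_cases hXF : X ⊆ F
    · exact Finset.mem_union_left _ (mem_starOf.2 ⟨hF, hXF⟩)
    · obtain ⟨x, hx, hxF⟩ := hS F hF hXF
      exact Finset.mem_union_right _ (Finset.mem_biUnion.2 ⟨x, hx, mem_starOf.2 ⟨hF, hxF⟩⟩)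
  refine (Finset.card_le_card hsub).trans ((Finset.card_union_le _ _).trans ?_)
  exact Nat.add_le_add_left (Finset.card_biUnion_le_card_mul _ _ m hm) _

theorem exists_erase_subset {n t : ℕ} {X F : Finset (Finset (Fin n))} {B : Finset (Fin n)}
    (hX : X.card = t) (hXF : ¬ X ⊆ F) (hB : B ∉ X) (hBF : t ≤ (insert B X ∩ F).card) :
    B ∈ F ∧ ∃ x ∈ X, X.erase x ⊆ F := by
  obtain ⟨x, hx, hxF⟩ := Finset.not_subset.1 hXF
  have h1 : X ∩ F ⊆ X.erase x := fun C hC => by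
    rw [Finset.mem_inter] at hC
    exact Finset.mem_erase.2 ⟨fun h => hxF (h ▸ hC.2), hC.1⟩
  have h2 := Finset.card_le_card h1
  have hpos : 0 < X.card := Finset.card_pos.2 ⟨x, hx⟩
  rw [Finset.card_erase_of_mem hx, hX] at h2
  by_cases hBF' : B ∈ F
  · rw [Finset.insert_inter_of_mem hBF', Finset.card_insert_of_notMem
      fun h => hB (Finset.mem_inter.1 h).1] at hBF
    have h3 : X ∩ F = X.erase x := Finset.eq_of_subset_of_card_le h1 (by
      rw [Finset.card_erase_of_mem hx, hX]; omega)
    exact ⟨hBF', x, hx, h3 ▸ Finset.inter_subset_right⟩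
  · rw [Finset.insert_inter_of_notMem hBF'] at hBF
    omega

/-- A `k`-partition that contains all but one of `k` disjoint blocks is determined. -/
theorem eq_sdiff_union_of_subset {n k : ℕ} {M F : Finset (Finset (Fin n))}
    (hM : IsPartitionOf (M.sup id) M) (hMc : M.card = k) {B : Finset (Fin n)} (hB : B ∈ M)
    (hF : F ∈ kPartitions n k) (hMF : M \ {B} ⊆ F) : F = (M \ {B}) ∪ {B ∪ (M.sup id)ᶜ} := by
  have hpos : 0 < M.card := Finset.card_pos.2 ⟨B, hB⟩
  have hc : (M \ {B}).card = k - 1 := by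
    rw [Finset.card_sdiff_of_subset (Finset.singleton_subset_iff.2 hB), hMc, Finset.card_singleton]
  have hone : (starOf (kPartitions n k) (M \ {B})).card ≤ 1 := by
    rw [card_starOf_kPartitions (isPartitionOf_subset hM Finset.sdiff_subset) (by omega), hc,
      show k - (k - 1) = 1 by omega]
    generalize n - ((M \ {B}).biUnion id).card = m
    cases m with
    | zero => simp [Nat.stirlingSecond]
    | succ m => rw [Nat.stirlingSecond_one_right]
  exact Finset.card_le_one.1 hone _ (mem_starOf.2 ⟨hF, hMF⟩) _
    (mem_starOf.2 ⟨sdiff_union_mem_kPartitions hM hMc hB, Finset.subset_union_left⟩)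

namespace IsOptimal

variable {n k l t p : ℕ} {𝓕 𝓖 : PartFamily n}

/-- It is not optimal that each family has `t` common blocks of its own. -/
theorem not_isCover (h : IsOptimal k l t 𝓕 𝓖) (hL : IsLarge n t p) (hk : k ≤ t + p)
    (hk2 : t + 2 ≤ k) (hl : l ≤ t + p) (hl2 : t + 2 ≤ l) {X T : Finset (Finset (Fin n))}
    (hX : X.card = t) (hX𝓖 : IsCover t 𝓖 X) (hT : T.card = t) : ¬ IsCover t 𝓕 T := by
  intro hT𝓕
  obtain ⟨h𝓕, h𝓖, hc, hnt⟩ := h.1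
  have hT𝓖 := hnt.not_isCover hT hT𝓕
  have hX𝓕 : ¬ IsCover t 𝓕 X := fun hcov => hnt.not_isCover hX hcov hX𝓖
  have h1 := card_starOf_le_mul_starSize h𝓕 h𝓖 hc hT.ge (by omega) hT𝓖
  have h2 := card_starOf_le_mul_starSize h𝓖 h𝓕 hc.symm hX.ge (by omega) hX𝓕
  rw [starOf_eq_self ((isCover_iff_subset hT).1 hT𝓕), hT] at h1
  rw [starOf_eq_self ((isCover_iff_subset hX).1 hX𝓖), hX] at h2
  have h1' : (𝓕.card : ℝ) ≤ p * starSize n k (t + 1) := by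
    exact_mod_cast h1.trans (Nat.mul_le_mul_right _ (by omega))
  have h2' : (𝓖.card : ℝ) ≤ p * starSize n l (t + 1) := by
    exact_mod_cast h2.trans (Nat.mul_le_mul_right _ (by omega))
  have h3 := hL.ratio_le hk le_rfl hk2
  have h4 := hL.sq_mul_ratio_le
  have := h.lt_of_card_le hL hk hk2 hl hl2 (c := 1 / 2) ?_
  · norm_num at this
  set r := 2 / (((t : ℝ) + 1) * (p + 1)) ^ 2
  calc (𝓕.card : ℝ) * 𝓖.card
      ≤ (p * (r * starSize n k t)) * (p * starSize n l (t + 1)) := by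
        refine mul_le_mul (h1'.trans (by gcongr)) h2' (Nat.cast_nonneg _) (by positivity)
    _ = (p ^ 2 * r) * (starSize n k t * starSize n l (t + 1)) := by ring
    _ ≤ _ := by gcongr

/-- If the other family has no `t`-cover with at most `t + 1` blocks, the pair is not optimal. -/
theorem minimal_cover_card_le (h : IsOptimal k l t 𝓕 𝓖) (hL : IsLarge n t p) (hk : k ≤ t + p)
    (hk2 : t + 2 ≤ k) (hl : l ≤ t + p) (hl3 : t + 3 ≤ l) {X T : Finset (Finset (Fin n))}
    (hX : X.card = t) (hX𝓖 : IsCover t 𝓖 X) (hT𝓕 : IsCover t 𝓕 T) (hTl : T.card ≤ l)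
    (hTmin : ∀ T', T'.card < T.card → ¬ IsCover t 𝓕 T') : T.card ≤ t + 1 := by
  by_contra! hT
  obtain ⟨h𝓕, h𝓖, hc, hnt⟩ := h.1
  have h1 : 𝓕.card ≤ T.card.choose t * starSize n k t := by
    refine card_le_choose_mul hT𝓕 fun H _ hHc => ?_
    rw [← hHc]
    exact card_starOf_le h𝓕 (by omega)
  have h2 := card_starOf_le_pow_mul (s := min T.card (l - 1)) h𝓖 h𝓕 hc.symm
    (fun T' hT' => hTmin T' (lt_of_lt_of_le hT' (min_le_left _ _))) (by omega) hX.ge (by omega)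
  rw [starOf_eq_self ((isCover_iff_subset hX).1 hX𝓖), hX] at h2
  have h3 := hL.choose_mul_le_three_halves_mul hl hl3 hT hTl
  have h12 : 𝓕.card * 𝓖.card ≤ starSize n k t * (T.card.choose t *
      p ^ (min T.card (l - 1) - t) * starSize n l (min T.card (l - 1))) := by
    calc 𝓕.card * 𝓖.card ≤ (T.card.choose t * starSize n k t) *
          (p ^ (min T.card (l - 1) - t) * starSize n l (min T.card (l - 1))) :=
          Nat.mul_le_mul h1 (h2.trans (Nat.mul_le_mul_right _ (Nat.pow_le_pow_left (by omega) _)))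
      _ = _ := by ring
  have := h.lt_of_card_le hL hk hk2 hl (by omega) (c := 3 / 2) ?_
  · norm_num at this
  calc (𝓕.card : ℝ) * 𝓖.card ≤ starSize n k t * ((T.card.choose t *
        p ^ (min T.card (l - 1) - t) * starSize n l (min T.card (l - 1)) : ℕ) : ℝ) := by
        exact_mod_cast h12
    _ ≤ starSize n k t * (3 / 2 * starSize n l (t + 1)) := by gcongr
    _ = _ := by ring

/-- A `t`-cover of `𝓕` with `t + 1` blocks that lies in every member of `𝓖` leads to the pair
`(𝓓, 𝓒)`; a block with two points would halve `𝓖`. -/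
theorem pairIso_of_cover_subset (h : IsOptimal k l t 𝓕 𝓖) (hL : IsLarge n t p) (hk : k ≤ t + p)
    (hk2 : t + 2 ≤ k) (hl : l ≤ t + p) (hl3 : t + 3 ≤ l) {T : Finset (Finset (Fin n))}
    (hTc : T.card = t + 1) (hT𝓕 : IsCover t 𝓕 T) (hT𝓖 : ∀ G ∈ 𝓖, T ⊆ G) :
    PairIso 𝓕 𝓖 (stdD n k t) (stdC n l t) := by
  by_cases hT : ∀ B ∈ T, B.card = 1
  · exact h.pairIso_stdD hL hk hk2 hl (by omega) hT hTc hT𝓕 hT𝓖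
  exfalso
  push Not at hT
  obtain ⟨h𝓕, h𝓖, hc, hnt⟩ := h.1
  have hlt := hL.add_lt
  have h1 : 𝓕.card ≤ T.card.choose t * starSize n k t := by
    refine card_le_choose_mul hT𝓕 fun H _ hHc => ?_
    rw [← hHc]
    exact card_starOf_le h𝓕 (by omega)
  rw [hTc, Nat.choose_succ_self_right] at h1
  have h2 := two_mul_card_starOf_le h𝓖 (by omega) (by omega) hT
  rw [starOf_eq_self hT𝓖, hTc] at h2
  have h1' : (𝓕.card : ℝ) ≤ ((t : ℝ) + 1) * starSize n k t := by exact_mod_cast h1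
  have h2' : 2 * (𝓖.card : ℝ) ≤ starSize n l (t + 1) := by exact_mod_cast h2
  have h3 := h.stdD_le hL hk hk2 hl (by omega)
  have h4 := hL.ratio_le_one_div
  have p1 : (0 : ℝ) < starSize n k t := by exact_mod_cast hL.starSize_pos hk (s := t) (by omega)
  have p2 : (0 : ℝ) < starSize n l (t + 1) := by
    exact_mod_cast hL.starSize_pos hl (s := t + 1) (by omega)
  have h5 : (𝓕.card : ℝ) * (2 * 𝓖.card) ≤
      (((t : ℝ) + 1) * starSize n k t) * starSize n l (t + 1) :=
    mul_le_mul h1' h2' (by positivity) (by positivity)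
  have h6 : 0 < ((t : ℝ) + 1) * (starSize n k t * starSize n l (t + 1)) := by positivity
  nlinarith

/-- If `𝓖` has further common blocks but not all of a cover `T` of `𝓕`, then only one `t`-subset of
`T` supports a large star of `𝓕`, and the pair is not optimal. -/
theorem eq_of_isCover (h : IsOptimal k l t 𝓕 𝓖) (hL : IsLarge n t p) (hk : k ≤ t + p)
    (hk2 : t + 2 ≤ k) (hl : l ≤ t + p) (hl3 : t + 3 ≤ l) {X X' T : Finset (Finset (Fin n))}
    (hX : X.card = t) (hX𝓖 : IsCover t 𝓖 X) (hX' : X'.card = t) (hX'𝓖 : IsCover t 𝓖 X')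
    (hTc : T.card = t + 1) (hT𝓕 : IsCover t 𝓕 T) (hT𝓖 : ¬ ∀ G ∈ 𝓖, T ⊆ G) : X' = X := by
  by_contra hne
  obtain ⟨h𝓕, h𝓖, hc, hnt⟩ := h.1
  push Not at hT𝓖
  obtain ⟨G, hG, hTG⟩ := hT𝓖
  obtain ⟨C, hCT, hCG⟩ := Finset.not_subset.1 hTG
  have hXG := (isCover_iff_subset hX).1 hX𝓖
  have hXG' := (isCover_iff_subset hX').1 hX'𝓖
  have h2 : 𝓖.card ≤ starSize n l (t + 1) := by
    obtain ⟨B, hB, hBX⟩ := Finset.not_subset.1 fun hsub =>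
      hne (Finset.eq_of_subset_of_card_le hsub (by omega))
    have hc1 : (insert B X).card = t + 1 := by rw [Finset.card_insert_of_notMem hBX, hX]
    have := card_starOf_le h𝓖 (H := insert B X) (by omega)
    rwa [hc1, starOf_eq_self fun G hG => Finset.insert_subset (hXG' G hG hB) (hXG G hG)] at this
  have h1 : 𝓕.card ≤ starSize n k t + t * (p * starSize n k (t + 1)) := by
    have hmem : T.erase C ∈ T.powersetCard t := Finset.mem_powersetCard.2
      ⟨Finset.erase_subset _ _, by rw [Finset.card_erase_of_mem hCT]; omega⟩
    have hcard : ((T.powersetCard t).erase (T.erase C)).card = t := by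
      rw [Finset.card_erase_of_mem hmem, Finset.card_powersetCard, hTc,
        Nat.choose_succ_self_right, Nat.add_sub_cancel]
    have hsum : ∑ H ∈ (T.powersetCard t).erase (T.erase C), (starOf 𝓕 H).card ≤
        t * (p * starSize n k (t + 1)) := by
      rw [← hcard, ← smul_eq_mul, hcard]
      nth_rw 2 [← hcard]
      refine Finset.sum_le_card_nsmul _ _ _ fun H hH => ?_
      rw [Finset.mem_erase, Finset.mem_powersetCard] at hH
      have hCH : C ∈ H := by
        by_contra hCH
        refine hH.1 (Finset.eq_of_subset_of_card_le (Finset.subset_erase.2 ⟨hH.2.1, hCH⟩) ?_)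
        rw [Finset.card_erase_of_mem hCT]
        omega
      have := card_starOf_le_mul_starSize h𝓕 h𝓖 hc hH.2.2.ge (by omega)
        fun hcov => hCG ((isCover_iff_subset hH.2.2).1 hcov G hG hCH)
      rw [hH.2.2] at this
      exact this.trans (Nat.mul_le_mul_right _ (by omega))
    have hone : (starOf 𝓕 (T.erase C)).card ≤ starSize n k t := by
      have := card_starOf_le h𝓕 (H := T.erase C) (by
        rw [Finset.card_erase_of_mem hCT]; omega)
      rwa [Finset.card_erase_of_mem hCT, hTc, Nat.add_sub_cancel] at this
    have hall := card_le_sum_starOf hT𝓕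
    rw [← Finset.add_sum_erase _ _ hmem] at hall
    omega
  have h1' : (𝓕.card : ℝ) ≤ starSize n k t + t * (p * starSize n k (t + 1)) := by
    exact_mod_cast h1
  have h2' : (𝓖.card : ℝ) ≤ starSize n l (t + 1) := by exact_mod_cast h2
  have h3 := hL.ratio_le hk le_rfl hk2
  have h4 := hL.mul_mul_ratio_le
  have := h.lt_of_card_le hL hk hk2 hl (by omega) (c := 10 / 9) ?_
  · norm_num at this
  set r := 2 / (((t : ℝ) + 1) * (p + 1)) ^ 2
  calc (𝓕.card : ℝ) * 𝓖.card
      ≤ (starSize n k t + t * (p * (r * starSize n k t))) * starSize n l (t + 1) := by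
        refine mul_le_mul (h1'.trans (by gcongr)) h2' (Nat.cast_nonneg _) (by positivity)
    _ = (1 + t * p * r) * (starSize n k t * starSize n l (t + 1)) := by ring
    _ ≤ _ := mul_le_mul_of_nonneg_right (by linarith) (by positivity)

/-- A smallest cover of `𝓕` contains the common blocks of `𝓖`, as otherwise none of its `t`-subsets
supports a large star of `𝓕`. -/
theorem subset_of_isCover (h : IsOptimal k l t 𝓕 𝓖) (hL : IsLarge n t p) (hk : k ≤ t + p)
    (hk2 : t + 2 ≤ k) (hl : l ≤ t + p) (hl2 : t + 2 ≤ l) {X T : Finset (Finset (Fin n))}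
    (hX : X.card = t) (hX𝓖 : IsCover t 𝓖 X)
    (huniq : ∀ X', X'.card = t → IsCover t 𝓖 X' → X' = X)
    (hTc : T.card = t + 1) (hT𝓕 : IsCover t 𝓕 T) : X ⊆ T := by
  by_contra hXT
  obtain ⟨h𝓕, h𝓖, hc, hnt⟩ := h.1
  have h1 : 𝓕.card ≤ (t + 1) * (p * starSize n k (t + 1)) := by
    have := card_le_choose_mul (m := p * starSize n k (t + 1)) hT𝓕 fun H hH hHc => ?_
    · rwa [hTc, Nat.choose_succ_self_right] at this
    · have := card_starOf_le_mul_starSize h𝓕 h𝓖 hc hHc.ge (by omega)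
        fun hcov => hXT (huniq H hHc hcov ▸ hH)
      rw [hHc] at this
      exact this.trans (Nat.mul_le_mul_right _ (by omega))
  have h2 := card_starOf_le_mul_starSize h𝓖 h𝓕 hc.symm hX.ge (by omega)
    fun hcov => hnt.not_isCover hX hcov hX𝓖
  rw [starOf_eq_self ((isCover_iff_subset hX).1 hX𝓖), hX] at h2
  have h1' : (𝓕.card : ℝ) ≤ ((t : ℝ) + 1) * (p * starSize n k (t + 1)) := by exact_mod_cast h1
  have h2' : (𝓖.card : ℝ) ≤ p * starSize n l (t + 1) := by
    exact_mod_cast h2.trans (Nat.mul_le_mul_right _ (by omega))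
  have h3 := hL.ratio_le hk le_rfl hk2
  have h4 := hL.mul_sq_mul_ratio_le
  have := h.lt_of_card_le hL hk hk2 hl hl2 (c := 1) ?_
  · norm_num at this
  set r := 2 / (((t : ℝ) + 1) * (p + 1)) ^ 2
  calc (𝓕.card : ℝ) * 𝓖.card
      ≤ (((t : ℝ) + 1) * (p * (r * starSize n k t))) * (p * starSize n l (t + 1)) := by
        refine mul_le_mul (h1'.trans (by gcongr)) h2' (Nat.cast_nonneg _) (by positivity)
    _ = (((t : ℝ) + 1) * p ^ 2 * r) * (starSize n k t * starSize n l (t + 1)) := by ring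
    _ ≤ _ := by gcongr

/-- Let `X` be the common blocks of `𝓖`, and let `Y` be blocks of which every member of `𝓖` contains
one. If only one block of `Y` extends `X` to a cover of `𝓕`, then `𝓖` is hardly larger than one
star. -/
theorem two_le_card_filter (h : IsOptimal k l t 𝓕 𝓖) (hL : IsLarge n t p) (hk : k ≤ t + p)
    (hk2 : t + 2 ≤ k) (hl : l ≤ t + p) (hl3 : t + 3 ≤ l) {X Y : Finset (Finset (Fin n))}
    (hX : X.card = t) (hX𝓖 : IsCover t 𝓖 X)
    (huniq : ∀ X', X'.card = t → IsCover t 𝓖 X' → X' = X) {B₀ : Finset (Fin n)} (hB₀ : B₀ ∉ X)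
    (hB₀𝓕 : IsCover t 𝓕 (insert B₀ X)) (hYX : Disjoint Y X) (hYc : Y.card ≤ k - t)
    (hY : ∀ G ∈ 𝓖, ∃ B ∈ Y, B ∈ G) {M : Finset (Finset (Fin n))} (hMY : M ⊆ Y)
    (hM : ∀ B ∈ Y, IsCover t 𝓕 (insert B X) → B ∈ M) : 2 ≤ M.card := by
  by_contra! hM1
  obtain ⟨h𝓕, h𝓖, hc, hnt⟩ := h.1
  have hXG := (isCover_iff_subset hX).1 hX𝓖
  have h1 : 𝓕.card ≤ starSize n k t + t * (p * starSize n k (t + 1)) := by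
    have hmain := card_le_card_starOf_add (𝓕 := 𝓕) (X := X) (m := p * starSize n k (t + 1))
      (fun x => insert B₀ (X.erase x)) ?_ ?_
    · have := card_starOf_le h𝓕 (H := X) (by omega)
      rw [hX] at hmain this
      omega
    · intro x hx
      have hnot : B₀ ∉ X.erase x := fun hmem => hB₀ (Finset.mem_of_mem_erase hmem)
      have hcard : (insert B₀ (X.erase x)).card = t := by
        rw [Finset.card_insert_of_notMem hnot, Finset.card_erase_of_mem hx, hX]
        have := Finset.card_pos.2 ⟨x, hx⟩
        omega
      have := card_starOf_le_mul_starSize h𝓕 h𝓖 hc hcard.ge (by omega)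
        fun hcov => hB₀ (huniq _ hcard hcov ▸ Finset.mem_insert_self _ _)
      rw [hcard] at this
      exact this.trans (Nat.mul_le_mul_right _ (by omega))
    · intro F hF hXF
      obtain ⟨hB, x, hx, hxF⟩ := exists_erase_subset hX hXF hB₀ (hB₀𝓕 F hF)
      exact ⟨x, hx, Finset.insert_subset hB hxF⟩
  have h2 : 𝓖.card ≤ starSize n l (t + 1) + p * (p * starSize n l (t + 2)) := by
    have hsum := card_starOf_le_sum (𝓕 := 𝓖) (H := X) (Y := Y) fun G hG _ => hY G hG
    rw [starOf_eq_self hXG, ← Finset.sum_sdiff hMY] at hsum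
    have hcard : ∀ B ∈ Y, (insert B X).card = t + 1 := fun B hB => by
      rw [Finset.card_insert_of_notMem (Finset.disjoint_left.1 hYX hB), hX]
    have e1 : ∑ B ∈ M, (starOf 𝓖 (insert B X)).card ≤ 1 * starSize n l (t + 1) := by
      refine (Finset.sum_le_card_nsmul M _ (starSize n l (t + 1)) fun B hB => ?_).trans ?_
      · have := card_starOf_le h𝓖 (H := insert B X) (by rw [hcard B (hMY hB)]; omega)
        rwa [hcard B (hMY hB)] at this
      · rw [smul_eq_mul]
        exact Nat.mul_le_mul_right _ (by omega)
    have e2 : ∑ B ∈ Y \ M, (starOf 𝓖 (insert B X)).card ≤ p * (p * starSize n l (t + 2)) := by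
      refine (Finset.sum_le_card_nsmul _ _ (p * starSize n l (t + 2)) fun B hB => ?_).trans ?_
      · rw [Finset.mem_sdiff] at hB
        have := card_starOf_le_mul_starSize h𝓖 h𝓕 hc.symm (H := insert B X)
          (by rw [hcard B hB.1]; omega) (by rw [hcard B hB.1]; omega)
          fun hcov => hB.2 (hM B hB.1 hcov)
        rw [hcard B hB.1] at this
        exact this.trans (Nat.mul_le_mul_right _ (by omega))
      · rw [smul_eq_mul]
        refine Nat.mul_le_mul_right _ ((Finset.card_le_card Finset.sdiff_subset).trans (by omega))
    omega
  have h1' : (𝓕.card : ℝ) ≤ starSize n k t + t * (p * starSize n k (t + 1)) := by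
    exact_mod_cast h1
  have h2' : (𝓖.card : ℝ) ≤ starSize n l (t + 1) + p * (p * starSize n l (t + 2)) := by
    exact_mod_cast h2
  have h3 := hL.ratio_le hk le_rfl hk2
  have h3' := hL.ratio_le hl (by omega : t ≤ t + 1) (by omega)
  have h4 := hL.mul_mul_ratio_le
  have h5 := hL.sq_mul_ratio_le
  have := h.lt_of_card_le hL hk hk2 hl (by omega) (c := 10 / 9 * (3 / 2)) ?_
  · norm_num at this
  set r := 2 / (((t : ℝ) + 1) * (p + 1)) ^ 2
  calc (𝓕.card : ℝ) * 𝓖.card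
      ≤ (starSize n k t + t * (p * (r * starSize n k t))) *
          (starSize n l (t + 1) + p * (p * (r * starSize n l (t + 1)))) := by
        refine mul_le_mul (h1'.trans ?_) (h2'.trans ?_) (Nat.cast_nonneg _) (by positivity)
        · gcongr
        · gcongr
    _ = ((1 + t * p * r) * (1 + p ^ 2 * r)) * (starSize n k t * starSize n l (t + 1)) := by ring
    _ ≤ _ := by
        refine mul_le_mul_of_nonneg_right ?_ (by positivity)
        exact mul_le_mul (by linarith) (by linarith) (by positivity) (by norm_num)

/-- In the situation of `two_le_card_filter`, all `k - t` blocks of `Y` are one-point blocks that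
extend `X` to a cover of `𝓕`, since otherwise `𝓖` loses half a star against `𝓐`. -/
theorem forall_singleton (h : IsOptimal k l t 𝓕 𝓖) (hL : IsLarge n t p) (hk : k ≤ t + p)
    (hk2 : t + 2 ≤ k) (hl : l ≤ t + p) (hl3 : t + 3 ≤ l) {X Y : Finset (Finset (Fin n))}
    (hX : X.card = t) (hX𝓖 : IsCover t 𝓖 X) (hYX : Disjoint Y X) (hYc : Y.card ≤ k - t)
    (hY : ∀ G ∈ 𝓖, ∃ B ∈ Y, B ∈ G) {B₁ B₂ : Finset (Fin n)} (hB₁ : B₁ ∈ Y) (hB₂ : B₂ ∈ Y)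
    (hne : B₁ ≠ B₂) (hc₁ : IsCover t 𝓕 (insert B₁ X)) (hc₂ : IsCover t 𝓕 (insert B₂ X)) :
    Y.card = k - t ∧
      ∀ B ∈ Y, IsCover t 𝓕 (insert B X) ∧ ∀ C ∈ insert B X, C.card = 1 := by
  by_contra hbad
  obtain ⟨h𝓕, h𝓖, hc, hnt⟩ := h.1
  have hlt := hL.add_lt
  have hXG := (isCover_iff_subset hX).1 hX𝓖
  have hB₁X := Finset.disjoint_left.1 hYX hB₁
  have hB₂X := Finset.disjoint_left.1 hYX hB₂
  have h1 : 𝓕.card ≤ starSize n k t + t * starSize n k (t + 1) := by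
    have hmain := card_le_card_starOf_add (𝓕 := 𝓕) (X := X) (m := starSize n k (t + 1))
      (fun x => insert B₁ (insert B₂ (X.erase x))) ?_ ?_
    · have := card_starOf_le h𝓕 (H := X) (by omega)
      rw [hX] at hmain this
      omega
    · intro x hx
      have hn2 : B₂ ∉ X.erase x := fun hmem => hB₂X (Finset.mem_of_mem_erase hmem)
      have hn1 : B₁ ∉ insert B₂ (X.erase x) := by
        rw [Finset.mem_insert]
        rintro (he | hmem)
        · exact hne he
        · exact hB₁X (Finset.mem_of_mem_erase hmem)
      have hcard : (insert B₁ (insert B₂ (X.erase x))).card = t + 1 := by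
        rw [Finset.card_insert_of_notMem hn1, Finset.card_insert_of_notMem hn2,
          Finset.card_erase_of_mem hx, hX]
        have := Finset.card_pos.2 ⟨x, hx⟩
        omega
      rw [← hcard]
      exact card_starOf_le h𝓕 (by omega)
    · intro F hF hXF
      obtain ⟨hB, -⟩ := exists_erase_subset hX hXF hB₁X (hc₁ F hF)
      obtain ⟨hB', x, hx, hxF⟩ := exists_erase_subset hX hXF hB₂X (hc₂ F hF)
      exact ⟨x, hx, Finset.insert_subset hB (Finset.insert_subset hB' hxF)⟩
  have hcard : ∀ B ∈ Y, (insert B X).card = t + 1 := fun B hB => by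
    rw [Finset.card_insert_of_notMem (Finset.disjoint_left.1 hYX hB), hX]
  have hone : ∀ B ∈ Y, (starOf 𝓖 (insert B X)).card ≤ starSize n l (t + 1) := fun B hB => by
    have := card_starOf_le h𝓖 (H := insert B X) (by rw [hcard B hB]; omega)
    rwa [hcard B hB] at this
  have hsum := card_starOf_le_sum (𝓕 := 𝓖) (H := X) (Y := Y) fun G hG _ => hY G hG
  rw [starOf_eq_self hXG] at hsum
  have h2 : 2 * 𝓖.card + starSize n l (t + 1) ≤ 2 * ((k - t) * starSize n l (t + 1)) := by
    by_cases hYk : Y.card = k - t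
    · have hex : ∃ B ∈ Y, ¬ (IsCover t 𝓕 (insert B X) ∧ ∀ C ∈ insert B X, C.card = 1) := by
        by_contra! hcon
        exact hbad ⟨hYk, fun B hB => hcon B hB⟩
      obtain ⟨B, hB, hBbad⟩ := hex
      have hhalf : 2 * (starOf 𝓖 (insert B X)).card ≤ starSize n l (t + 1) := by
        by_cases hcov : IsCover t 𝓕 (insert B X)
        · have hns : ∃ C ∈ insert B X, C.card ≠ 1 := by
            by_contra! hcon
            exact hBbad ⟨hcov, hcon⟩
          have := two_mul_card_starOf_le h𝓖 (H := insert B X) (by rw [hcard B hB]; omega)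
            (by rw [hcard B hB]; omega) hns
          rwa [hcard B hB] at this
        · have h3 := card_starOf_le_mul_starSize h𝓖 h𝓕 hc.symm (H := insert B X)
            (by rw [hcard B hB]; omega) (by rw [hcard B hB]; omega) hcov
          rw [hcard B hB] at h3
          have h4 := hL.sq_mul_starSize_le hl (by omega : t ≤ t + 1) (by omega)
          have h5 : 4 * (k - t) ≤ ((t + 1) * (p + 1)) ^ 2 := by
            have h6 := hL.one_le
            have h7 : k - t ≤ p := by omega
            have h8 : 2 * (p + 1) ≤ (t + 1) * (p + 1) := Nat.mul_le_mul_right _ (by omega)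
            nlinarith [Nat.pow_le_pow_left h8 2]
          have h9 := (Nat.mul_le_mul_right (starSize n l (t + 1 + 1)) h5).trans h4
          rw [mul_assoc] at h9
          omega
      rw [← Finset.add_sum_erase _ _ hB] at hsum
      have hrest : ∑ C ∈ Y.erase B, (starOf 𝓖 (insert C X)).card ≤
          (k - t - 1) * starSize n l (t + 1) := by
        rw [← hYk, ← Finset.card_erase_of_mem hB, ← smul_eq_mul]
        exact Finset.sum_le_card_nsmul _ _ _ fun C hC => hone C (Finset.mem_of_mem_erase hC)
      have hsplit : (k - t) * starSize n l (t + 1) =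
          (k - t - 1) * starSize n l (t + 1) + starSize n l (t + 1) := by
        rw [← Nat.succ_mul]; congr 1; omega
      omega
    · have hall := hsum.trans (Finset.sum_le_card_nsmul Y _ _ hone)
      rw [smul_eq_mul] at hall
      have hall' := hall.trans (Nat.mul_le_mul_right _ (by omega : Y.card ≤ k - t - 1))
      have hsplit : (k - t) * starSize n l (t + 1) =
          (k - t - 1) * starSize n l (t + 1) + starSize n l (t + 1) := by
        rw [← Nat.succ_mul]; congr 1; omega
      omega
  have hlow := h.stdB_le hL hk hk2 hl hl3
  obtain ⟨w, rfl⟩ : ∃ w, k = t + w := Nat.exists_eq_add_of_le (by omega)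
  rw [Nat.add_sub_cancel_left] at h2
  have h1' : (𝓕.card : ℝ) ≤ starSize n (t + w) t + t * starSize n (t + w) (t + 1) := by
    exact_mod_cast h1
  have h2' : 2 * (𝓖.card : ℝ) + starSize n l (t + 1) ≤ 2 * (w * starSize n l (t + 1)) := by
    exact_mod_cast h2
  have h3 := hL.ratio_le hk le_rfl hk2
  have p1 : (0 : ℝ) < starSize n (t + w) t := by
    exact_mod_cast hL.starSize_pos hk (s := t) (by omega)
  have p2 : (0 : ℝ) < starSize n l (t + 1) := by
    exact_mod_cast hL.starSize_pos hl (s := t + 1) (by omega)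
  have ht1 := hL.one_le_cast
  have hp2 := hL.two_le_cast
  have hw2 : (2 : ℝ) ≤ w := by exact_mod_cast (by omega : 2 ≤ w)
  have hwp : (w : ℝ) ≤ p := by exact_mod_cast (by omega : w ≤ p)
  push_cast at hlow
  rw [add_sub_cancel_left] at hlow
  have hQ : (0 : ℝ) < (((t : ℝ) + 1) * (p + 1)) ^ 2 := by positivity
  have hsmall : 2 / (((t : ℝ) + 1) * (p + 1)) ^ 2 * (w * (w - 1) + t * (w - 1 / 2)) < 1 / 2 := by
    rw [div_mul_eq_mul_div, div_lt_div_iff₀ hQ (by norm_num), mul_pow]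
    have a1 : (w : ℝ) * (w - 1) + t * (w - 1 / 2) < t * (p + 1) ^ 2 := by
      have b1 : (w : ℝ) * (w - 1) ≤ t * (w * (w - 1)) :=
        le_mul_of_one_le_left (mul_nonneg (by linarith) (by linarith)) ht1
      have b2 : (t : ℝ) * (w ^ 2 - 1 / 2) < t * (p + 1) ^ 2 :=
        mul_lt_mul_of_pos_left (by nlinarith) (by linarith)
      linarith
    have a2 : 4 * (t : ℝ) ≤ (t + 1) ^ 2 := by nlinarith [sq_nonneg ((t : ℝ) - 1)]
    nlinarith [mul_le_mul_of_nonneg_right a2 (sq_nonneg ((p : ℝ) + 1))]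
  set r := 2 / (((t : ℝ) + 1) * (p + 1)) ^ 2
  have hup : (𝓕.card : ℝ) * 𝓖.card ≤
      ((1 + t * r) * (w - 1 / 2)) * (starSize n (t + w) t * starSize n l (t + 1)) := by
    calc (𝓕.card : ℝ) * 𝓖.card
        ≤ (starSize n (t + w) t + t * (r * starSize n (t + w) t)) *
            ((w - 1 / 2) * starSize n l (t + 1)) := by
          refine mul_le_mul (h1'.trans (by gcongr)) (by linarith) (Nat.cast_nonneg _)
            (by positivity)
      _ = _ := by ring
  have := le_of_mul_le_mul_right (hlow.trans hup) (mul_pos p1 p2)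
  nlinarith

/-- An optimal pair in which `𝓖` has `t` common blocks is one of two standard pairs. -/
theorem pairIso_of_isCover (h : IsOptimal k l t 𝓕 𝓖) (hL : IsLarge n t p) (hk : k ≤ t + p)
    (hk2 : t + 2 ≤ k) (hl : l ≤ t + p) (hl3 : t + 3 ≤ l) {X : Finset (Finset (Fin n))}
    (hX : X.card = t) (hX𝓖 : IsCover t 𝓖 X) :
    PairIso 𝓕 𝓖 (stdB n k t) (stdA n l k t) ∨ PairIso 𝓕 𝓖 (stdD n k t) (stdC n l t) := by
  classical
  obtain ⟨h𝓕, h𝓖, hc, hnt⟩ := h.1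
  obtain ⟨h𝓕0, h𝓖0⟩ := h.card_pos hL hk hk2 hl (by omega)
  have hXG := (isCover_iff_subset hX).1 hX𝓖
  obtain ⟨T, hT𝓕, hTl, hTmin⟩ := exists_minimal_cover h𝓖 hc h𝓖0
  have hTle := h.minimal_cover_card_le hL hk hk2 hl hl3 hX hX𝓖 hT𝓕 hTl hTmin
  have hTge := hT𝓕.le_card h𝓕0
  have hTt : T.card ≠ t := fun hTt =>
    h.not_isCover hL hk hk2 hl (by omega) hX hX𝓖 hTt hT𝓕
  have hTc : T.card = t + 1 := by omega
  by_cases hT𝓖 : ∀ G ∈ 𝓖, T ⊆ G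
  · exact Or.inr (h.pairIso_of_cover_subset hL hk hk2 hl hl3 hTc hT𝓕 hT𝓖)
  left
  have huniq : ∀ X', X'.card = t → IsCover t 𝓖 X' → X' = X := fun X' hX' hX'𝓖 =>
    h.eq_of_isCover hL hk hk2 hl hl3 hX hX𝓖 hX' hX'𝓖 hTc hT𝓕 hT𝓖
  have hXT := h.subset_of_isCover hL hk hk2 hl (by omega) hX hX𝓖 huniq hTc hT𝓕
  obtain ⟨B₀, hB₀X, rfl⟩ : ∃ B₀, B₀ ∉ X ∧ insert B₀ X = T := by
    obtain ⟨B₀, hB₀⟩ := Finset.card_eq_one.1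
      (show (T \ X).card = 1 by rw [Finset.card_sdiff_of_subset hXT]; omega)
    refine ⟨B₀, (Finset.mem_sdiff.1 (hB₀ ▸ Finset.mem_singleton_self B₀)).2, ?_⟩
    rw [Finset.insert_eq, ← hB₀, Finset.sdiff_union_of_subset hXT]
  have hX𝓕 : ¬ IsCover t 𝓕 X := fun hcov => hnt.not_isCover hX hcov hX𝓖
  obtain ⟨F₀, hF₀, hF₀X⟩ : ∃ F₀ ∈ 𝓕, (X ∩ F₀).card < t := by
    unfold IsCover at hX𝓕
    push Not at hX𝓕
    exact hX𝓕
  obtain ⟨Y, hYF, hYc, hYmeet⟩ := exists_transversal (h𝓕 hF₀) hX.ge hF₀X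
  have hY : ∀ G ∈ 𝓖, ∃ B ∈ Y, B ∈ G := fun G hG =>
    hYmeet l G (h𝓖 hG) (hXG G hG) (hc.symm G hG F₀ hF₀)
  have hYX : Disjoint Y X := Finset.disjoint_left.2 fun B hB => (Finset.mem_sdiff.1 (hYF hB)).2
  obtain ⟨B₁, hB₁, B₂, hB₂, hne⟩ := Finset.one_lt_card.1
    (h.two_le_card_filter hL hk hk2 hl hl3 hX hX𝓖 huniq hB₀X hT𝓕 hYX hYc hY
      (Finset.filter_subset (fun B => IsCover t 𝓕 (insert B X)) Y)
      fun B hB hcov => Finset.mem_filter.2 ⟨hB, hcov⟩)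
  rw [Finset.mem_filter] at hB₁ hB₂
  obtain ⟨hYk, hgood⟩ := h.forall_singleton hL hk hk2 hl hl3 hX hX𝓖 hYX hYc hY hB₁.1 hB₂.1 hne
    hB₁.2 hB₂.2
  have hsing : ∀ B ∈ X ∪ Y, B.card = 1 := by
    intro B hB
    rcases Finset.mem_union.1 hB with hB | hB
    · exact (hgood B₁ hB₁.1).2 B (Finset.mem_insert_of_mem hB)
    · exact (hgood B hB).2 B (Finset.mem_insert_self _ _)
  have hMc : (X ∪ Y).card = k := by
    rw [Finset.card_union_of_disjoint hYX.symm, hX, hYk]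
    omega
  refine h.pairIso_stdB hL hk hk2 hl hl3 hsing Finset.subset_union_left hX hMc ?_ ?_
  · intro F hF
    by_cases hXF : X ⊆ F
    · exact Finset.mem_union_left _ (Finset.mem_filter.2 ⟨h𝓕 hF, hXF⟩)
    · obtain ⟨-, x, hx, hxF⟩ := exists_erase_subset hX hXF hB₀X (hT𝓕 F hF)
      refine Finset.mem_union_right _ (Finset.mem_image.2 ⟨x, hx, ?_⟩)
      symm
      refine eq_sdiff_union_of_subset ?_ hMc (Finset.mem_union_left _ hx) (h𝓕 hF) ?_
      · rw [Finset.sup_eq_biUnion]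
        exact isPartitionOf_singletons hsing
      · intro B hB
        rw [Finset.mem_sdiff, Finset.mem_union, Finset.mem_singleton] at hB
        rcases hB.1 with hBX | hBY
        · exact hxF (Finset.mem_erase.2 ⟨hB.2, hBX⟩)
        · exact (exists_erase_subset hX hXF (Finset.disjoint_left.1 hYX hBY)
            ((hgood B hBY).1 F hF)).1
  · intro G hG
    obtain ⟨B, hB, hBG⟩ := hY G hG
    refine Finset.mem_filter.2 ⟨h𝓖 hG, hXG G hG, B, Finset.mem_inter.2 ⟨hBG, ?_⟩⟩
    exact Finset.mem_sdiff.2 ⟨Finset.mem_union_right _ hB, Finset.disjoint_left.1 hYX hB⟩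

end IsOptimal

/-! ### Partitions into `t + 2` blocks -/

theorem IsLarge.pow_four_le_starSize {n t p : ℕ} (hL : IsLarge n t p) :
    81 * (t + 1) ^ 4 ≤ starSize n (t + 2) t := by
  have hp := hL.two_le
  have h6 := hL.six_le
  have h1 := hL.pow_le_starSize_sub_two (k := t + 2) (by omega) (by omega)
  rw [Nat.add_sub_cancel] at h1
  refine le_trans ?_ h1
  calc 81 * (t + 1) ^ 4 = ((t + 1) * (2 + 1)) ^ 4 := by ring
    _ ≤ ((t + 1) * (p + 1)) ^ 4 := Nat.pow_le_pow_left (Nat.mul_le_mul_left _ (by omega)) _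
    _ ≤ _ := Nat.pow_le_pow_right (by omega) (by omega)

/-- Let `G` be a partition into `t + 2` blocks all of which but possibly `D` are singletons. A
partition into `t + 2` blocks that shares `t` blocks with `G` shares `t` blocks with
`G \ {D}`. -/
theorem isCover_erase_of_singletons {n t : ℕ} {𝓕 : PartFamily n}
    (h𝓕 : 𝓕 ⊆ kPartitions n (t + 2)) {G : Finset (Finset (Fin n))}
    (hG : G ∈ kPartitions n (t + 2)) (hc : IsCover t 𝓕 G) {D : Finset (Fin n)}
    (hsing : ∀ B ∈ G.erase D, B.card = 1) : IsCover t 𝓕 (G.erase D) := by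
  intro F hF
  by_contra! hlt
  have hFG := hc F hF
  have herase : (G.erase D) ∩ F = (G ∩ F).erase D := Finset.erase_inter D G F
  rw [herase] at hlt
  have hDF : D ∈ G ∩ F := by
    by_contra hcon
    rw [Finset.erase_eq_of_notMem hcon] at hlt
    omega
  rw [Finset.card_erase_of_mem hDF] at hlt
  have hHc : (G ∩ F).card = t := by
    have := Finset.card_pos.2 ⟨D, hDF⟩
    omega
  have hGp := mem_kPartitions.1 hG
  have hHp := isPartitionOf_subset hGp.2 (Finset.inter_subset_left : G ∩ F ⊆ G)
  -- the two blocks of `G` outside `F` are singletons, so only one partition contains `G ∩ F`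
  have hU : n = ((G ∩ F).biUnion id).card + 2 := by
    have h1 := hGp.2.card_eq_sum
    rw [Finset.card_univ, Fintype.card_fin,
      ← Finset.sum_sdiff (Finset.inter_subset_left : G ∩ F ⊆ G), ← hHp.card_eq_sum] at h1
    have h2 : ∑ B ∈ G \ (G ∩ F), B.card = (G \ (G ∩ F)).card := by
      rw [Finset.card_eq_sum_ones]
      refine Finset.sum_congr rfl fun B hB => hsing B ?_
      rw [Finset.mem_sdiff] at hB
      exact Finset.mem_erase.2 ⟨fun hBD => hB.2 (hBD ▸ hDF), hB.1⟩
    rw [Finset.card_sdiff_of_subset Finset.inter_subset_left, hGp.1, hHc] at h2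
    omega
  have hone := card_starOf_kPartitions (k := t + 2) hHp (by omega)
  rw [hHc, show n - ((G ∩ F).biUnion id).card = 2 by omega, Nat.add_sub_cancel_left,
    Nat.stirlingSecond_self] at hone
  have hFeq : F = G := Finset.card_le_one.1 hone.le _
    (mem_starOf.2 ⟨h𝓕 hF, Finset.inter_subset_right⟩) _
    (mem_starOf.2 ⟨hG, Finset.inter_subset_left⟩)
  rw [hFeq, Finset.inter_self, hGp.1] at hHc
  omega

/-- If `t` blocks of a partition `G` into `t + 2` blocks include a largest one, then they cover at
least a third of the points that are not forced, and few partitions contain them. -/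
theorem two_mul_card_starOf_le_of_max {n t p : ℕ} (hL : IsLarge n t p)
    {G H : Finset (Finset (Fin n))} (hG : G ∈ kPartitions n (t + 2)) {D : Finset (Fin n)}
    (hmax : ∀ B ∈ G, B.card ≤ D.card) (hHG : H ⊆ G) (hDH : D ∈ H) (hHc : H.card = t) :
    2 * (t + 1) * (starOf (kPartitions n (t + 2)) H).card ≤ starSize n (t + 2) t := by
  have hlt := hL.add_lt
  have hp := hL.two_le
  have ht := hL.one_le
  have hGp := mem_kPartitions.1 hG
  have hHp := isPartitionOf_subset hGp.2 hHG
  rw [card_starOf_kPartitions hHp (by omega), hHc, Nat.add_sub_cancel_left]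
  set u := (H.biUnion id).card with hu
  have hsum : ∑ B ∈ G \ H, B.card + u = n := by
    rw [hu, hHp.card_eq_sum, Finset.sum_sdiff hHG, ← hGp.2.card_eq_sum, Finset.card_univ,
      Fintype.card_fin]
  have hGH : (G \ H).card = 2 := by
    rw [Finset.card_sdiff_of_subset hHG, hGp.1, hHc, Nat.add_sub_cancel_left]
  have hup : ∑ B ∈ G \ H, B.card ≤ 2 * D.card := by
    rw [← hGH, ← smul_eq_mul]
    exact Finset.sum_le_card_nsmul _ _ _ fun B hB => hmax B (Finset.mem_sdiff.1 hB).1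
  have hlow : 2 ≤ ∑ B ∈ G \ H, B.card := by
    rw [← hGH, Finset.card_eq_sum_ones]
    exact Finset.sum_le_sum fun B hB => Finset.card_pos.2 (hGp.2.1 B (Finset.mem_sdiff.1 hB).1)
  have hD : D.card + (t - 1) ≤ u := by
    rw [hu, hHp.card_eq_sum, ← Finset.add_sum_erase _ _ hDH]
    refine Nat.add_le_add_left ?_ _
    rw [← hHc, ← Finset.card_erase_of_mem hDH, Finset.card_eq_sum_ones]
    exact Finset.sum_le_sum fun B hB => Finset.card_pos.2 (hHp.1 B (Finset.mem_of_mem_erase hB))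
  obtain ⟨e, he⟩ : ∃ e, n - u = e + 1 := Nat.exists_eq_add_of_le' (by omega)
  have hs := stirlingSecond_two e
  have hN := hL.starSize_sub_two (k := t + 2) (by omega) (by omega)
  have hN4 := hL.pow_four_le_starSize
  rw [Nat.add_sub_cancel, show n - (t + 2) + 1 = n - t - 1 by omega] at hN
  rw [he]
  set S := Nat.stirlingSecond (e + 1) 2
  set N := starSize n (t + 2) t
  -- `3 (e + 1) ≤ 2 (n - t + 1)`, so `S ^ 3` is at most of the order of `N ^ 2`
  have hcube : S ^ 3 ≤ 2 * (N + 1) ^ 2 := by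
    calc S ^ 3 ≤ (2 ^ e) ^ 3 := Nat.pow_le_pow_left (by omega) 3
      _ = 2 ^ (3 * e) := by rw [← pow_mul, mul_comm]
      _ ≤ 2 ^ (2 * (n - t - 1) + 1) := Nat.pow_le_pow_right (by norm_num) (by omega)
      _ = 2 * (N + 1) ^ 2 := by rw [hN, ← pow_mul, pow_succ]; ring
  by_contra! hcon
  have hNpos : 1 ≤ N := le_trans (Nat.mul_pos (by norm_num) (pow_pos (by omega) 4)) hN4
  have h1 : N ^ 3 < (2 * (t + 1) * S) ^ 3 := Nat.pow_lt_pow_left hcon (by norm_num)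
  have h2 : (2 * (t + 1) * S) ^ 3 ≤ 64 * (t + 1) ^ 3 * N ^ 2 := by
    calc (2 * (t + 1) * S) ^ 3 = 8 * (t + 1) ^ 3 * S ^ 3 := by ring
      _ ≤ 8 * (t + 1) ^ 3 * (2 * (N + N) ^ 2) :=
          Nat.mul_le_mul_left _ (hcube.trans
            (Nat.mul_le_mul_left _ (Nat.pow_le_pow_left (by omega) 2)))
      _ = _ := by ring
  have h3 : 64 * (t + 1) ^ 3 ≤ N := by
    refine le_trans ?_ hN4
    refine Nat.mul_le_mul (by norm_num) (Nat.pow_le_pow_right (by omega) (by omega))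
  have h4 : 64 * (t + 1) ^ 3 * N ^ 2 ≤ N * N ^ 2 := Nat.mul_le_mul_right _ h3
  have h5 : N * N ^ 2 = N ^ 3 := by ring
  omega

namespace IsOptimal

variable {n k t p : ℕ} {𝓕 𝓖 : PartFamily n}

/-- For `k > t + 2`, a family of `(t + 2)`-partitions with `t` common blocks is too small. -/
theorem not_isCover_of_lt (h : IsOptimal k (t + 2) t 𝓕 𝓖) (hL : IsLarge n t p) (hk : k ≤ t + p)
    (hk3 : t + 3 ≤ k) {X : Finset (Finset (Fin n))} (hX : X.card = t) : ¬ IsCover t 𝓖 X := by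
  intro hX𝓖
  obtain ⟨h𝓕, h𝓖, hc, hnt⟩ := h.1
  have hp := hL.two_le
  obtain ⟨-, G, hG⟩ := h.card_pos hL hk (by omega) (by omega) le_rfl
  have hGc := (mem_kPartitions.1 (h𝓖 hG)).1
  have h1 : 𝓕.card ≤ (t + 1) ^ 2 * starSize n k t := by
    have := card_le_choose_mul (m := starSize n k t) (T := G) (t := t) (𝓕 := 𝓕)
      (fun F hF => hc.symm G hG F hF) fun H _ hHc => ?_
    · rw [hGc] at this
      exact this.trans (Nat.mul_le_mul_right _ (choose_add_le_pow t 2))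
    · rw [← hHc]
      exact card_starOf_le h𝓕 (by omega)
  have h2 := card_starOf_le_mul_starSize h𝓖 h𝓕 hc.symm hX.ge (by omega)
    fun hcov => hnt.not_isCover hX hcov hX𝓖
  have hpred := hL.starSize_pred (k := t + 2) (by omega) (by omega)
  rw [show t + 2 - 1 = t + 1 by omega] at hpred
  rw [starOf_eq_self ((isCover_iff_subset hX).1 hX𝓖), hX, hpred, mul_one] at h2
  have h3 : 𝓕.card * 𝓖.card < starSize n k (t + 1) * starSize n (t + 2) t := by
    refine lt_of_le_of_lt ?_ (hL.mul_starSize_lt hk hk3)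
    calc 𝓕.card * 𝓖.card ≤ ((t + 1) ^ 2 * starSize n k t) * (k - t) := Nat.mul_le_mul h1 h2
      _ = _ := by ring
  have h4 := h.symm.stdD_le hL (by omega) le_rfl hk (by omega)
  have h5 := hL.ratio_le_one_div
  have h6 := hL.one_le_cast
  have h3' : (𝓕.card : ℝ) * 𝓖.card < starSize n k (t + 1) * starSize n (t + 2) t := by
    exact_mod_cast h3
  have h7 : (1 : ℝ) ≤ ((t : ℝ) + 1) * (1 - 2 / (((t : ℝ) + 1) * (p + 1)) ^ 2) := by nlinarith
  have h8 := mul_le_mul_of_nonneg_right h7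
    (by positivity : (0 : ℝ) ≤ starSize n (t + 2) t * starSize n k (t + 1))
  linarith

theorem mul_starSize_le_card_mul (h : IsOptimal (t + 2) (t + 2) t 𝓕 𝓖) (hL : IsLarge n t p) :
    (t + 1) * starSize n (t + 2) t ≤ 𝓕.card * 𝓖.card + (t + 1) := by
  have hp := hL.two_le
  have h1 := h.2 _ _ (hL.stdD_stdC (k := t + 2) (l := t + 2) (by omega) le_rfl)
  have hpred := hL.starSize_pred (k := t + 2) (by omega) (by omega)
  rw [show t + 2 - 1 = t + 1 by omega] at hpred
  rw [hL.card_stdC (by omega) le_rfl, hpred, mul_one] at h1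
  have h2 := hL.mul_starSize_le_card_stdD (k := t + 2) (by omega) le_rfl
  rw [hpred] at h2
  omega

/-- For `k₁ = k₂ = t + 2 ≥ 4` it is not optimal that `𝓖` has exactly `t` common blocks: then `𝓖`
has at most two members. -/
theorem exists_ne_isCover (h : IsOptimal (t + 2) (t + 2) t 𝓕 𝓖) (hL : IsLarge n t p)
    (ht : 2 ≤ t) {X : Finset (Finset (Fin n))} (hX : X.card = t) (hX𝓖 : IsCover t 𝓖 X) :
    ∃ X', X'.card = t ∧ IsCover t 𝓖 X' ∧ X' ≠ X := by
  by_contra! huniq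
  obtain ⟨h𝓕, h𝓖, hc, hnt⟩ := h.1
  have hp := hL.two_le
  obtain ⟨-, G, hG⟩ := h.card_pos hL (by omega) le_rfl (by omega) le_rfl
  have hGc := (mem_kPartitions.1 (h𝓖 hG)).1
  have hXG := (isCover_iff_subset hX).1 hX𝓖
  have hpred := hL.starSize_pred (k := t + 2) (by omega) (by omega)
  rw [show t + 2 - 1 = t + 1 by omega] at hpred
  have h2 := card_starOf_le_mul_starSize h𝓖 h𝓕 hc.symm hX.ge (by omega)
    fun hcov => hnt.not_isCover hX hcov hX𝓖
  rw [starOf_eq_self hXG, hX, hpred, mul_one, Nat.add_sub_cancel_left] at h2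
  have hmem : X ∈ G.powersetCard t := Finset.mem_powersetCard.2 ⟨hXG G hG, hX⟩
  have h1 : 𝓕.card ≤ starSize n (t + 2) t + (t + 1) ^ 2 * 2 := by
    have hall := card_le_sum_starOf (t := t) (𝓕 := 𝓕) (T := G) fun F hF => hc.symm G hG F hF
    rw [← Finset.add_sum_erase _ _ hmem] at hall
    have hfirst := card_starOf_le h𝓕 (H := X) (by omega)
    rw [hX] at hfirst
    have hrest : ∑ H ∈ (G.powersetCard t).erase X, (starOf 𝓕 H).card ≤ (t + 1) ^ 2 * 2 := by
      refine (Finset.sum_le_card_nsmul _ _ 2 fun H hH => ?_).trans ?_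
      · rw [Finset.mem_erase, Finset.mem_powersetCard] at hH
        have := card_starOf_le_mul_starSize h𝓕 h𝓖 hc hH.2.2.ge (by omega)
          fun hcov => hH.1 (huniq H hH.2.2 hcov)
        rwa [hH.2.2, hpred, mul_one, Nat.add_sub_cancel_left] at this
      · rw [smul_eq_mul]
        refine Nat.mul_le_mul_right _ ((Finset.card_le_card (Finset.erase_subset _ _)).trans ?_)
        rw [Finset.card_powersetCard, hGc]
        exact choose_add_le_pow t 2
    omega
  have h3 := h.mul_starSize_le_card_mul hL
  have h4 := hL.pow_four_le_starSize
  have h5 := Nat.mul_le_mul h1 h2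
  have h6 : 3 * starSize n (t + 2) t ≤ (t + 1) * starSize n (t + 2) t :=
    Nat.mul_le_mul_right _ (by omega)
  have h7 : 4 * (t + 1) ^ 2 + (t + 1) < 81 * (t + 1) ^ 4 := by
    have h8 : (t + 1) ^ 2 ≤ (t + 1) ^ 4 := Nat.pow_le_pow_right (by omega) (by omega)
    have h9 : (t + 1) ^ 1 ≤ (t + 1) ^ 4 := Nat.pow_le_pow_right (by omega) (by omega)
    have h10 : 0 < (t + 1) ^ 4 := pow_pos (by omega) 4
    rw [pow_one] at h9
    omega
  omega

/-- An optimal pair for `k₁ = k₂ = t + 2 ≥ 4` in which `𝓖` has `t` common blocks is `(𝓓, 𝓒)`. -/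
theorem pairIso_of_isCover_of_eq (h : IsOptimal (t + 2) (t + 2) t 𝓕 𝓖) (hL : IsLarge n t p)
    (ht : 2 ≤ t) {X : Finset (Finset (Fin n))} (hX : X.card = t) (hX𝓖 : IsCover t 𝓖 X) :
    PairIso 𝓕 𝓖 (stdD n (t + 2) t) (stdC n (t + 2) t) := by
  classical
  obtain ⟨h𝓕, h𝓖, hc, hnt⟩ := h.1
  have hp := hL.two_le
  have hlt := hL.add_lt
  obtain ⟨-, G, hG⟩ := h.card_pos hL (by omega) le_rfl (by omega) le_rfl
  have hGp := mem_kPartitions.1 (h𝓖 hG)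
  have hXG := (isCover_iff_subset hX).1 hX𝓖
  have hpred := hL.starSize_pred (k := t + 2) (by omega) (by omega)
  rw [show t + 2 - 1 = t + 1 by omega] at hpred
  have hG1 : 𝓖.card ≤ 1 := by
    obtain ⟨X', hX', hX'𝓖, hne⟩ := h.exists_ne_isCover hL ht hX hX𝓖
    have hXG' := (isCover_iff_subset hX').1 hX'𝓖
    obtain ⟨B, hB, hBX⟩ := Finset.not_subset.1 fun hsub =>
      hne (Finset.eq_of_subset_of_card_le hsub (by omega))
    have hc1 : (insert B X).card = t + 1 := by rw [Finset.card_insert_of_notMem hBX, hX]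
    have := card_starOf_le h𝓖 (H := insert B X) (by omega)
    rwa [hc1, hpred,
      starOf_eq_self fun G hG => Finset.insert_subset (hXG' G hG hB) (hXG G hG)] at this
  have hGcov : IsCover t 𝓕 G := fun F hF => hc.symm G hG F hF
  obtain ⟨D, hD, hmax⟩ := Finset.exists_max_image G Finset.card
    (Finset.card_pos.1 (by omega))
  have hTc : (G.erase D).card = t + 1 := by rw [Finset.card_erase_of_mem hD, hGp.1]; omega
  by_cases hsing : ∀ B ∈ G.erase D, B.card = 1
  · refine h.pairIso_stdD hL (by omega) le_rfl (by omega) le_rfl hsing hTc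
      (isCover_erase_of_singletons h𝓕 (h𝓖 hG) hGcov hsing) fun G' hG' => ?_
    rw [Finset.card_le_one.1 hG1 G' hG' G hG]
    exact Finset.erase_subset _ _
  exfalso
  push Not at hsing
  obtain ⟨C, hC, hC1⟩ := hsing
  set N := starSize n (t + 2) t with hN
  have hsplit := Finset.card_filter_add_card_filter_not (s := 𝓕)
    (fun F => t ≤ (G.erase D ∩ F).card)
  have h1 : 2 * (𝓕.filter fun F => t ≤ (G.erase D ∩ F).card).card ≤ (t + 2) * N := by
    have hmem : (G.erase D).erase C ∈ (G.erase D).powersetCard t := Finset.mem_powersetCard.2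
      ⟨Finset.erase_subset _ _, by rw [Finset.card_erase_of_mem hC]; omega⟩
    have hall := card_le_sum_starOf (t := t)
      (𝓕 := 𝓕.filter fun F => t ≤ (G.erase D ∩ F).card) (T := G.erase D)
      fun F hF => (Finset.mem_filter.1 hF).2
    have hsub : (𝓕.filter fun F => t ≤ (G.erase D ∩ F).card) ⊆ kPartitions n (t + 2) :=
      (Finset.filter_subset _ _).trans h𝓕
    rw [← Finset.add_sum_erase _ _ hmem] at hall
    have hfirst := card_starOf_le hsub (H := (G.erase D).erase C) (by
      rw [Finset.card_erase_of_mem hC]; omega)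
    rw [Finset.card_erase_of_mem hC, hTc, Nat.add_sub_cancel] at hfirst
    have hrest : ∑ H ∈ ((G.erase D).powersetCard t).erase ((G.erase D).erase C),
        2 * (starOf (𝓕.filter fun F => t ≤ (G.erase D ∩ F).card) H).card ≤ t * N := by
      have hcard : (((G.erase D).powersetCard t).erase ((G.erase D).erase C)).card = t := by
        rw [Finset.card_erase_of_mem hmem, Finset.card_powersetCard, hTc,
          Nat.choose_succ_self_right, Nat.add_sub_cancel]
      refine (Finset.sum_le_card_nsmul _ _ N fun H hH => ?_).trans
        (by rw [hcard, smul_eq_mul])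
      rw [Finset.mem_erase, Finset.mem_powersetCard] at hH
      have hCH : C ∈ H := by
        by_contra hCH
        refine hH.1 (Finset.eq_of_subset_of_card_le (Finset.subset_erase.2 ⟨hH.2.1, hCH⟩) ?_)
        rw [Finset.card_erase_of_mem hC]
        omega
      have := two_mul_card_starOf_le hsub (H := H) (by omega) (by omega) ⟨C, hCH, hC1⟩
      rwa [hH.2.2] at this
    rw [← Finset.mul_sum] at hrest
    have : (t + 2) * N = 2 * N + t * N := by ring
    omega
  have h2 : 4 * (𝓕.filter fun F => ¬ t ≤ (G.erase D ∩ F).card).card ≤ t * N := by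
    have hsub : (𝓕.filter fun F => ¬ t ≤ (G.erase D ∩ F).card) ⊆
        ((G.erase D).powersetCard (t - 1)).biUnion
          fun J => starOf (kPartitions n (t + 2)) (insert D J) := by
      intro F hF
      rw [Finset.mem_filter] at hF
      have hFG := hGcov F hF.1
      have herase : (G.erase D) ∩ F = (G ∩ F).erase D := Finset.erase_inter D G F
      have hDF : D ∈ G ∩ F := by
        by_contra hcon
        rw [herase, Finset.erase_eq_of_notMem hcon] at hF
        exact hF.2 hFG
      have hle : t - 1 ≤ (G.erase D ∩ F).card := by
        rw [herase, Finset.card_erase_of_mem hDF]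
        omega
      obtain ⟨J, hJ, hJc⟩ := Finset.exists_subset_card_eq hle
      rw [Finset.subset_inter_iff] at hJ
      exact Finset.mem_biUnion.2 ⟨J, Finset.mem_powersetCard.2 ⟨hJ.1, hJc⟩,
        mem_starOf.2 ⟨h𝓕 hF.1, Finset.insert_subset (Finset.mem_inter.1 hDF).2 hJ.2⟩⟩
    have hcard := (Finset.card_le_card hsub).trans Finset.card_biUnion_le
    have hterm : ∀ J ∈ (G.erase D).powersetCard (t - 1),
        2 * (t + 1) * (starOf (kPartitions n (t + 2)) (insert D J)).card ≤ N := by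
      intro J hJ
      rw [Finset.mem_powersetCard] at hJ
      refine two_mul_card_starOf_le_of_max hL (h𝓖 hG) hmax
        (Finset.insert_subset hD (hJ.1.trans (Finset.erase_subset _ _)))
        (Finset.mem_insert_self _ _) ?_
      rw [Finset.card_insert_of_notMem fun hDJ => Finset.notMem_erase D G (hJ.1 hDJ), hJ.2]
      omega
    have hsum := Finset.sum_le_card_nsmul _ _ N hterm
    rw [← Finset.mul_sum, Finset.card_powersetCard, hTc, smul_eq_mul] at hsum
    have hchoose : 2 * (t + 1).choose (t - 1) = (t + 1) * t := by
      rw [← Nat.choose_symm (by omega), show t + 1 - (t - 1) = 2 by omega, Nat.choose_two_right,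
        Nat.add_sub_cancel]
      exact Nat.mul_div_cancel' (by rw [mul_comm]; exact (Nat.even_mul_succ_self t).two_dvd)
    refine Nat.le_of_mul_le_mul_left ?_ (Nat.succ_pos t)
    calc (t + 1) * (4 * (𝓕.filter fun F => ¬ t ≤ (G.erase D ∩ F).card).card)
        ≤ (t + 1) * (4 * ∑ J ∈ (G.erase D).powersetCard (t - 1),
            (starOf (kPartitions n (t + 2)) (insert D J)).card) := by gcongr
      _ = 2 * (2 * (t + 1) * ∑ J ∈ (G.erase D).powersetCard (t - 1),
            (starOf (kPartitions n (t + 2)) (insert D J)).card) := by ring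
      _ ≤ 2 * ((t + 1).choose (t - 1) * N) := Nat.mul_le_mul_left _ hsum
      _ = (t + 1) * (t * N) := by rw [← mul_assoc, hchoose, mul_assoc]
  have h3 := h.mul_starSize_le_card_mul hL
  have h4 := hL.pow_four_le_starSize
  rw [← hN] at h3 h4
  have h5 : 𝓕.card * 𝓖.card ≤ 𝓕.card := by
    simpa using Nat.mul_le_mul_left 𝓕.card hG1
  have h6 : 4 * (t + 1) < t * N := by
    have h9 : (t + 1) ^ 1 ≤ (t + 1) ^ 4 := Nat.pow_le_pow_right (by omega) (by omega)
    rw [pow_one] at h9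
    have : N ≤ t * N := Nat.le_mul_of_pos_left _ (by omega)
    omega
  have e1 : (t + 1) * N = t * N + N := by ring
  have e2 : (t + 2) * N = t * N + 2 * N := by ring
  omega

end IsOptimal

/-! ### Neither family has `t` common blocks -/

namespace IsOptimal

variable {n k l t p : ℕ} {𝓕 𝓖 : PartFamily n}

/-- The stars of each family are bounded through a smallest cover of the other one, and the number
of stars through a smallest cover of the family itself. -/
theorem card_mul_card_le_of_minimal_covers (h : IsOptimal k l t 𝓕 𝓖) (hk : k ≤ t + p)
    (hk2 : t + 2 ≤ k) (hl : l ≤ t + p) (hl2 : t + 2 ≤ l) {T₁ T₂ : Finset (Finset (Fin n))}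
    (hT₁ : IsCover t 𝓕 T₁) (hT₁min : ∀ T', T'.card < T₁.card → ¬ IsCover t 𝓕 T')
    (hT₁t : t ≤ T₁.card)
    (hT₂ : IsCover t 𝓖 T₂) (hT₂min : ∀ T', T'.card < T₂.card → ¬ IsCover t 𝓖 T')
    (hT₂t : t ≤ T₂.card) :
    𝓕.card * 𝓖.card ≤
      (T₁.card.choose t * p ^ (min T₁.card (l - 1) - t) * starSize n l (min T₁.card (l - 1))) *
      (T₂.card.choose t * p ^ (min T₂.card (k - 1) - t) * starSize n k (min T₂.card (k - 1))) := by
  obtain ⟨h𝓕, h𝓖, hc, hnt⟩ := h.1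
  have h1 : 𝓕.card ≤ T₁.card.choose t *
      (p ^ (min T₂.card (k - 1) - t) * starSize n k (min T₂.card (k - 1))) := by
    refine card_le_choose_mul hT₁ fun H _ hHc => ?_
    have := card_starOf_le_pow_mul (s := min T₂.card (k - 1)) h𝓕 h𝓖 hc
      (fun T' hT' => hT₂min T' (lt_of_lt_of_le hT' (min_le_left _ _))) (by omega) hHc.ge (by omega)
    rw [hHc] at this
    exact this.trans (Nat.mul_le_mul_right _ (Nat.pow_le_pow_left (by omega) _))
  have h2 : 𝓖.card ≤ T₂.card.choose t *
      (p ^ (min T₁.card (l - 1) - t) * starSize n l (min T₁.card (l - 1))) := by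
    refine card_le_choose_mul hT₂ fun H _ hHc => ?_
    have := card_starOf_le_pow_mul (s := min T₁.card (l - 1)) h𝓖 h𝓕 hc.symm
      (fun T' hT' => hT₁min T' (lt_of_lt_of_le hT' (min_le_left _ _))) (by omega) hHc.ge (by omega)
    rw [hHc] at this
    exact this.trans (Nat.mul_le_mul_right _ (Nat.pow_le_pow_left (by omega) _))
  exact (Nat.mul_le_mul h1 h2).trans (le_of_eq (by ring))

/-- In an optimal pair one of the families has `t` common blocks: otherwise the smallest covers of
both families have more than `t` blocks, and both families are too small. -/
theorem exists_isCover (h : IsOptimal k l t 𝓕 𝓖) (hL : IsLarge n t p) (hk : k ≤ t + p)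
    (hlk : l ≤ k) (hl2 : t + 2 ≤ l) :
    (∃ X, X.card = t ∧ IsCover t 𝓕 X) ∨ ∃ X, X.card = t ∧ IsCover t 𝓖 X := by
  by_contra! hno
  obtain ⟨hno𝓕, hno𝓖⟩ := hno
  have ⟨h𝓕, h𝓖, hc, hnt⟩ := h.1
  have hl : l ≤ t + p := hlk.trans hk
  have hk2 : t + 2 ≤ k := hl2.trans hlk
  obtain ⟨h𝓕0, h𝓖0⟩ := h.card_pos hL hk hk2 hl hl2
  obtain ⟨T₁, hT₁, hT₁l, hT₁min⟩ := exists_minimal_cover h𝓖 hc h𝓖0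
  obtain ⟨T₂, hT₂, hT₂k, hT₂min⟩ := exists_minimal_cover h𝓕 hc.symm h𝓕0
  have hT₁t := hT₁.le_card h𝓕0
  have hT₂t := hT₂.le_card h𝓖0
  have hT₁ne : T₁.card ≠ t := fun he => hno𝓕 T₁ he hT₁
  have hT₂ne : T₂.card ≠ t := fun he => hno𝓖 T₂ he hT₂
  have hprod := h.card_mul_card_le_of_minimal_covers hk hk2 hl hl2 hT₁ hT₁min hT₁t hT₂ hT₂min hT₂t
  have hp := hL.two_le
  have h6 := hL.six_le
  rcases hk2.eq_or_lt with rfl | hk3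
  · obtain rfl : l = t + 2 := le_antisymm hlk hl2
    have hpred := hL.starSize_pred (k := t + 2) hk (by omega)
    rw [show t + 2 - 1 = t + 1 by omega] at hpred hprod
    have hbound : ∀ T : Finset (Finset (Fin n)), T.card ≤ t + 2 → t ≤ T.card → T.card ≠ t →
        T.card.choose t * p ^ (min T.card (t + 1) - t) *
          starSize n (t + 2) (min T.card (t + 1)) ≤ (t + 1) ^ 2 * p := by
      intro T hT hTt hTne
      rw [show min T.card (t + 1) = t + 1 by omega, hpred, Nat.add_sub_cancel_left, pow_one,
        mul_one]
      exact Nat.mul_le_mul_right _ ((Nat.choose_le_choose t hT).trans (choose_add_le_pow t 2))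
    have h1 := hprod.trans
      (Nat.mul_le_mul (hbound T₁ hT₁l hT₁t hT₁ne) (hbound T₂ hT₂k hT₂t hT₂ne))
    have h2 := h.mul_starSize_le_card_mul hL
    have h3 := hL.pow_le_starSize_sub_two (k := t + 2) hk (by omega)
    rw [Nat.add_sub_cancel] at h3
    have h4 : ((t + 1) * (p + 1)) ^ 4 ≤ starSize n (t + 2) t :=
      le_trans (Nat.pow_le_pow_right (by omega) (by omega)) h3
    have h5 : 2 * starSize n (t + 2) t ≤ (t + 1) * starSize n (t + 2) t :=
      Nat.mul_le_mul_right _ (by have := hL.one_le; omega)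
    have h7 : (t + 1) ^ 2 * p * ((t + 1) ^ 2 * p) ≤ ((t + 1) * (p + 1)) ^ 4 := by
      calc (t + 1) ^ 2 * p * ((t + 1) ^ 2 * p) = (t + 1) ^ 4 * p ^ 2 := by ring
        _ ≤ (t + 1) ^ 4 * (p + 1) ^ 4 := Nat.mul_le_mul_left _
            ((Nat.pow_le_pow_left (Nat.le_succ p) 2).trans
              (Nat.pow_le_pow_right (Nat.succ_pos p) (by norm_num)))
        _ = _ := (mul_pow _ _ _).symm
    have h8 : t + 1 < ((t + 1) * (p + 1)) ^ 4 := by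
      have h9 : ((t + 1) * (p + 1)) ^ 1 ≤ ((t + 1) * (p + 1)) ^ 4 :=
        Nat.pow_le_pow_right (by omega) (by norm_num)
      have h10 : (t + 1) * 2 ≤ (t + 1) * (p + 1) := Nat.mul_le_mul_left _ (by omega)
      rw [pow_one] at h9
      omega
    omega
  · have h1 := hL.choose_mul_le_ratio_mul hl hl2 (by omega : t + 1 ≤ T₁.card) hT₁l
    have h2 := hL.choose_mul_le_mul hk hk3 (by omega : t + 1 ≤ T₂.card) hT₂k
    have h3 := h.symm.stdD_le hL hl hl2 hk hk2
    have hprod' : (𝓖.card : ℝ) * 𝓕.card ≤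
        ((T₁.card.choose t * p ^ (min T₁.card (l - 1) - t) *
          starSize n l (min T₁.card (l - 1)) : ℕ) : ℝ) *
        ((T₂.card.choose t * p ^ (min T₂.card (k - 1) - t) *
          starSize n k (min T₂.card (k - 1)) : ℕ) : ℝ) := by
      rw [mul_comm]
      exact_mod_cast hprod
    have ht1 := hL.one_le_cast
    have hp2 := hL.two_le_cast
    have p1 : (0 : ℝ) < starSize n l t := by exact_mod_cast hL.starSize_pos hl (s := t) (by omega)
    have p2 : (0 : ℝ) < starSize n k (t + 1) := by
      exact_mod_cast hL.starSize_pos hk (s := t + 1) (by omega)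
    have hQ : (0 : ℝ) < (((t : ℝ) + 1) * (p + 1)) ^ 2 := by positivity
    have hlt : (((t : ℝ) + 1) * p) ^ 2 * (2 / (((t : ℝ) + 1) * (p + 1)) ^ 2) <
        2 * (1 - 2 / (((t : ℝ) + 1) * (p + 1)) ^ 2) := by
      rw [mul_div_assoc', div_lt_iff₀ hQ, mul_assoc, sub_mul, one_mul, div_mul_cancel₀ _ hQ.ne']
      nlinarith [mul_pos (by positivity : (0 : ℝ) < (t : ℝ) + 1)
        (by positivity : (0 : ℝ) < (t : ℝ) + 1)]
    have hr := hL.ratio_le_one_div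
    set r := 2 / (((t : ℝ) + 1) * (p + 1)) ^ 2 with hrdef
    have hr0 : 0 < r := by positivity
    have h4 : (𝓖.card : ℝ) * 𝓕.card ≤
        ((((t : ℝ) + 1) * p) ^ 2 * r) * (starSize n l t * starSize n k (t + 1)) := by
      calc (𝓖.card : ℝ) * 𝓕.card
          ≤ (((t : ℝ) + 1) * p * r * starSize n l t) *
              (((t : ℝ) + 1) * p * starSize n k (t + 1)) :=
            hprod'.trans (mul_le_mul h1 h2 (Nat.cast_nonneg _) (by positivity))
        _ = _ := by ring
    have h5 := le_of_mul_le_mul_right (h3.trans h4) (mul_pos p1 p2)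
    nlinarith

end IsOptimal

/-! ### The optimal pairs -/

theorem PairIso.symm {n : ℕ} {𝓕 𝓖 𝓕' 𝓖' : PartFamily n} (h : PairIso 𝓕 𝓖 𝓕' 𝓖') :
    PairIso 𝓖 𝓕 𝓖' 𝓕' := by
  obtain ⟨σ, h1, h2⟩ := h
  exact ⟨σ, h2, h1⟩

theorem theorem1p4 (n k₁ k₂ t : ℕ) (ht : 1 ≤ t) (hk₂ : t + 2 ≤ k₂) (hk₁ : k₂ ≤ k₁)
    (hne : (k₁, k₂) ≠ (3, 3)) (hn : 2 * boundL k₁ t ≤ (n : ℝ))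
    (𝓕₁ 𝓕₂ : PartFamily n)
    (hF : IsNonTrivialCross k₁ k₂ t 𝓕₁ 𝓕₂)
    (hmax : ∀ 𝓖₁ 𝓖₂ : PartFamily n, IsNonTrivialCross k₁ k₂ t 𝓖₁ 𝓖₂ →
      𝓖₁.card * 𝓖₂.card ≤ 𝓕₁.card * 𝓕₂.card) :
    PairIso 𝓕₁ 𝓕₂ (stdA n k₁ k₂ t) (stdB n k₂ t) ∨
    PairIso 𝓕₁ 𝓕₂ (stdB n k₁ t) (stdA n k₂ k₁ t) ∨
    PairIso 𝓕₁ 𝓕₂ (stdC n k₁ t) (stdD n k₂ t) ∨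
    PairIso 𝓕₁ 𝓕₂ (stdD n k₁ t) (stdC n k₂ t) := by
  obtain ⟨p, rfl⟩ : ∃ p, k₁ = t + p := Nat.exists_eq_add_of_le (by omega)
  have hL : IsLarge n t p := isLarge_of_boundL ht (by omega) (by exact_mod_cast hn)
  have h : IsOptimal (t + p) k₂ t 𝓕₁ 𝓕₂ := ⟨hF, hmax⟩
  rcases h.exists_isCover hL le_rfl hk₁ hk₂ with ⟨X, hX, hcov⟩ | ⟨X, hX, hcov⟩
  -- `𝓕₁` has `t` common blocks: the lemmas are applied to the pair `(𝓕₂, 𝓕₁)`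
  · rcases (hk₂.trans hk₁).eq_or_lt with he | hk3
    · obtain rfl : k₂ = t + 2 := by omega
      obtain rfl : p = 2 := by omega
      have ht2 : 2 ≤ t := by
        by_contra! hlt
        obtain rfl : t = 1 := by omega
        exact hne rfl
      exact Or.inr (Or.inr (Or.inl (h.symm.pairIso_of_isCover_of_eq hL ht2 hX hcov).symm))
    · rcases h.symm.pairIso_of_isCover hL hk₁ hk₂ le_rfl hk3 hX hcov with h1 | h1
      · exact Or.inl h1.symm
      · exact Or.inr (Or.inr (Or.inl h1.symm))
  · rcases hk₂.eq_or_lt with rfl | hk3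
    · rcases hk₁.eq_or_lt with he | hlt
      · obtain rfl : p = 2 := by omega
        have ht2 : 2 ≤ t := by
          by_contra! hlt
          obtain rfl : t = 1 := by omega
          exact hne rfl
        exact Or.inr (Or.inr (Or.inr (h.pairIso_of_isCover_of_eq hL ht2 hX hcov)))
      · exact absurd hcov (h.not_isCover_of_lt hL le_rfl hlt hX)
    · rcases h.pairIso_of_isCover hL le_rfl (hk₂.trans hk₁) hk₁ hk3 hX hcov with h1 | h1
      · exact Or.inr (Or.inl h1)
      · exact Or.inr (Or.inr (Or.inr h1))
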